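/- For $n\ge 1$ and $d\ge 0$, the transitive $d$-simultaneous conjugacy problem in $S_n$ is the following decision problem. The input consists of $n$, $d$ and two $d$-tuples $(a_1,\dots,a_d)$ and $(b_1,\dots,b_d)$ of permutations in $S_n$ (each permutation given by the list of its $n$ images), such that $a_1,\dots,a_d$ generate a transitive subgroup of $S_n$ and so do $b_1,\dots,b_d$. The question is whether there is a $\tau\in S_n$ with $b_j=\tau^{-1}a_j\tau$ for all $j=1,\dots,d$. Theorem. The transitive $d$-simultaneous conjugacy problem in $S_n$ can be solved in $$O\!\left(\frac{n^2\log d}{\log n}+dn\log n\right)$$ time, using $O(n^{3/2}+dn)$ space. Here the model of computation is the unit-cost RAM with $w$-bit words, where the words are long enough to address the memory; time is the number of executed steps and space the number of memory cells. Precisely: there are a single program $P$ (independent of $n$, $d$ and $w$) and a constant $C>0$ such that, for all $n\ge 1$, $d\ge 0$, every input as above, and every $w$ with $2^w\ge C(n^{3/2}+dn)$, the program $P$ halts on this input with the correct answer ($1$ for yes, $0$ for no), accesses only the first $S$ memory cells for some $S\le C(n^{3/2}+dn)$ (the input being stored in memory from cell $0$ on) and, if $n\ge 2$, makes at most $C\,(n^2\log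 d/\log n+dn\log n)$ steps. -/

import Mathlib

/-! ### The word RAM

A random access machine with `w`-bit words. It has finitely many registers that a program can name
and a memory of `w`-bit cells, addressed by words. A program is a fixed finite object that does not
depend on the input or on `w`; control flow is structured, which is a restriction of jumps. -/

namespace WordRAM

/-- Binary operations on words, modulo `2 ^ w`; `div` and `mod` are those of unsigned integers. -/
inductive Op
  | add | sub | mul | div | mod

/-- The value of a binary operation on two words. -/
def Op.eval {w : ℕ} : Op → BitVec w → BitVec w → BitVec w
  | .add, x, y => x + y
  | .sub, x, y => x - y
  | .mul, x, y => x * y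
  | .div, x, y => x / y
  | .mod, x, y => x % y

/-- The unit-cost instructions. Registers are named by natural numbers. -/
inductive Instr
  /-- `r := k` for a literal `k` -/
  | const (r k : ℕ)
  /-- `r := x` -/
  | copy (r x : ℕ)
  /-- `r := x o y` -/
  | op (o : Op) (r x y : ℕ)
  /-- `r := mem[x]`, the address being the content of register `x` -/
  | load (r x : ℕ)
  /-- `mem[x] := y`, the address being the content of register `x` -/
  | store (x y : ℕ)

/-- Tests on the contents of two registers (words are compared as unsigned integers). -/
inductive Test
  | lt (x y : ℕ)
  | eq (x y : ℕ)

/-- Programs with structured control flow. -/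
inductive Program
  | skip
  | instr (i : Instr)
  | seq (p q : Program)
  | branch (c : Test) (p q : Program)
  | loop (c : Test) (p : Program)

/-- A state of the machine: the contents of the registers and of the memory cells. -/
structure State (w : ℕ) where
  reg : ℕ → BitVec w
  mem : ℕ → BitVec w

/-- The state after writing the word `v` into register `r`. -/
def State.setReg {w : ℕ} (s : State w) (r : ℕ) (v : BitVec w) : State w :=
  { s with reg := Function.update s.reg r v }

/-- The state after writing the word `v` into memory cell `j`. -/
def State.setMem {w : ℕ} (s : State w) (j : ℕ) (v : BitVec w) : State w :=
  { s with mem := Function.update s.mem j v }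

/-- The truth of a test in a state. -/
def Test.Holds {w : ℕ} (s : State w) : Test → Prop
  | .lt x y => s.reg x < s.reg y
  | .eq x y => s.reg x = s.reg y

/-- `Step S i s s'`: on a machine with the memory cells `0, …, S - 1`, the instruction `i` leads from
`s` to `s'`. An access to any other cell has no successor state. -/
inductive Step {w : ℕ} (S : ℕ) : Instr → State w → State w → Prop
  | const (r k : ℕ) (s : State w) :
      Step S (.const r k) s (s.setReg r (BitVec.ofNat w k))
  | copy (r x : ℕ) (s : State w) :
      Step S (.copy r x) s (s.setReg r (s.reg x))
  | op (o : Op) (r x y : ℕ) (s : State w) :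
      Step S (.op o r x y) s (s.setReg r (o.eval (s.reg x) (s.reg y)))
  | load (r x : ℕ) (s : State w) (h : (s.reg x).toNat < S) :
      Step S (.load r x) s (s.setReg r (s.mem (s.reg x).toNat))
  | store (x y : ℕ) (s : State w) (h : (s.reg x).toNat < S) :
      Step S (.store x y) s (s.setMem (s.reg x).toNat (s.reg y))

/-- `Exec S p s t s'`: on a machine with `S` memory cells, the program `p` started in the state `s`
halts after exactly `t` steps in the state `s'`. Every instruction and every evaluation of a test
is one step. -/
inductive Exec {w : ℕ} (S : ℕ) : Program → State w → ℕ → State w → Prop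
  | skip (s : State w) : Exec S .skip s 0 s
  | instr {i : Instr} {s s' : State w} (h : Step S i s s') : Exec S (.instr i) s 1 s'
  | seq {p q : Program} {s s' s'' : State w} {t t' : ℕ}
      (hp : Exec S p s t s') (hq : Exec S q s' t' s'') : Exec S (.seq p q) s (t + t') s''
  | branch_true {c : Test} {p q : Program} {s s' : State w} {t : ℕ}
      (hc : c.Holds s) (hp : Exec S p s t s') : Exec S (.branch c p q) s (t + 1) s'
  | branch_false {c : Test} {p q : Program} {s s' : State w} {t : ℕ}
      (hc : ¬ c.Holds s) (hq : Exec S q s t s') : Exec S (.branch c p q) s (t + 1) s'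
  | loop_true {c : Test} {p : Program} {s s' s'' : State w} {t t' : ℕ}
      (hc : c.Holds s) (hp : Exec S p s t s') (hl : Exec S (.loop c p) s' t' s'') :
      Exec S (.loop c p) s (t + t' + 1) s''
  | loop_false {c : Test} {p : Program} {s : State w}
      (hc : ¬ c.Holds s) : Exec S (.loop c p) s 1 s

end WordRAM

/-! ### The simultaneous conjugacy problem -/

/-- The tuple `b` is conjugate to the tuple `a` by a single element of the group. -/
def SimultaneouslyConjugate {G : Type*} [Group G] {d : ℕ} (a b : Fin d → G) : Prop :=
  ∃ τ : G, ∀ j, b j = τ⁻¹ * a j * τ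

/-- The permutations in the tuple generate a transitive subgroup of the symmetric group. -/
def GeneratesTransitive {n d : ℕ} (a : Fin d → Equiv.Perm (Fin n)) : Prop :=
  MulAction.IsPretransitive (Subgroup.closure (Set.range a)) (Fin n)

/-- A tuple of permutations as `d * n` numbers: entry `k * n + i` is the image of `i` under the
`k`-th permutation. -/
def tupleWords {n d : ℕ} (a : Fin d → Equiv.Perm (Fin n)) : List ℕ :=
  List.ofFn fun j : Fin (d * n) => (a j.divNat j.modNat : ℕ)

/-- The initial state for a pair of tuples: the memory holds `n`, `d` and the two tuples, one number
per cell, from cell `0` on; all other cells and all registers are `0`. -/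
def scpInput (w : ℕ) {n d : ℕ} (a b : Fin d → Equiv.Perm (Fin n)) : WordRAM.State w where
  reg := fun _ => 0
  mem := fun j => BitVec.ofNat w ((n :: d :: (tupleWords a ++ tupleWords b)).getD j 0)

/-! Let the first tuple act on the points below `n` and the second on the points from `n` to `2 * n
- 1` (`pairAct`). A conjugating permutation is then the inverse of an isomorphism between the two
actions (`exists_isIso_pairAct`). By transitivity, every equivariant map from left to right is
bijective (`Acts.isIso`) and is determined by the image of one point. A breadth-first search in
O(dn) steps therefore decides whether `u ↦ v` extends to an isomorphism (`bfsStm_spec`).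

Trying all images `v` of one point `u` would be too slow, so a failed search is exploited. It
exhibits an edge that the attempted map does not respect, and hence two words in the generators that
agree at `u` but not at `v` (`wordsStm_spec`). Every isomorphism commutes with words, so it
preserves the set of points where two words agree (`IsIso.agree_iff`). The algorithm keeps a set of
candidates that every isomorphism preserves, with `m` points on each side. The two words split it
into an agreeing and a differing part. If the sizes on the two sides do not match, there is no
isomorphism. Otherwise both parts are nonempty, and the smaller one, with at most `m / 2` points, is
the new set of candidates (`splitStm_spec`). There are O(log n) rounds, whose searches cost O(dn log
n).

The words may have `n` letters and have to be evaluated at `2 * m` points. For speed, the maps of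
the first `sq + d + 1` words, with `sq` the rounded-up square root of `n`, are tabulated in
O(n^{3/2} + dn) cells. A long word is cut into at most `n / ℓ + 1` tabulated words, where `ℓ` is at
least a constant times log n / log d (`pathStm_spec`, `exists_wordLength`). A round evaluates words
in O(m n / ℓ) steps, and `m` halves each time. The sum is geometric and amounts to O(n² log d / log
n) (`roundsStm_spec`).

The algorithm is written in a small structured language with a compiler to the machine. `Tri` is a
total-correctness triple with a time bound over states of natural numbers, in which the absence of
overflow and the validity of addresses are proof obligations. If `n ≤ 1` or `d ≤ 1`, the answer is
always yes. -/

set_option linter.unusedSimpArgs false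

namespace WordRAM

/-! ### A small language with expressions, compiled to the word RAM -/

/-- Registers below this bound are variables, the others hold intermediate results. -/
abbrev scratch : ℕ := 64

/-- Expressions over the registers and the memory. -/
inductive Ex
  | lit (k : ℕ)
  | reg (r : ℕ)
  | op (o : Op) (e f : Ex)
  | ld (e : Ex)

/-- Conditions. -/
inductive Cond
  | lt (e f : Ex)
  | eq (e f : Ex)

/-- Statements. -/
inductive Stm
  | skip
  | assign (r : ℕ) (e : Ex)
  | store (e f : Ex)
  | seq (p q : Stm)
  | ite (c : Cond) (p q : Stm)
  | whileDo (c : Cond) (p : Stm)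

/-- The code that puts the value of an expression into register `t`. -/
def Ex.compile (t : ℕ) : Ex → Program
  | .lit k => .instr (.const t k)
  | .reg r => .instr (.copy t r)
  | .op o e f => .seq (e.compile t) (.seq (f.compile (t + 1)) (.instr (.op o t t (t + 1))))
  | .ld e => .seq (e.compile t) (.instr (.load t t))

def Ex.cost : Ex → ℕ
  | .lit _ => 1
  | .reg _ => 1
  | .op _ e f => e.cost + (f.cost + 1)
  | .ld e => e.cost + 1

def Cond.compile : Cond → Program
  | .lt e f => .seq (e.compile scratch) (f.compile (scratch + 1))
  | .eq e f => .seq (e.compile scratch) (f.compile (scratch + 1))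

def Cond.test : Cond → Test
  | .lt _ _ => .lt scratch (scratch + 1)
  | .eq _ _ => .eq scratch (scratch + 1)

def Cond.cost : Cond → ℕ
  | .lt e f => e.cost + f.cost
  | .eq e f => e.cost + f.cost

/-- A machine test only compares two registers. The operands of a loop condition are therefore
computed before the loop and again at the end of each pass. -/
def Stm.compile : Stm → Program
  | .skip => .skip
  | .assign r e => .seq (e.compile scratch) (.instr (.copy r scratch))
  | .store e f =>
    .seq (e.compile scratch) (.seq (f.compile (scratch + 1)) (.instr (.store scratch (scratch + 1))))
  | .seq p q => .seq p.compile q.compile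
  | .ite c p q => .seq c.compile (.branch c.test p.compile q.compile)
  | .whileDo c p => .seq c.compile (.loop c.test (.seq p.compile c.compile))

/-! ### Semantics over the natural numbers -/

/-- Machine states over the natural numbers, without the intermediate results. -/
@[ext] structure NState where
  reg : ℕ → ℕ
  mem : ℕ → ℕ

def NState.set (s : NState) (r v : ℕ) : NState := ⟨Function.update s.reg r v, s.mem⟩

def NState.put (s : NState) (k v : ℕ) : NState := ⟨s.reg, Function.update s.mem k v⟩

@[simp] theorem NState.set_reg (s : NState) (r v q : ℕ) :
    (s.set r v).reg q = if q = r then v else s.reg q := by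
  simp [NState.set, Function.update_apply]

@[simp] theorem NState.set_mem (s : NState) (r v : ℕ) : (s.set r v).mem = s.mem := rfl

@[simp] theorem NState.put_reg (s : NState) (k v : ℕ) : (s.put k v).reg = s.reg := rfl

theorem NState.put_mem (s : NState) (k v q : ℕ) :
    (s.put k v).mem q = if q = k then v else s.mem q := by
  simp [NState.put, Function.update_apply]

theorem NState.put_mem_self (s : NState) (k v : ℕ) : (s.put k v).mem k = v := by
  simp [NState.put_mem]

theorem NState.put_mem_ne (s : NState) {k v q : ℕ} (h : q ≠ k) :
    (s.put k v).mem q = s.mem q := by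
  simp [NState.put_mem, h]

/-- The natural numbers in a machine state. -/
def State.toNat {w : ℕ} (s : State w) : NState :=
  ⟨fun r => if r < scratch then (s.reg r).toNat else 0, fun k => (s.mem k).toNat⟩

def Op.nat : Op → ℕ → ℕ → ℕ
  | .add, x, y => x + y
  | .sub, x, y => x - y
  | .mul, x, y => x * y
  | .div, x, y => x / y
  | .mod, x, y => x % y

/-- No overflow occurs. -/
def Op.Ok (B : ℕ) : Op → ℕ → ℕ → Prop
  | .add, x, y => x + y < B
  | .sub, x, y => y ≤ x
  | .mul, x, y => x * y < B
  | .div, _, _ => True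
  | .mod, _, _ => True

theorem Op.toNat_eval {w : ℕ} (o : Op) (x y : BitVec w) (h : o.Ok (2 ^ w) x.toNat y.toNat) :
    (o.eval x y).toNat = o.nat x.toNat y.toNat := by
  cases o <;> simp only [Op.eval, Op.nat, Op.Ok] at h ⊢
  · rw [BitVec.toNat_add, Nat.mod_eq_of_lt h]
  · exact BitVec.toNat_sub_of_le h
  · rw [BitVec.toNat_mul, Nat.mod_eq_of_lt h]
  · exact BitVec.toNat_udiv
  · exact BitVec.toNat_umod

def Ex.val (s : NState) : Ex → ℕ
  | .lit k => k
  | .reg r => s.reg r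
  | .op o e f => o.nat (e.val s) (f.val s)
  | .ld e => s.mem (e.val s)

/-- The expression can be evaluated with words below `B` and addresses below `S`. -/
def Ex.Ok (B S : ℕ) (s : NState) : Ex → Prop
  | .lit k => k < B
  | .reg r => r < scratch
  | .op o e f => e.Ok B S s ∧ f.Ok B S s ∧ o.Ok B (e.val s) (f.val s)
  | .ld e => e.Ok B S s ∧ e.val s < S

def Cond.Holds (s : NState) : Cond → Prop
  | .lt e f => e.val s < f.val s
  | .eq e f => e.val s = f.val s

def Cond.Ok (B S : ℕ) (s : NState) : Cond → Prop
  | .lt e f => e.Ok B S s ∧ f.Ok B S s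
  | .eq e f => e.Ok B S s ∧ f.Ok B S s

theorem State.toNat_congr {w : ℕ} {s s' : State w} (hm : s'.mem = s.mem)
    (hr : ∀ r < scratch, s'.reg r = s.reg r) : s'.toNat = s.toNat := by
  ext r
  · simp only [State.toNat]
    split_ifs with h
    · rw [hr r h]
    · rfl
  · simp [State.toNat, hm]

/-- The registers from `t` on serve as an evaluation stack. Those below `t` survive, so a first
operand in `t` is still there when the second one arrives in `t + 1`. -/
theorem Ex.exec_compile {w S : ℕ} (e : Ex) :
    ∀ (t : ℕ) (s : State w), scratch ≤ t → e.Ok (2 ^ w) S s.toNat →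
      ∃ s', Exec S (e.compile t) s e.cost s' ∧ s'.mem = s.mem ∧
        (∀ r < t, s'.reg r = s.reg r) ∧ (s'.reg t).toNat = e.val s.toNat := by
  induction e with
  | lit k =>
    intro t s _ hok
    refine ⟨_, Exec.instr (Step.const t k s), rfl, ?_, ?_⟩
    · intro r hr
      simp [State.setReg, hr.ne]
    · simp only [Ex.Ok] at hok
      simp [State.setReg, Ex.val, Nat.mod_eq_of_lt hok]
  | reg r =>
    intro t s _ hok
    refine ⟨_, Exec.instr (Step.copy t r s), rfl, ?_, ?_⟩
    · intro r hr
      simp [State.setReg, hr.ne]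
    · simp only [Ex.Ok] at hok
      simp [State.setReg, Ex.val, State.toNat, hok]
  | op o e f he hf =>
    intro t s ht hok
    obtain ⟨h1, h2, h3⟩ := hok
    obtain ⟨s1, x1, m1, r1, v1⟩ := he t s ht h1
    have e1 : s1.toNat = s.toNat := State.toNat_congr m1 fun r hr => r1 r (by omega)
    obtain ⟨s2, x2, m2, r2, v2⟩ := hf (t + 1) s1 (by omega) (by rw [e1]; exact h2)
    refine ⟨_, x1.seq (x2.seq (Exec.instr (Step.op o t t (t + 1) s2))), ?_, ?_, ?_⟩
    · simp [State.setReg, m1, m2]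
    · intro r hr
      simp only [State.setReg, ne_eq, hr.ne, not_false_eq_true, Function.update_of_ne]
      rw [r2 r (by omega), r1 r hr]
    · have h4 : (s2.reg t).toNat = e.val s.toNat := by rw [r2 t (by omega), v1]
      rw [e1] at v2
      simp only [State.setReg, Function.update_self, Ex.val]
      rw [Op.toNat_eval, h4, v2]
      rw [h4, v2]
      exact h3
  | ld e he =>
    intro t s ht hok
    obtain ⟨h1, h2⟩ := hok
    obtain ⟨s1, x1, m1, r1, v1⟩ := he t s ht h1
    refine ⟨_, x1.seq (Exec.instr (Step.load t t s1 (by rw [v1]; exact h2))), ?_, ?_, ?_⟩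
    · simp [State.setReg, m1]
    · intro r hr
      simp only [State.setReg, ne_eq, hr.ne, not_false_eq_true, Function.update_of_ne]
      exact r1 r hr
    · simp [State.setReg, Ex.val, State.toNat, v1, m1]

theorem Cond.exec_compile {w S : ℕ} (c : Cond) (s : State w) (hok : c.Ok (2 ^ w) S s.toNat) :
    ∃ s', Exec S c.compile s c.cost s' ∧ s'.toNat = s.toNat ∧
      (c.test.Holds s' ↔ c.Holds s.toNat) := by
  have key : ∀ e f : Ex, e.Ok (2 ^ w) S s.toNat → f.Ok (2 ^ w) S s.toNat →
      ∃ s', Exec S (.seq (e.compile scratch) (f.compile (scratch + 1))) s (e.cost + f.cost) s' ∧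
        s'.toNat = s.toNat ∧ (s'.reg scratch).toNat = e.val s.toNat ∧
        (s'.reg (scratch + 1)).toNat = f.val s.toNat := by
    intro e f he hf
    obtain ⟨s1, x1, m1, r1, v1⟩ := e.exec_compile scratch s le_rfl he
    have e1 : s1.toNat = s.toNat := State.toNat_congr m1 r1
    obtain ⟨s2, x2, m2, r2, v2⟩ :=
      f.exec_compile (scratch + 1) s1 (by omega) (by rw [e1]; exact hf)
    refine ⟨s2, x1.seq x2, ?_, ?_, ?_⟩
    · rw [State.toNat_congr m2 fun r hr => r2 r (by omega), e1]
    · rw [r2 _ (by omega), v1]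
    · rw [v2, e1]
  cases c with
  | lt e f =>
    obtain ⟨s', x, h, h1, h2⟩ := key e f hok.1 hok.2
    exact ⟨s', x, h, by simp only [Cond.test, Test.Holds, Cond.Holds, BitVec.lt_def, h1, h2]⟩
  | eq e f =>
    obtain ⟨s', x, h, h1, h2⟩ := key e f hok.1 hok.2
    exact ⟨s', x, h, by
      simp only [Cond.test, Test.Holds, Cond.Holds, BitVec.toNat_inj.symm, h1, h2]⟩

/-! ### The variables that a program can change -/

/-- The variables that a statement may change. -/
def Stm.writes : Stm → List ℕ
  | .skip => []
  | .assign r _ => [r]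
  | .store _ _ => []
  | .seq p q => p.writes ++ q.writes
  | .ite _ p q => p.writes ++ q.writes
  | .whileDo _ p => p.writes

/-- The registers that a program may change. -/
def Program.writes : Program → Set ℕ
  | .skip => ∅
  | .instr (.const r _) => {r}
  | .instr (.copy r _) => {r}
  | .instr (.op _ r _ _) => {r}
  | .instr (.load r _) => {r}
  | .instr (.store _ _) => ∅
  | .seq p q => p.writes ∪ q.writes
  | .branch _ p q => p.writes ∪ q.writes
  | .loop _ p => p.writes

theorem Exec.reg_eq {w S : ℕ} {p : Program} {s s' : State w} {t : ℕ} (h : Exec S p s t s') :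
    ∀ r ∉ p.writes, s'.reg r = s.reg r := by
  induction h with
  | skip => simp
  | instr h =>
    intro r hr
    cases h <;> simp only [Program.writes, Set.mem_singleton_iff] at hr <;>
      simp [State.setReg, State.setMem, hr]
  | seq _ _ h1 h2 =>
    intro r hr
    simp only [Program.writes, Set.mem_union, not_or] at hr
    rw [h2 r hr.2, h1 r hr.1]
  | branch_true _ _ h =>
    intro r hr
    simp only [Program.writes, Set.mem_union, not_or] at hr
    rw [h r hr.1]
  | branch_false _ _ h =>
    intro r hr
    simp only [Program.writes, Set.mem_union, not_or] at hr
    rw [h r hr.2]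
  | loop_true _ _ _ h1 h2 =>
    intro r hr
    rw [h2 r hr, h1 r hr]
  | loop_false _ => simp

theorem Ex.writes_compile (e : Ex) : ∀ t, ∀ r ∈ (e.compile t).writes, t ≤ r := by
  induction e with
  | lit k => simp [Ex.compile, Program.writes]
  | reg r => simp [Ex.compile, Program.writes]
  | op o e f he hf =>
    intro t r hr
    simp only [Ex.compile, Program.writes, Set.mem_union, Set.mem_singleton_iff] at hr
    rcases hr with hr | hr | hr
    · exact he t r hr
    · exact (Nat.le_succ t).trans (hf (t + 1) r hr)
    · exact hr.ge
  | ld e he =>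
    intro t r hr
    simp only [Ex.compile, Program.writes, Set.mem_union, Set.mem_singleton_iff] at hr
    rcases hr with hr | hr
    · exact he t r hr
    · exact hr.ge

theorem Cond.writes_compile (c : Cond) : ∀ r ∈ c.compile.writes, scratch ≤ r := by
  intro r hr
  cases c <;> simp only [Cond.compile, Program.writes, Set.mem_union] at hr <;>
    rcases hr with hr | hr
  · exact Ex.writes_compile _ _ r hr
  · exact (Nat.le_succ _).trans (Ex.writes_compile _ _ r hr)
  · exact Ex.writes_compile _ _ r hr
  · exact (Nat.le_succ _).trans (Ex.writes_compile _ _ r hr)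

/-- Together with `Exec.reg_eq` this yields the frame rule. The list `writes` is computable, so
`decide` proves that a given variable is preserved. -/
theorem Stm.writes_compile (p : Stm) :
    ∀ r < scratch, r ∈ p.compile.writes → r ∈ p.writes := by
  induction p with
  | skip => simp [Stm.compile, Program.writes]
  | assign r e =>
    intro q hq h
    simp only [Stm.compile, Program.writes, Set.mem_union, Set.mem_singleton_iff] at h
    rcases h with h | h
    · exact absurd (Ex.writes_compile _ _ q h) (by omega)
    · simp [Stm.writes, h]
  | store e f =>
    intro q hq h
    simp only [Stm.compile, Program.writes, Set.mem_union, Set.mem_empty_iff_false, or_false] at h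
    rcases h with h | h
    · exact absurd (Ex.writes_compile _ _ q h) (by omega)
    · exact absurd (Ex.writes_compile _ _ q h) (by omega)
  | seq p q hp hq =>
    intro r hr h
    simp only [Stm.compile, Program.writes, Set.mem_union] at h
    simp only [Stm.writes, List.mem_append]
    exact h.imp (hp r hr) (hq r hr)
  | ite c p q hp hq =>
    intro r hr h
    simp only [Stm.compile, Program.writes, Set.mem_union] at h
    simp only [Stm.writes, List.mem_append]
    rcases h with h | h
    · exact absurd (Cond.writes_compile _ r h) (by omega)
    · exact h.imp (hp r hr) (hq r hr)
  | whileDo c p hp =>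
    intro r hr h
    simp only [Stm.compile, Program.writes, Set.mem_union] at h
    simp only [Stm.writes]
    rcases h with h | h | h
    · exact absurd (Cond.writes_compile _ r h) (by omega)
    · exact hp r hr h
    · exact absurd (Cond.writes_compile _ r h) (by omega)

/-! ### Total correctness with time bounds -/

/-- Started in the state `s`, the statement halts within `T` steps in a state satisfying `Q`,
with `w`-bit words and `S` memory cells. -/
def Tri (w S : ℕ) (p : Stm) (s : NState) (T : ℕ) (Q : NState → Prop) : Prop :=
  ∀ σ : State w, σ.toNat = s →
    ∃ t σ', Exec S p.compile σ t σ' ∧ t ≤ T ∧ Q σ'.toNat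

variable {w S : ℕ} {p q : Stm} {c : Cond} {s : NState} {T T' : ℕ} {Q Q' : NState → Prop}

theorem Tri.mono (h : Tri w S p s T Q) (hT : T ≤ T') (hQ : ∀ s', Q s' → Q' s') :
    Tri w S p s T' Q' := by
  intro σ hσ
  obtain ⟨t, σ', x, ht, hq⟩ := h σ hσ
  exact ⟨t, σ', x, ht.trans hT, hQ _ hq⟩

/-- Variables that are not written keep their values. -/
theorem Tri.frame (h : Tri w S p s T Q) :
    Tri w S p s T fun s' => Q s' ∧ ∀ r ∉ p.writes, s'.reg r = s.reg r := by
  intro σ hσ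
  obtain ⟨t, σ', x, ht, hq⟩ := h σ hσ
  refine ⟨t, σ', x, ht, hq, fun r hr => ?_⟩
  subst hσ
  simp only [State.toNat]
  split_ifs with h
  · rw [x.reg_eq r fun h' => hr (Stm.writes_compile p r h h')]
  · rfl

theorem Tri.skip (h : Q s) : Tri w S .skip s 0 Q := by
  rintro σ rfl
  exact ⟨0, σ, Exec.skip σ, le_rfl, h⟩

theorem Tri.seq (hp : Tri w S p s T fun s' => Tri w S q s' T' Q) :
    Tri w S (.seq p q) s (T + T') Q := by
  intro σ hσ
  obtain ⟨t, σ', x, ht, hq⟩ := hp σ hσ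
  obtain ⟨t', σ'', x', ht', hq'⟩ := hq σ' rfl
  exact ⟨t + t', σ'', x.seq x', by omega, hq'⟩

theorem Tri.bind {R : NState → Prop} (hp : Tri w S p s T R)
    (hq : ∀ s', R s' → (∀ r ∉ p.writes, s'.reg r = s.reg r) → Tri w S q s' T' Q) :
    Tri w S (.seq p q) s (T + T') Q :=
  Tri.seq (hp.frame.mono le_rfl fun s' h => hq s' h.1 h.2)

theorem Tri.assign {r : ℕ} {e : Ex} (hr : r < scratch) (he : e.Ok (2 ^ w) S s)
    (h : Q (s.set r (e.val s))) : Tri w S (.assign r e) s (e.cost + 1) Q := by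
  rintro σ rfl
  obtain ⟨σ1, x1, m1, r1, v1⟩ := e.exec_compile scratch σ le_rfl he
  refine ⟨_, _, x1.seq (Exec.instr (Step.copy r scratch σ1)), le_rfl, ?_⟩
  convert h using 1
  ext k
  · simp only [State.toNat, State.setReg, NState.set, Function.update_apply]
    split_ifs with h1 h2
    · exact v1
    · rw [r1 k h1]
    · omega
    · rfl
  · simp [State.toNat, State.setReg, NState.set, m1]

theorem Tri.store {e f : Ex} (he : e.Ok (2 ^ w) S s) (hf : f.Ok (2 ^ w) S s)
    (hS : e.val s < S) (h : Q (s.put (e.val s) (f.val s))) :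
    Tri w S (.store e f) s (e.cost + (f.cost + 1)) Q := by
  rintro σ rfl
  obtain ⟨σ1, x1, m1, r1, v1⟩ := e.exec_compile scratch σ le_rfl he
  have e1 : σ1.toNat = σ.toNat := State.toNat_congr m1 r1
  obtain ⟨σ2, x2, m2, r2, v2⟩ :=
    f.exec_compile (scratch + 1) σ1 (by omega) (by rw [e1]; exact hf)
  have v3 : (σ2.reg scratch).toNat = e.val σ.toNat := by rw [r2 _ (by omega), v1]
  refine ⟨_, _, x1.seq (x2.seq (Exec.instr (Step.store scratch (scratch + 1) σ2
    (by rw [v3]; exact hS)))), le_rfl, ?_⟩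
  convert h using 1
  ext k
  · simp only [State.toNat, State.setMem, NState.put]
    split_ifs with h1
    · rw [r2 k (by omega), r1 k h1]
    · rfl
  · simp only [State.toNat, State.setMem, NState.put, Function.update_apply, v3, m2, m1]
    split_ifs with h1
    · rw [v2, e1]
      rfl
    · rfl

theorem Tri.ite (hc : c.Ok (2 ^ w) S s) (hp : c.Holds s → Tri w S p s T Q)
    (hq : ¬ c.Holds s → Tri w S q s T' Q) :
    Tri w S (.ite c p q) s (c.cost + (max T T' + 1)) Q := by
  rintro σ rfl
  obtain ⟨σ1, x1, e1, h1⟩ := c.exec_compile σ hc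
  by_cases h : c.Holds σ.toNat
  · obtain ⟨t, σ', x, ht, hQ⟩ := hp h σ1 e1
    exact ⟨_, σ', x1.seq (Exec.branch_true (h1.2 h) x), by omega, hQ⟩
  · obtain ⟨t, σ', x, ht, hQ⟩ := hq h σ1 e1
    exact ⟨_, σ', x1.seq (Exec.branch_false (fun h' => h (h1.1 h')) x), by omega, hQ⟩

/-- A loop whose potential `Φ` pays for every iteration. -/
theorem Tri.whileDo (I : NState → Prop) (Φ : NState → ℕ) (hI : I s)
    (hok : ∀ s', I s' → c.Ok (2 ^ w) S s')
    (hbody : ∀ s', I s' → c.Holds s' → ∃ T, Tri w S p s' T fun s'' =>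
      I s'' ∧ T + c.cost + 1 + Φ s'' ≤ Φ s')
    (hend : ∀ s', I s' → ¬ c.Holds s' → Q s') :
    Tri w S (.whileDo c p) s (c.cost + 1 + Φ s) Q := by
  -- The induction starts where the operands of the test have already been computed, so the test in
  -- `σ` is linked to the condition in `s`. Each pass lowers `Φ` by at least one, the cost of the
  -- test itself.
  have key : ∀ k, ∀ (s : NState) (σ : State w), Φ s ≤ k → I s → σ.toNat = s →
      (c.test.Holds σ ↔ c.Holds s) →
      ∃ t σ', Exec S (.loop c.test (.seq p.compile c.compile)) σ t σ' ∧ t ≤ 1 + Φ s ∧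
        Q σ'.toNat := by
    intro k
    induction k using Nat.strong_induction_on with
    | _ k ih =>
      intro s σ hk hI hσ hc
      by_cases h : c.Holds s
      · obtain ⟨T, hT⟩ := hbody s hI h
        obtain ⟨t1, σ1, x1, ht1, hI1, hΦ⟩ := hT σ hσ
        obtain ⟨σ2, x2, e2, h2⟩ := c.exec_compile σ1 (hok _ hI1)
        obtain ⟨t3, σ3, x3, ht3, hQ⟩ := ih (Φ σ1.toNat) (by omega) σ1.toNat σ2 le_rfl hI1 e2 h2
        exact ⟨_, σ3, Exec.loop_true (hc.2 h) (x1.seq x2) x3, by omega, hQ⟩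
      · exact ⟨_, σ, Exec.loop_false fun h' => h (hc.1 h'), by omega, hσ ▸ hend s hI h⟩
  rintro σ rfl
  obtain ⟨σ1, x1, e1, h1⟩ := c.exec_compile σ (hok _ hI)
  obtain ⟨t, σ', x, ht, hQ⟩ := key _ σ.toNat σ1 le_rfl hI e1 h1
  exact ⟨_, σ', x1.seq x, by omega, hQ⟩

theorem Tri.whileDo_frame (I : NState → Prop) (Φ : NState → ℕ) (hI : I s)
    (hok : ∀ s', (∀ r ∉ p.writes, s'.reg r = s.reg r) → I s' → c.Ok (2 ^ w) S s')
    (hbody : ∀ s', (∀ r ∉ p.writes, s'.reg r = s.reg r) → I s' → c.Holds s' →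
      ∃ T, Tri w S p s' T fun s'' => I s'' ∧ T + c.cost + 1 + Φ s'' ≤ Φ s')
    (hend : ∀ s', (∀ r ∉ p.writes, s'.reg r = s.reg r) → I s' → ¬ c.Holds s' → Q s') :
    Tri w S (.whileDo c p) s (c.cost + 1 + Φ s) Q := by
  refine Tri.whileDo (fun s' => (∀ r ∉ p.writes, s'.reg r = s.reg r) ∧ I s') Φ ⟨fun _ _ => rfl, hI⟩
    (fun s' h => hok s' h.1 h.2) ?_ fun s' h => hend s' h.1 h.2
  rintro s' ⟨hf, h⟩ hc
  obtain ⟨T, hT⟩ := hbody s' hf h hc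
  refine ⟨T, hT.frame.mono le_rfl ?_⟩
  rintro s'' ⟨⟨h1, h2⟩, h3⟩
  exact ⟨⟨fun r hr => by rw [h3 r hr, hf r hr], h1⟩, h2⟩

/-- The loop `for i := 0, …, l - 1 do p`, the bound `l` being a register. -/
def Stm.forTo (i l : ℕ) (p : Stm) : Stm :=
  .seq (.assign i (.lit 0))
    (.whileDo (.lt (.reg i) (.reg l)) (.seq p (.assign i (.op .add (.reg i) (.lit 1)))))

theorem Tri.forTo {i l : ℕ} (I : ℕ → NState → Prop) (f : ℕ → ℕ) (N : ℕ) (hN : s.reg l = N)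
    (hw : i ∉ p.writes ∧ l ∉ i :: p.writes ∧ i < scratch ∧ l < scratch)
    (hB : N < 2 ^ w) (h0 : I 0 (s.set i 0))
    (hbody : ∀ k < N, ∀ s', (∀ r ∉ i :: p.writes, s'.reg r = s.reg r) → s'.reg i = k → I k s' →
      Tri w S p s' (f k) fun s'' => I (k + 1) (s''.set i (k + 1)))
    (hend : ∀ s', (∀ r ∉ i :: p.writes, s'.reg r = s.reg r) → I N s' → Q s') :
    Tri w S (.forTo i l p) s (5 + 7 * N + ∑ k ∈ Finset.range N, f k) Q := by
  obtain ⟨hi, hl, hi', hl'⟩ := hw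
  refine Tri.mono (T := 2 + (3 + (∑ k ∈ Finset.Ico 0 N, (f k + 7)))) (Tri.seq ?_) ?_
    fun _ h => h
  · refine Tri.assign hi' (Nat.two_pow_pos w) ?_
    have hli : l ≠ i := fun h => hl (by simp [h])
    have h1 : (s.set i 0).reg i = 0 := by simp
    -- Each remaining pass is charged its body and 7 more steps: 4 for the increment and 3 for the
    -- test.
    set Φ : NState → ℕ := fun s' => ∑ k ∈ Finset.Ico (s'.reg i) N, (f k + 7) with hΦ
    have := Tri.whileDo (w := w) (S := S) (s := s.set i 0) (c := .lt (.reg i) (.reg l))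
      (p := .seq p (.assign i (.op .add (.reg i) (.lit 1)))) (Q := Q)
      (fun s' => (∀ r ∉ i :: p.writes, s'.reg r = s.reg r) ∧ s'.reg i ≤ N ∧ I (s'.reg i) s') Φ
    simp only [hΦ, h1] at this
    refine this ?_ ?_ ?_ ?_
    · refine ⟨?_, Nat.zero_le _, h0⟩
      intro r hr
      simp only [List.mem_cons, not_or] at hr
      simp [hr.1]
    · intro s' _
      exact ⟨hi', hl'⟩
    · rintro s' ⟨hf, hle, hI⟩ hc
      simp only [Cond.Holds, Ex.val, hf l hl, hN] at hc
      refine ⟨f (s'.reg i) + 4, Tri.seq ((hbody _ hc s' hf rfl hI).frame.mono le_rfl ?_)⟩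
      rintro s2 ⟨hI2, hf2⟩
      have e2 : s2.reg i = s'.reg i := hf2 i hi
      have hpow : 1 < 2 ^ w := by omega
      refine Tri.assign hi' ⟨hi', hpow, ?_⟩ ?_
      · simp only [Op.Ok, Ex.val, e2]
        omega
      · simp only [Ex.val, Op.nat, e2]
        refine ⟨⟨?_, ?_, ?_⟩, ?_⟩
        · intro r hr
          have hr' := hr
          simp only [List.mem_cons, not_or] at hr'
          simp only [NState.set_reg, hr'.1, if_false]
          rw [hf2 r hr'.2, hf r hr]
        · simpa using hc
        · simpa using hI2
        · simp only [NState.set_reg, if_true, Cond.cost, Ex.cost]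
          rw [← Finset.add_sum_Ioo_eq_sum_Ico hc]
          have : Finset.Ico (s'.reg i + 1) N = Finset.Ioo (s'.reg i) N := by
            ext; simp
          rw [this]
    · rintro s' ⟨hf, hle, hI⟩ hc
      simp only [Cond.Holds, Ex.val, hf l hl, hN] at hc
      have : s'.reg i = N := by omega
      exact hend s' hf (this ▸ hI)
  · rw [Finset.sum_add_distrib, Finset.range_eq_Ico]
    simp
    omega

/-- The verification condition of a statement without loops. -/
def Stm.vc (w S : ℕ) : Stm → NState → (NState → Prop) → Prop
  | .skip, s, Q => Q s
  | .assign r e, s, Q => r < scratch ∧ e.Ok (2 ^ w) S s ∧ Q (s.set r (e.val s))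
  | .store e f, s, Q =>
    e.Ok (2 ^ w) S s ∧ f.Ok (2 ^ w) S s ∧ e.val s < S ∧ Q (s.put (e.val s) (f.val s))
  | .seq p q, s, Q => p.vc w S s fun s' => q.vc w S s' Q
  | .ite c p q, s, Q =>
    c.Ok (2 ^ w) S s ∧ (c.Holds s → p.vc w S s Q) ∧ (¬ c.Holds s → q.vc w S s Q)
  | .whileDo _ _, _, _ => False

/-- A bound for the time of a statement without loops. -/
def Stm.cost : Stm → ℕ
  | .skip => 0
  | .assign _ e => e.cost + 1
  | .store e f => e.cost + (f.cost + 1)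
  | .seq p q => p.cost + q.cost
  | .ite c p q => c.cost + (max p.cost q.cost + 1)
  -- This value is irrelevant, since `Stm.vc` is false for loops.
  | .whileDo _ _ => 0

theorem Tri.of_vc (h : p.vc w S s Q) : Tri w S p s p.cost Q := by
  induction p generalizing s Q with
  | skip => exact Tri.skip h
  | assign r e => exact Tri.assign h.1 h.2.1 h.2.2
  | store e f => exact Tri.store h.1 h.2.1 h.2.2.1 h.2.2.2
  | seq p q hp hq => exact Tri.seq ((hp h).mono le_rfl fun _ h' => hq h')
  | ite c p q hp hq => exact Tri.ite h.1 (fun hc => hp (h.2.1 hc)) fun hc => hq (h.2.2 hc)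
  | whileDo c p => exact h.elim

end WordRAM

/-! ### Actions on two sets of points, words and isomorphisms -/

namespace Conj

/-- Maps `g j` for `j < d` that act transitively on the points below `n` and on the points from `n`
to `2 * n - 1`. -/
structure Acts (n d : ℕ) (g : ℕ → ℕ → ℕ) : Prop where
  left : ∀ j < d, ∀ x < n, g j x < n
  right : ∀ j < d, ∀ x, n ≤ x → x < 2 * n → n ≤ g j x ∧ g j x < 2 * n
  reach_left : ∀ Z : ℕ → Prop, ∀ u < n, Z u → (∀ x < n, Z x → ∀ j < d, Z (g j x)) →
    ∀ x < n, Z x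
  reach_right : ∀ Z : ℕ → Prop, ∀ u, n ≤ u → u < 2 * n → Z u →
    (∀ x, n ≤ x → x < 2 * n → Z x → ∀ j < d, Z (g j x)) → ∀ x, n ≤ x → x < 2 * n → Z x

/-- An isomorphism from the left to the right action. -/
def IsIso (n d : ℕ) (g : ℕ → ℕ → ℕ) (σ : ℕ → ℕ) : Prop :=
  Set.BijOn σ (Set.Iio n) (Set.Ico n (2 * n)) ∧ ∀ j < d, ∀ x < n, σ (g j x) = g j (σ x)

/-- The maps given by words in the letters `g j`. -/
inductive IsWord (d : ℕ) (g : ℕ → ℕ → ℕ) : (ℕ → ℕ) → Prop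
  | id : IsWord d g fun x => x
  | cons {F : ℕ → ℕ} {j : ℕ} (hj : j < d) (hF : IsWord d g F) : IsWord d g fun x => F (g j x)

variable {n d : ℕ} {g : ℕ → ℕ → ℕ} {F G σ : ℕ → ℕ}

theorem IsWord.comp (hF : IsWord d g F) (hG : IsWord d g G) : IsWord d g fun x => F (G x) := by
  induction hG with
  | id => exact hF
  | cons hj _ ih => exact IsWord.cons hj ih

theorem IsWord.left (hF : IsWord d g F) (h : Acts n d g) : ∀ x < n, F x < n := by
  induction hF with
  | id => exact fun x hx => hx
  | cons hj _ ih => exact fun x hx => ih _ (h.left _ hj x hx)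

theorem IsWord.right (hF : IsWord d g F) (h : Acts n d g) :
    ∀ x, n ≤ x → x < 2 * n → n ≤ F x ∧ F x < 2 * n := by
  induction hF with
  | id => exact fun x hx hx' => ⟨hx, hx'⟩
  | cons hj _ ih =>
    intro x hx hx'
    obtain ⟨h1, h2⟩ := h.right _ hj x hx hx'
    exact ih _ h1 h2

theorem IsWord.lt (hF : IsWord d g F) (h : Acts n d g) {x : ℕ} (hx : x < 2 * n) :
    F x < 2 * n := by
  by_cases hx' : x < n
  · have := hF.left h x hx'
    omega
  · exact (hF.right h x (by omega) hx).2

theorem IsIso.map (hσ : IsIso n d g σ) {x : ℕ} (hx : x < n) : n ≤ σ x ∧ σ x < 2 * n :=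
  Set.mem_Ico.1 (hσ.1.mapsTo (Set.mem_Iio.2 hx))

theorem IsIso.word (hσ : IsIso n d g σ) (h : Acts n d g) (hF : IsWord d g F) :
    ∀ x < n, σ (F x) = F (σ x) := by
  induction hF with
  | id => exact fun x _ => rfl
  | cons hj _ ih =>
    intro x hx
    rw [ih _ (h.left _ hj x hx), hσ.2 _ hj x hx]

/-- The invariant behind the splitting of candidates: `σ` commutes with both words and is injective
on the left points. -/
theorem IsIso.agree_iff (hσ : IsIso n d g σ) (h : Acts n d g) (hF : IsWord d g F)
    (hG : IsWord d g G) {x : ℕ} (hx : x < n) : F x = G x ↔ F (σ x) = G (σ x) := by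
  rw [← hσ.word h hF x hx, ← hσ.word h hG x hx]
  exact (hσ.1.injOn.eq_iff (hF.left h x hx) (hG.left h x hx)).symm

theorem IsIso.card_eq (hσ : IsIso n d g σ) (P : ℕ → Prop) [DecidablePred P]
    (hP : ∀ x < n, P x ↔ P (σ x)) :
    ((Finset.range n).filter P).card = ((Finset.Ico n (2 * n)).filter P).card := by
  refine Finset.card_bij (fun x _ => σ x) ?_ ?_ ?_
  · intro x hx
    simp only [Finset.mem_filter, Finset.mem_range, Finset.mem_Ico] at hx ⊢
    exact ⟨hσ.map hx.1, (hP x hx.1).1 hx.2⟩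
  · intro x hx y hy hxy
    simp only [Finset.mem_filter, Finset.mem_range] at hx hy
    exact hσ.1.injOn hx.1 hy.1 hxy
  · intro y hy
    simp only [Finset.mem_filter, Finset.mem_range, Finset.mem_Ico] at hy ⊢
    obtain ⟨x, hx, rfl⟩ := hσ.1.surjOn (Set.mem_Ico.2 hy.1)
    exact ⟨x, ⟨hx, (hP x hx).2 hy.2⟩, rfl⟩

/-- An equivariant map between the two sides is an isomorphism. -/
theorem Acts.isIso (h : Acts n d g) (hn : 0 < n) (hm : ∀ x < n, n ≤ σ x ∧ σ x < 2 * n)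
    (hc : ∀ j < d, ∀ x < n, σ (g j x) = g j (σ x)) : IsIso n d g σ := by
  -- The image of an equivariant map is closed under the letters, hence it is the whole right side
  -- by transitivity. Injectivity follows because both sides have `n` points.
  have hs : Set.SurjOn σ (Finset.range n) (Finset.Ico n (2 * n)) := by
    intro y hy
    simp only [Finset.coe_Ico, Set.mem_Ico] at hy
    refine h.reach_right (fun y => y ∈ σ '' (Finset.range n)) (σ 0) (hm 0 hn).1 (hm 0 hn).2
      ⟨0, by simpa using hn, rfl⟩ ?_ y hy.1 hy.2
    rintro _ _ _ ⟨x, hx, rfl⟩ j hj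
    simp only [Finset.coe_range, Set.mem_Iio] at hx
    exact ⟨g j x, by simpa using h.left j hj x hx, hc j hj x hx⟩
  have hmt : Set.MapsTo σ (Finset.range n) (Finset.Ico n (2 * n)) := by
    intro x hx
    simp only [Finset.coe_range, Set.mem_Iio] at hx
    simpa using hm x hx
  have hi := Finset.injOn_of_surjOn_of_card_le σ hmt hs (by simp; omega)
  refine ⟨⟨?_, ?_, ?_⟩, hc⟩
  · simpa using hmt
  · simpa using hi
  · simpa using hs

/-! ### Coded words and their compositions -/

/-- The map of the word with code `c`; the words are numbered like the nodes of a `d`-ary heap. -/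
def row (d : ℕ) (g : ℕ → ℕ → ℕ) : ℕ → ℕ → ℕ
  | 0, x => x
  -- The parent of the heap node `c + 1` is `c / d`; its own letter `c % d` acts before the word of
  -- the parent.
  | c + 1, x => row d g (c / d) (g (c % d) x)
termination_by c => c
decreasing_by exact Nat.lt_succ_of_le (Nat.div_le_self c d)

theorem row_zero (x : ℕ) : row d g 0 x = x := by rw [row]

theorem row_succ (c x : ℕ) : row d g (c + 1) x = row d g (c / d) (g (c % d) x) := by rw [row]

theorem row_letter {j : ℕ} (hj : j < d) (x : ℕ) : row d g (j + 1) x = g j x := by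
  rw [row_succ, Nat.div_eq_of_lt hj, row_zero, Nat.mod_eq_of_lt hj]

/-- Adding a letter that acts first is plain arithmetic on codes. A walk up a tree towards the root
delivers the letters of a path in exactly this order. -/
theorem row_push {c j : ℕ} (hj : j < d) (x : ℕ) :
    row d g (c * d + j + 1) x = row d g c (g j x) := by
  rw [row_succ, Nat.add_comm, Nat.add_mul_div_right _ _ (by omega), Nat.div_eq_of_lt hj,
    Nat.add_mul_mod_self_right, Nat.mod_eq_of_lt hj, Nat.zero_add]

theorem isWord_row (hd : 0 < d) (c : ℕ) : IsWord d g (row d g c) := by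
  induction c using Nat.strong_induction_on with
  | _ c ih =>
    cases c with
    | zero =>
      have : row d g 0 = fun x => x := funext row_zero
      rw [this]
      exact IsWord.id
    | succ c =>
      have : row d g (c + 1) = fun x => row d g (c / d) (g (c % d) x) := funext (row_succ c)
      rw [this]
      exact IsWord.cons (Nat.mod_lt _ hd) (ih _ (Nat.lt_succ_of_le (Nat.div_le_self c d)))

/-- The composition of the words with codes `f (k - 1), …, f 0`, in this order. -/
def chain (d : ℕ) (g : ℕ → ℕ → ℕ) (f : ℕ → ℕ) : ℕ → ℕ → ℕ
  | 0, x => x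
  | k + 1, x => chain d g f k (row d g (f k) x)

theorem chain_succ (f : ℕ → ℕ) (k x : ℕ) :
    chain d g f (k + 1) x = chain d g f k (row d g (f k) x) := rfl

theorem isWord_chain (hd : 0 < d) (f : ℕ → ℕ) (k : ℕ) : IsWord d g (chain d g f k) := by
  induction k with
  | zero => exact IsWord.id
  | succ k ih => exact ih.comp (isWord_row hd (f k))

theorem chain_congr {f f' : ℕ → ℕ} {k : ℕ} (h : ∀ i < k, f i = f' i) (x : ℕ) :
    chain d g f k x = chain d g f' k x := by
  induction k generalizing x with
  | zero => rfl
  | succ k ih =>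
    rw [chain_succ, chain_succ, h k k.lt_succ_self, ih fun i hi => h i (by omega)]

/-! ### Breadth-first search from `u`, with images under the partial map `u ↦ v` -/

/-- The queue `q` holds `m` vertices, `t` their images, with spanning tree `pr`, `lt`. -/
structure Bfs (n d : ℕ) (g : ℕ → ℕ → ℕ) (u v : ℕ) (t pr lt q : ℕ → ℕ) (m : ℕ) : Prop where
  pos : 0 < m
  root : q 0 = u
  root_image : t u = v
  root_letter : lt u = d
  queue_lt : ∀ i < m, q i < n
  queue_inj : ∀ i < m, ∀ j < m, q i = q j → i = j
  image : ∀ y < n, t y ≠ 0 → n ≤ t y ∧ t y < 2 * n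
  mem_queue : ∀ y < n, t y ≠ 0 → ∃ i < m, q i = y
  queue_image : ∀ i < m, t (q i) ≠ 0
  letter : ∀ i < m, 0 < i → lt (q i) < d
  parent : ∀ i < m, 0 < i → ∃ k < i, pr (q i) = q k
  edge : ∀ i < m, 0 < i → g (lt (q i)) (pr (q i)) = q i
  edge_image : ∀ i < m, 0 < i → g (lt (q i)) (t (pr (q i))) = t (q i)

variable {u v m : ℕ} {t pr lt q t' pr' lt' q' : ℕ → ℕ}

theorem Bfs.card_le (h : Bfs n d g u v t pr lt q m) : m ≤ n := by
  have := Finset.card_le_card_of_injOn (s := Finset.range m) (t := Finset.range n) q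
    (fun i hi => by simpa using h.queue_lt i (by simpa using hi))
    (fun i hi j hj hij => h.queue_inj i (by simpa using hi) j (by simpa using hj) hij)
  simpa using this

theorem Bfs.start (hu : u < n) (hv : n ≤ v) (hv' : v < 2 * n) (ht : ∀ x < n, x ≠ u → t x = 0)
    (htu : t u = v) (hl : lt u = d) (hq : q 0 = u) : Bfs n d g u v t pr lt q 1 := by
  have hz : ∀ y < n, t y ≠ 0 → y = u := fun y hy h0 => by
    by_contra hne
    exact h0 (ht y hy hne)
  refine ⟨Nat.one_pos, hq, htu, hl, ?_, ?_, ?_, ?_, ?_, ?_, ?_, ?_, ?_⟩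
  · intro i hi
    rw [show i = 0 by omega, hq]
    exact hu
  · intro i hi j hj _
    omega
  · intro y hy h0
    rw [hz y hy h0, htu]
    exact ⟨hv, hv'⟩
  · intro y hy h0
    exact ⟨0, Nat.one_pos, by rw [hq, hz y hy h0]⟩
  · intro i hi
    rw [show i = 0 by omega, hq, htu]
    omega
  all_goals
    intro i hi h0
    omega

/-- A new vertex `y = g j (q k)` enters the queue. -/
theorem Bfs.extend (h : Bfs n d g u v t pr lt q m) (ha : Acts n d g) {k j : ℕ} (hk : k < m)
    (hj : j < d) (h0 : t (g j (q k)) = 0)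
    (ht' : ∀ x < n, t' x = if x = g j (q k) then g j (t (q k)) else t x)
    (hp' : ∀ x < n, pr' x = if x = g j (q k) then q k else pr x)
    (hl' : ∀ x < n, lt' x = if x = g j (q k) then j else lt x)
    (hq' : ∀ x < n, q' x = if x = m then g j (q k) else q x) :
    m < n ∧ Bfs n d g u v t' pr' lt' q' (m + 1) := by
  set y := g j (q k) with hy
  have hqk := h.queue_lt k hk
  have hyn : y < n := ha.left j hj _ hqk
  have hne : ∀ i < m, q i ≠ y := fun i hi e => h.queue_image i hi (by rw [e, h0])
  -- The queue injects into the points other than the unvisited `y`, so its array still has a free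
  -- cell.
  have hmn : m < n := by
    have hs := Finset.card_le_card_of_injOn (s := Finset.range m)
      (t := (Finset.range n).erase y) q
      (fun i hi => by
        have hi' : i < m := by simpa using hi
        exact Finset.mem_erase.2 ⟨hne i hi', by simpa using h.queue_lt i hi'⟩)
      (fun i hi j hj hij => h.queue_inj i (by simpa using hi) j (by simpa using hj) hij)
    rw [Finset.card_erase_of_mem (by simpa using hyn)] at hs
    simp only [Finset.card_range] at hs
    omega
  have hqi : ∀ i < m, q' i = q i := fun i hi => by
    rw [hq' i (by omega), if_neg (by omega)]
  have hqm : q' m = y := by rw [hq' m hmn, if_pos rfl]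
  have hti : ∀ i < m, t' (q i) = t (q i) := fun i hi => by
    rw [ht' _ (h.queue_lt i hi), if_neg (hne i hi)]
  have hpi : ∀ i < m, pr' (q i) = pr (q i) := fun i hi => by
    rw [hp' _ (h.queue_lt i hi), if_neg (hne i hi)]
  have hli : ∀ i < m, lt' (q i) = lt (q i) := fun i hi => by
    rw [hl' _ (h.queue_lt i hi), if_neg (hne i hi)]
  have hty : t' y = g j (t (q k)) := by rw [ht' y hyn, if_pos rfl]
  have hpy : pr' y = q k := by rw [hp' y hyn, if_pos rfl]
  have hly : lt' y = j := by rw [hl' y hyn, if_pos rfl]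
  obtain ⟨hb1, hb2⟩ := h.image _ hqk (h.queue_image k hk)
  obtain ⟨hb3, hb4⟩ := ha.right j hj _ hb1 hb2
  have hcases : ∀ i < m + 1, i < m ∨ i = m := fun i hi => by omega
  refine ⟨hmn, ?_⟩
  constructor
  · omega
  · rw [hqi 0 h.pos, h.root]
  · rw [← h.root, hti 0 h.pos, h.root, h.root_image]
  · rw [← h.root, hli 0 h.pos, h.root, h.root_letter]
  · intro i hi
    rcases hcases i hi with hi | rfl
    · rw [hqi i hi]
      exact h.queue_lt i hi
    · rwa [hqm]
  · intro i hi l hl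
    rcases hcases i hi with hi | rfl <;> rcases hcases l hl with hl | rfl
    · rw [hqi i hi, hqi l hl]
      exact h.queue_inj i hi l hl
    · rw [hqi i hi, hqm]
      exact fun e => absurd e (hne i hi)
    · rw [hqi l hl, hqm]
      exact fun e => absurd e.symm (hne l hl)
    · exact fun _ => rfl
  · intro x hx
    rw [ht' x hx]
    split_ifs
    · exact fun _ => ⟨hb3, hb4⟩
    · exact h.image x hx
  · intro x hx hx0
    rw [ht' x hx] at hx0
    split_ifs at hx0 with e
    · exact ⟨m, by omega, by rw [hqm, e]⟩
    · obtain ⟨i, hi, e⟩ := h.mem_queue x hx hx0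
      exact ⟨i, by omega, by rw [hqi i hi, e]⟩
  · intro i hi
    rcases hcases i hi with hi | rfl
    · rw [hqi i hi, hti i hi]
      exact h.queue_image i hi
    · rw [hqm, hty]
      omega
  · intro i hi hi0
    rcases hcases i hi with hi | rfl
    · rw [hqi i hi, hli i hi]
      exact h.letter i hi hi0
    · rwa [hqm, hly]
  · intro i hi hi0
    rcases hcases i hi with hi | rfl
    · obtain ⟨l, hl, e⟩ := h.parent i hi hi0
      exact ⟨l, hl, by rw [hqi i hi, hpi i hi, e, hqi l (by omega)]⟩
    · exact ⟨k, hk, by rw [hqm, hpy, hqi k hk]⟩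
  · intro i hi hi0
    rcases hcases i hi with hi | rfl
    · rw [hqi i hi, hpi i hi, hli i hi]
      exact h.edge i hi hi0
    · rw [hqm, hpy, hly]
  · intro i hi hi0
    rcases hcases i hi with hi | rfl
    · obtain ⟨l, hl, e⟩ := h.parent i hi hi0
      have := h.edge_image i hi hi0
      rw [hqi i hi, hpi i hi, hli i hi, hti i hi, e, hti l (by omega), ← e]
      exact this
    · rw [hqm, hpy, hly, hti k hk, hty]

/-! ### Spanning trees and scanned edges -/

/-- A spanning tree with root `u`, with the images of the vertices under the map `u ↦ v`. -/
structure Tree (n d : ℕ) (g : ℕ → ℕ → ℕ) (u v : ℕ) (t pr lt dep : ℕ → ℕ) : Prop where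
  dep_lt : ∀ y < n, dep y < n
  image : ∀ y < n, n ≤ t y ∧ t y < 2 * n
  root : ∀ y < n, ¬ lt y < d → y = u ∧ t y = v
  parent : ∀ y < n, lt y < d → pr y < n ∧ dep (pr y) < dep y ∧ g (lt y) (pr y) = y ∧
    g (lt y) (t (pr y)) = t y

/-- The first `k` vertices of the queue and the first `l` edges at the next one have been scanned;
`cf` tells whether an edge `cj` from `cx` to `cy` has been found that the map does not respect. -/
structure Scan (n d : ℕ) (g : ℕ → ℕ → ℕ) (t q : ℕ → ℕ) (k l cf cx cj cy : ℕ) : Prop where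
  done : ∀ i j, j < d → (i < k ∨ i = k ∧ j < l) →
    t (g j (q i)) ≠ 0 ∧ (cf = 0 → t (g j (q i)) = g j (t (q i)))
  conflict : cf ≠ 0 → cx < n ∧ cj < d ∧ cy = g cj cx ∧ t cx ≠ 0 ∧ t cy ≠ 0 ∧ t cy ≠ g cj (t cx)

variable {k l cf cx cj cy : ℕ}

/-- As long as not all vertices have been scanned, the queue is not empty. -/
theorem Bfs.lt_of_scan (h : Bfs n d g u v t pr lt q m) (ha : Acts n d g)
    (hs : Scan n d g t q k 0 cf cx cj cy) (hk : k < n) : k < m := by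
  by_contra hkm
  -- If the queue were exhausted, the visited set would be closed under all letters. By transitivity
  -- all `n` points would be in the queue, giving `n ≤ m ≤ k`.
  have hall := ha.reach_left (fun x => t x ≠ 0) u (h.root ▸ h.queue_lt 0 h.pos)
    (h.root ▸ h.queue_image 0 h.pos) (by
      intro x hx hx0 j hj
      obtain ⟨i, hi, rfl⟩ := h.mem_queue x hx hx0
      exact (hs.done i j hj (Or.inl (by omega))).1)
  choose f hf hqf using fun x : Fin n => h.mem_queue x x.2 (hall x x.2)
  have hinj : Function.Injective (fun x => (⟨f x, hf x⟩ : Fin m)) := by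
    intro x y hxy
    simp only [Fin.mk.injEq] at hxy
    have := hqf x
    rw [hxy, hqf y] at this
    exact Fin.ext this.symm
  have := Fintype.card_le_of_injective _ hinj
  simp only [Fintype.card_fin] at this
  omega

theorem Scan.next (hs : Scan n d g t q k d cf cx cj cy) : Scan n d g t q (k + 1) 0 cf cx cj cy := by
  refine ⟨?_, hs.conflict⟩
  intro i j hj hij
  refine hs.done i j hj ?_
  rcases hij with hij | hij
  · rcases Nat.lt_succ_iff_lt_or_eq.1 hij with h | h
    · exact Or.inl h
    · exact Or.inr ⟨h, hj⟩
  · omega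

/-- The image of the new vertex is defined so that the new edge is respected. Images that were
nonzero do not change, so earlier edges and a recorded conflict keep their properties. -/
theorem Scan.extend (hs : Scan n d g t q k l cf cx cj cy) (h : Bfs n d g u v t pr lt q m)
    (ha : Acts n d g) (hk : k < m) (hl : l < d) (h0 : t (g l (q k)) = 0)
    (ht' : ∀ x < n, t' x = if x = g l (q k) then g l (t (q k)) else t x)
    (hq' : ∀ x < n, q' x = if x = m then g l (q k) else q x) :
    Scan n d g t' q' k (l + 1) cf cx cj cy := by
  have hmn := h.card_le
  have hqk := h.queue_lt k hk
  obtain ⟨hb1, hb2⟩ := h.image _ hqk (h.queue_image k hk)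
  have hb3 := (ha.right l hl _ hb1 hb2).1
  have ht : ∀ x < n, t x ≠ 0 → t' x = t x := fun x hx hx0 => by
    rw [ht' x hx, if_neg fun e => hx0 (by rw [e, h0])]
  have hq : ∀ i ≤ k, q' i = q i := fun i hi => by rw [hq' i (by omega), if_neg (by omega)]
  have htq : ∀ i ≤ k, t' (q i) = t (q i) := fun i hi =>
    ht _ (h.queue_lt i (by omega)) (h.queue_image i (by omega))
  constructor
  · intro i j hj hij
    have hik : i ≤ k := by omega
    have hqi := h.queue_lt i (by omega)
    rw [hq i hik, htq i hik]
    by_cases e : i = k ∧ j = l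
    · obtain ⟨rfl, rfl⟩ := e
      rw [ht' _ (ha.left j hj _ hqk), if_pos rfl]
      exact ⟨by omega, fun _ => rfl⟩
    · have := hs.done i j hj (by omega)
      rw [ht _ (ha.left j hj _ hqi) this.1]
      exact this
  · intro hc
    obtain ⟨h1, h2, h3, h4, h5, h6⟩ := hs.conflict hc
    have hy : cy < n := h3 ▸ ha.left cj h2 cx h1
    rw [ht cx h1 h4, ht cy hy h5]
    exact ⟨h1, h2, h3, h4, h5, h6⟩

theorem Scan.agree (hs : Scan n d g t q k l cf cx cj cy) (h0 : t (g l (q k)) ≠ 0)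
    (h1 : t (g l (q k)) = g l (t (q k))) : Scan n d g t q k (l + 1) cf cx cj cy := by
  refine ⟨fun i j hj hij => ?_, hs.conflict⟩
  by_cases e : i = k ∧ j = l
  · obtain ⟨rfl, rfl⟩ := e
    exact ⟨h0, fun _ => h1⟩
  · exact hs.done i j hj (by omega)

/-- Once the flag is 1, nothing is claimed about equivariance any more, so a newly found conflict
may overwrite an older one. -/
theorem Scan.disagree (hs : Scan n d g t q k l cf cx cj cy) (h : Bfs n d g u v t pr lt q m)
    (hk : k < m) (hl : l < d) (h0 : t (g l (q k)) ≠ 0) (h1 : t (g l (q k)) ≠ g l (t (q k))) :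
    Scan n d g t q k (l + 1) 1 (q k) l (g l (q k)) := by
  refine ⟨fun i j hj hij => ⟨?_, fun h => absurd h one_ne_zero⟩,
    fun _ => ⟨h.queue_lt k hk, hl, rfl, h.queue_image k hk, h0, h1⟩⟩
  by_cases e : i = k ∧ j = l
  · obtain ⟨rfl, rfl⟩ := e
    exact h0
  · exact (hs.done i j hj (by omega)).1

/-- When everything has been scanned, we have a spanning tree. -/
theorem Bfs.tree (h : Bfs n d g u v t pr lt q m) (ha : Acts n d g)
    (hs : Scan n d g t q n 0 cf cx cj cy) :
    (∃ dep, Tree n d g u v t pr lt dep) ∧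
      (cf = 0 → ∀ j < d, ∀ x < n, t (g j x) = g j (t x)) := by
  have hall := ha.reach_left (fun x => t x ≠ 0) u (h.root ▸ h.queue_lt 0 h.pos)
    (h.root ▸ h.queue_image 0 h.pos) (by
      intro x hx hx0 j hj
      obtain ⟨i, hi, rfl⟩ := h.mem_queue x hx hx0
      exact (hs.done i j hj (Or.inl (hi.trans_le h.card_le))).1)
  have hmem := fun x hx => h.mem_queue x hx (hall x hx)
  constructor
  -- The position in the queue serves as depth, since a parent enters the queue before its children.
  -- It occurs only in the proof and is not stored by the program.
  · choose! dep hdep hqdep using hmem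
    have hdq : ∀ i < m, dep (q i) = i := fun i hi =>
      h.queue_inj _ (hdep _ (h.queue_lt i hi)) i hi (hqdep _ (h.queue_lt i hi))
    refine ⟨dep, fun y hy => (hdep y hy).trans_le h.card_le, fun y hy => h.image y hy (hall y hy),
      ?_, ?_⟩
    · intro y hy hlt
      rcases Nat.eq_zero_or_pos (dep y) with h0 | h0
      · have : y = u := by rw [← hqdep y hy, h0, h.root]
        exact ⟨this, by rw [this, h.root_image]⟩
      · refine absurd ?_ hlt
        rw [← hqdep y hy]
        exact h.letter _ (hdep y hy) h0
    · intro y hy hlt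
      rcases Nat.eq_zero_or_pos (dep y) with h0 | h0
      · have : y = u := by rw [← hqdep y hy, h0, h.root]
        rw [this, h.root_letter] at hlt
        exact absurd hlt (lt_irrefl d)
      · obtain ⟨k, hk, e⟩ := h.parent _ (hdep y hy) h0
        have h1 := h.edge _ (hdep y hy) h0
        have h2 := h.edge_image _ (hdep y hy) h0
        have hkm : k < m := hk.trans (hdep y hy)
        rw [hqdep y hy] at e h1 h2
        refine ⟨e ▸ h.queue_lt k hkm, ?_, h1, h2⟩
        rw [e, hdq k hkm]
        exact hk
  · intro h0 j hj x hx
    obtain ⟨i, hi, rfl⟩ := hmem x hx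
    exact (hs.done i j hj (Or.inl (hi.trans_le h.card_le))).2 h0

end Conj

namespace WordRAM

/-! ### Notation for programs -/

instance : Add Ex := ⟨.op .add⟩
instance : Sub Ex := ⟨.op .sub⟩
instance : Mul Ex := ⟨.op .mul⟩
instance : Div Ex := ⟨.op .div⟩
instance : Mod Ex := ⟨.op .mod⟩

section

variable (B S : ℕ) (s : NState) (e f : Ex) (k r : ℕ)

theorem Ex.val_add : (e + f).val s = e.val s + f.val s := rfl
theorem Ex.val_sub : (e - f).val s = e.val s - f.val s := rfl
theorem Ex.val_mul : (e * f).val s = e.val s * f.val s := rfl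
theorem Ex.val_div : (e / f).val s = e.val s / f.val s := rfl
theorem Ex.val_mod : (e % f).val s = e.val s % f.val s := rfl
theorem Ex.val_lit : (Ex.lit k).val s = k := rfl
theorem Ex.val_reg : (Ex.reg r).val s = s.reg r := rfl
theorem Ex.val_ld : (Ex.ld e).val s = s.mem (e.val s) := rfl
theorem Ex.ok_add :
    (e + f).Ok B S s ↔ e.Ok B S s ∧ f.Ok B S s ∧ e.val s + f.val s < B := Iff.rfl
theorem Ex.ok_sub : (e - f).Ok B S s ↔ e.Ok B S s ∧ f.Ok B S s ∧ f.val s ≤ e.val s := Iff.rfl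
theorem Ex.ok_mul :
    (e * f).Ok B S s ↔ e.Ok B S s ∧ f.Ok B S s ∧ e.val s * f.val s < B := Iff.rfl
theorem Ex.ok_div : (e / f).Ok B S s ↔ e.Ok B S s ∧ f.Ok B S s ∧ True := Iff.rfl
theorem Ex.ok_mod : (e % f).Ok B S s ↔ e.Ok B S s ∧ f.Ok B S s ∧ True := Iff.rfl
theorem Ex.ok_lit : (Ex.lit k).Ok B S s ↔ k < B := Iff.rfl
theorem Ex.ok_reg : (Ex.reg r).Ok B S s ↔ r < 64 := Iff.rfl
theorem Ex.ok_ld : (Ex.ld e).Ok B S s ↔ e.Ok B S s ∧ e.val s < S := Iff.rfl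
theorem Cond.ok_lt : (Cond.lt e f).Ok B S s ↔ e.Ok B S s ∧ f.Ok B S s := Iff.rfl
theorem Cond.ok_eq : (Cond.eq e f).Ok B S s ↔ e.Ok B S s ∧ f.Ok B S s := Iff.rfl
theorem Cond.holds_lt : (Cond.lt e f).Holds s ↔ e.val s < f.val s := Iff.rfl
theorem Cond.holds_eq : (Cond.eq e f).Holds s ↔ e.val s = f.val s := Iff.rfl

end

end WordRAM

/-! ### Memory layout and the table of words -/

namespace Conj

open WordRAM

/-- The places of the arrays in the memory. -/
structure Layout where
  (w n d sq N T tb lab tau par lt Q stk S : ℕ)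
  hn : 2 ≤ n
  hd : 2 ≤ d
  hN : N = 2 * n
  -- One row for each code up to `sq + d`: these include the empty word, all letters, and every
  -- extension by a letter of a code `c` with `c * d ≤ sq`.
  hT : T = (sq + d + 1) * N
  htb : tb = 2 + N * d
  hlab : lab = tb + T
  htau : tau = lab + N
  hpar : par = tau + n
  hlt : lt = par + n
  hQ : Q = lt + n
  hstk : stk = Q + n
  -- The stack has room for two words of at most `n + 1` codes each.
  hS : S = stk + N + 2
  hSw : S ≤ 2 ^ w
  hsq : n ≤ sq * sq
  hsq' : ∀ k < sq, k * k < n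

/-- The layout in a form suited to `omega`: the products are hidden in the atoms `L.T` and `L.tb`.
-/
theorem Layout.facts (L : Layout) : 2 ≤ L.n ∧ 2 ≤ L.d ∧ L.N = 2 * L.n ∧ L.d ≤ L.tb ∧
    L.sq + L.d < L.T ∧ L.lab = L.tb + L.T ∧ L.tau = L.lab + L.N ∧ L.par = L.tau + L.n ∧
    L.lt = L.par + L.n ∧ L.Q = L.lt + L.n ∧ L.stk = L.Q + L.n ∧ L.S = L.stk + L.N + 2 ∧
    L.S ≤ 2 ^ L.w ∧ L.w ≠ 0 := by
  have h1 : L.d ≤ L.N * L.d := Nat.le_mul_of_pos_left _ (by have := L.hN; have := L.hn; omega)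
  have h2 : (L.sq + L.d + 1) * 1 ≤ L.T := by
    rw [L.hT]
    exact Nat.mul_le_mul_left _ (by have := L.hN; have := L.hn; omega)
  refine ⟨L.hn, L.hd, L.hN, by have := L.htb; omega, by omega, L.hlab, L.htau, L.hpar, L.hlt, L.hQ,
    L.hstk, L.hS, L.hSw, fun h => ?_⟩
  have h3 := L.hSw
  have := L.hS
  rw [h] at h3
  omega

/-- The constants of the program are in their registers. -/
structure Env (L : Layout) (s : NState) : Prop where
  n : s.reg 1 = L.n
  d : s.reg 2 = L.d
  N : s.reg 3 = L.N
  T : s.reg 4 = L.T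
  tb : s.reg 5 = L.tb
  lab : s.reg 6 = L.lab
  tau : s.reg 7 = L.tau
  par : s.reg 8 = L.par
  lt : s.reg 9 = L.lt
  Q : s.reg 10 = L.Q
  stk : s.reg 11 = L.stk
  sq : s.reg 12 = L.sq
  -- This register names the bottom of the stack when `evalStm` evaluates the first word.
  zero : s.reg 13 = 0

theorem Env.frame {L : Layout} {s s' : NState} {W : List ℕ} (h : Env L s)
    (hf : ∀ r ∉ W, s'.reg r = s.reg r) (hW : ∀ r ∈ W, r = 0 ∨ 14 ≤ r) :
    Env L s' := by
  have key : ∀ r < 14, 0 < r → s'.reg r = s.reg r := fun r hr hr0 => hf r fun h' => by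
    have := hW r h'
    omega
  constructor <;> rw [key _ (by norm_num) (by norm_num)]
  exacts [h.n, h.d, h.N, h.T, h.tb, h.lab, h.tau, h.par, h.lt, h.Q, h.stk, h.sq, h.zero]

theorem Env.set {L : Layout} {s : NState} (h : Env L s) {r v : ℕ} (hr : 14 ≤ r) :
    Env L (s.set r v) :=
  h.frame (W := [r]) (fun q hq => by
    simp only [List.mem_singleton] at hq
    simp [hq]) (by simpa using Or.inr hr)

/-- The memory holds the table of the words. -/
def Tab (L : Layout) (g : ℕ → ℕ → ℕ) (s : NState) : Prop :=
  ∀ c < L.sq + L.d + 1, ∀ x < L.N, s.mem (L.tb + (c * L.N + x)) = row L.d g c x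

/-- The entry for the word `c` and the point `x` in the table. -/
def tabAt (c x : Ex) : Ex := .ld (.reg 5 + (c * .reg 3 + x))

theorem Layout.idx_lt (L : Layout) {c x : ℕ} (hc : c < L.sq + L.d + 1) (hx : x < L.N) :
    c * L.N + x < L.T := by
  have h1 : (c + 1) * L.N ≤ L.T := by
    rw [L.hT]
    exact Nat.mul_le_mul_right _ hc
  rw [Nat.add_mul, Nat.one_mul] at h1
  omega

theorem val_tabAt {L : Layout} {s : NState} (h : Env L s) {c x : Ex} :
    (tabAt c x).val s = s.mem (L.tb + (c.val s * L.N + x.val s)) := by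
  simp only [tabAt, Ex.val_ld, Ex.val_add, Ex.val_mul, Ex.val_reg, h.tb, h.N]

theorem ok_tabAt {L : Layout} {s : NState} (h : Env L s) {c x : Ex} (hc : c.Ok (2 ^ L.w) L.S s)
    (hx : x.Ok (2 ^ L.w) L.S s) (hc' : c.val s < L.sq + L.d + 1) (hx' : x.val s < L.N) :
    (tabAt c x).Ok (2 ^ L.w) L.S s := by
  have h1 := L.idx_lt hc' hx'
  have := L.hlab
  have := L.htau
  have := L.hpar
  have := L.hlt
  have := L.hQ
  have := L.hstk
  have := L.hS
  have := L.hSw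
  simp only [tabAt, Ex.ok_ld, Ex.ok_add, Ex.ok_mul, Ex.ok_reg, Ex.val_add, Ex.val_mul, Ex.val_reg,
    h.tb, h.N]
  refine ⟨⟨by norm_num, ⟨⟨hc, by norm_num, ?_⟩, hx, ?_⟩, ?_⟩, ?_⟩ <;> omega

/-! ### Breadth-first search -/

/-- Scan the edge with the letter `j` at `x`. -/
def edgeStm : Stm :=
  .seq (.assign 26 (tabAt (.reg 24 + .lit 1) (.reg 25)))
  (.seq (.assign 27 (tabAt (.reg 24 + .lit 1) (.ld (.reg 7 + .reg 25))))
  (.ite (.eq (.ld (.reg 7 + .reg 26)) (.lit 0))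
    (.seq (.store (.reg 7 + .reg 26) (.reg 27))
    (.seq (.store (.reg 8 + .reg 26) (.reg 25))
    (.seq (.store (.reg 9 + .reg 26) (.reg 24))
    (.seq (.store (.reg 10 + .reg 22) (.reg 26))
    (.assign 22 (.reg 22 + .lit 1))))))
    (.ite (.eq (.ld (.reg 7 + .reg 26)) (.reg 27)) .skip
      (.seq (.assign 18 (.lit 1)) (.seq (.assign 19 (.reg 25))
        (.seq (.assign 20 (.reg 24)) (.assign 21 (.reg 26))))))))

/-- Enter the vertex in register 15, mapped to the vertex in register 16, into the queue. -/
def rootStm : Stm :=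
  .seq (.store (.reg 7 + .reg 15) (.reg 16))
  (.seq (.store (.reg 9 + .reg 15) (.reg 2))
  (.seq (.store (.reg 10) (.reg 15))
  (.seq (.assign 22 (.lit 1))
  (.assign 18 (.lit 0)))))

/-- Scan the edges at the vertex number 23 in the queue. -/
def vertexStm : Stm := .seq (.assign 25 (.ld (.reg 10 + .reg 23))) (.forTo 24 2 edgeStm)

/-- Search from the vertex in register 15, mapped to the vertex in register 16. -/
def bfsStm : Stm :=
  .seq (.forTo 14 1 (.store (.reg 7 + .reg 14) (.lit 0))) (.seq rootStm (.forTo 23 1 vertexStm))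

/-- The state of the search in memory. -/
structure Search (L : Layout) (g : ℕ → ℕ → ℕ) (u v k l : ℕ) (s : NState) : Prop where
  bfs : Bfs L.n L.d g u v (fun x => s.mem (L.tau + x)) (fun x => s.mem (L.par + x))
    (fun x => s.mem (L.lt + x)) (fun x => s.mem (L.Q + x)) (s.reg 22)
  scan : Scan L.n L.d g (fun x => s.mem (L.tau + x)) (fun x => s.mem (L.Q + x)) k l
    (s.reg 18) (s.reg 19) (s.reg 20) (s.reg 21)

variable {L : Layout} {g : ℕ → ℕ → ℕ} {s : NState} {u v k l : ℕ}

theorem Search.extend (h : Search L g u v k l s) (ha : Acts L.n L.d g) (hk : k < s.reg 22)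
    (hl : l < L.d) (h0 : s.mem (L.tau + g l (s.mem (L.Q + k))) = 0) {s' : NState}
    (ht : ∀ x < L.n, s'.mem (L.tau + x) = if x = g l (s.mem (L.Q + k)) then
      g l (s.mem (L.tau + s.mem (L.Q + k))) else s.mem (L.tau + x))
    (hp : ∀ x < L.n, s'.mem (L.par + x) = if x = g l (s.mem (L.Q + k)) then
      s.mem (L.Q + k) else s.mem (L.par + x))
    (hlt : ∀ x < L.n, s'.mem (L.lt + x) = if x = g l (s.mem (L.Q + k)) then
      l else s.mem (L.lt + x))
    (hq : ∀ x < L.n, s'.mem (L.Q + x) = if x = s.reg 22 then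
      g l (s.mem (L.Q + k)) else s.mem (L.Q + x))
    (h22 : s'.reg 22 = s.reg 22 + 1) (h18 : s'.reg 18 = s.reg 18) (h19 : s'.reg 19 = s.reg 19)
    (h20 : s'.reg 20 = s.reg 20) (h21 : s'.reg 21 = s.reg 21) : Search L g u v k (l + 1) s' := by
  refine ⟨?_, ?_⟩
  · rw [h22]
    exact (h.bfs.extend ha hk hl h0 ht hp hlt hq).2
  · rw [h18, h19, h20, h21]
    exact h.scan.extend h.bfs ha hk hl h0 ht hq

theorem edgeStm_spec (ha : Acts L.n L.d g) (hE : Env L s) (hT : Tab L g s)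
    (h : Search L g u v k l s) (hk : k < s.reg 22) (hl : l < L.d) (h24 : s.reg 24 = l)
    (h25 : s.reg 25 = s.mem (L.Q + k)) :
    Tri L.w L.S edgeStm s edgeStm.cost fun s' => Search L g u v k (l + 1) s' ∧
      s.reg 22 ≤ s'.reg 22 ∧ s'.mem (L.Q + k) = s.mem (L.Q + k) ∧
      ∀ a < L.tau, s'.mem a = s.mem a := by
  obtain ⟨l1, l2, l3, l4, l5, l6, l7, l8, l9, l10, l11, l12, l13, l14⟩ := L.facts
  have hm := h.bfs.card_le
  have hqk := h.bfs.queue_lt k hk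
  obtain ⟨hb1, hb2⟩ := h.bfs.image _ hqk (h.bfs.queue_image k hk)
  have hy := ha.left l hl _ hqk
  have hTj : ∀ x < L.N, s.mem (L.tb + ((l + 1) * L.N + x)) = g l x := fun x hx => by
    rw [hT (l + 1) (by omega) x hx, row_letter hl]
  have hTy := hTj (s.mem (L.Q + k)) (by omega)
  have hTz := hTj (s.mem (L.tau + s.mem (L.Q + k))) (by omega)
  refine Tri.of_vc ?_
  simp only [edgeStm, Stm.vc]
  refine ⟨by norm_num, ok_tabAt hE ?_ ?_ ?_ ?_, ?_⟩
  · simp only [Ex.ok_add, Ex.ok_reg, Ex.ok_lit, Ex.val_reg, Ex.val_lit, h24]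
    omega
  · simp [Ex.ok_reg]
  · simp only [Ex.val_add, Ex.val_reg, Ex.val_lit, h24]
    omega
  · simp only [Ex.val_reg, h25]
    omega
  have v1 : (tabAt (.reg 24 + .lit 1) (.reg 25)).val s = g l (s.mem (L.Q + k)) := by
    rw [val_tabAt hE]
    simp only [Ex.val_add, Ex.val_reg, Ex.val_lit, h24, h25, hTy]
  rw [v1]
  set y := g l (s.mem (L.Q + k)) with hydef
  have hE1 : Env L (s.set 26 y) := hE.set (by norm_num)
  have v2 : (tabAt (.reg 24 + .lit 1) (.ld (.reg 7 + .reg 25))).val (s.set 26 y) =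
      g l (s.mem (L.tau + s.mem (L.Q + k))) := by
    rw [val_tabAt hE1]
    simp only [Ex.val_add, Ex.val_reg, Ex.val_lit, Ex.val_ld, NState.set_reg, NState.set_mem]
    simp [h24, h25, hE.tau, hTz]
  refine ⟨by norm_num, ok_tabAt hE1 ?_ ?_ ?_ ?_, ?_⟩
  · simp only [Ex.ok_add, Ex.ok_reg, Ex.ok_lit, Ex.val_reg, Ex.val_lit, NState.set_reg]
    simp [h24]
    omega
  · simp only [Ex.ok_add, Ex.ok_ld, Ex.ok_reg, Ex.val_add, Ex.val_reg, NState.set_reg]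
    simp [h25, hE.tau]
    omega
  · simp only [Ex.val_add, Ex.val_reg, Ex.val_lit, NState.set_reg]
    simp [h24]
    omega
  · simp only [Ex.val_add, Ex.val_reg, Ex.val_ld, NState.set_reg, NState.set_mem]
    simp [h25, hE.tau]
    omega
  rw [v2]
  set z := g l (s.mem (L.tau + s.mem (L.Q + k))) with hzdef
  obtain ⟨hz1, hz2⟩ := ha.right l hl _ hb1 hb2
  rw [← hzdef] at hz1 hz2
  simp only [Cond.ok_eq, Ex.ok_add, Ex.ok_ld, Ex.ok_reg, Ex.ok_lit, Ex.val_add, Ex.val_reg,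
    Ex.val_ld, Ex.val_lit, Cond.holds_eq, NState.set_reg, NState.set_mem, NState.put_reg]
  simp [h24, h25, hE.tau, hE.par, hE.lt, hE.Q, scratch]
  -- An unvisited endpoint (entry 0, which is no image because images are at least `n`) extends the
  -- tree. A visited endpoint gives an agreement or a conflict.
  refine ⟨by omega, fun h0 => ⟨by omega, by omega, by omega, by omega, by omega, by omega, by omega,
    by omega, by omega, ?_, ?_, ?_⟩, fun h0 => ⟨by omega, ?_, ?_⟩⟩
  · refine h.extend ha hk hl h0 ?_ ?_ ?_ ?_ (by simp) (by simp) (by simp) (by simp) (by simp)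
    all_goals
      intro x hx
      simp only [NState.set_mem, NState.put_mem]
      split_ifs <;> omega
  · simp only [NState.set_mem, NState.put_mem]
    split_ifs <;> omega
  · intro a ha
    simp only [NState.set_mem, NState.put_mem]
    split_ifs <;> omega
  · intro h1
    exact ⟨by simpa using h.bfs, by simpa using h.scan.agree h0 h1⟩
  · intro h1
    exact ⟨l14, by simpa using h.bfs, by simpa using h.scan.disagree h.bfs hk hl h0 h1⟩

theorem Search.congr (h : Search L g u v k l s) {s' : NState} (hm : s'.mem = s.mem)
    (hr : ∀ r, 18 ≤ r → r ≤ 22 → s'.reg r = s.reg r) : Search L g u v k l s' := by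
  refine ⟨?_, ?_⟩
  · rw [hm, hr 22 (by norm_num) (by norm_num)]
    exact h.bfs
  · rw [hm, hr 18 (by norm_num) (by norm_num), hr 19 (by norm_num) (by norm_num),
      hr 20 (by norm_num) (by norm_num), hr 21 (by norm_num) (by norm_num)]
    exact h.scan

theorem Tab.congr (h : Tab L g s) {s' : NState} (hm : ∀ a < L.lab, s'.mem a = s.mem a) :
    Tab L g s' := by
  intro c hc x hx
  have := L.idx_lt hc hx
  have := L.hlab
  rw [hm _ (by omega)]
  exact h c hc x hx

theorem vertexStm_spec (ha : Acts L.n L.d g) (hE : Env L s) (hT : Tab L g s)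
    (h : Search L g u v k 0 s) (hk : k < L.n) (h23 : s.reg 23 = k) :
    Tri L.w L.S vertexStm s (100 * L.d) fun s' => Search L g u v (k + 1) 0 s' ∧
      ∀ a < L.tau, s'.mem a = s.mem a := by
  obtain ⟨l1, l2, l3, l4, l5, l6, l7, l8, l9, l10, l11, l12, l13, l14⟩ := L.facts
  have hkm := h.bfs.lt_of_scan ha h.scan hk
  refine Tri.mono (T := 5 + (5 + 7 * L.d + ∑ _k ∈ Finset.range L.d, 80)) (Tri.seq ?_) ?_
    fun _ h => h
  · refine Tri.assign (show 25 < scratch by norm_num) ?_ ?_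
    · simp only [Ex.ok_ld, Ex.ok_add, Ex.ok_reg, Ex.val_add, Ex.val_reg, hE.Q, h23]
      omega
    simp only [Ex.val_ld, Ex.val_add, Ex.val_reg, hE.Q, h23]
    have hE' : Env L (s.set 25 (s.mem (L.Q + k))) := hE.set (by norm_num)
    -- The queue may grow while the edges at its entry `k` are scanned, but that entry itself stays
    -- fixed.
    refine Tri.forTo (fun l s' => Search L g u v k l s' ∧ s.reg 22 ≤ s'.reg 22 ∧
        s'.mem (L.Q + k) = s.mem (L.Q + k) ∧ ∀ a < L.tau, s'.mem a = s.mem a) _ L.d hE'.d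
      (by decide) (by omega) ?_ ?_ ?_
    · refine ⟨h.congr rfl ?_, ?_, rfl, fun _ _ => rfl⟩
      · intro r h1 h2
        simp [show r ≠ 25 by omega, show r ≠ 24 by omega]
      · simp
    · rintro l hl s' hf h24 ⟨hs, h22, hq, hm⟩
      have hE2 := hE'.frame hf (by decide)
      have hT2 : Tab L g s' := hT.congr fun a ha => hm a (by omega)
      have h25 : s'.reg 25 = s'.mem (L.Q + k) := by rw [hf 25 (by decide), hq]; simp
      refine (edgeStm_spec ha hE2 hT2 hs (by omega) hl h24 h25).mono (by decide) ?_
      rintro s2 ⟨h1, h2, h3, h4⟩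
      refine ⟨h1.congr rfl ?_, ?_, ?_, ?_⟩
      · intro r h1 h2
        simp [show r ≠ 24 by omega]
      · simpa using h22.trans h2
      · simpa [hq] using h3
      · intro a ha
        rw [NState.set_mem, h4 a ha, hm a ha]
    · rintro s' hf ⟨hs, _, _, hm⟩
      exact ⟨⟨hs.bfs, hs.scan.next⟩, hm⟩
  · simp
    omega

theorem bfsStm_spec (ha : Acts L.n L.d g) (hE : Env L s) (hT : Tab L g s)
    (h15 : s.reg 15 = u) (h16 : s.reg 16 = v) (hu : u < L.n) (hv : L.n ≤ v) (hv' : v < L.N) :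
    Tri L.w L.S bfsStm s (200 * (L.n * L.d)) fun s' => (∀ a < L.tau, s'.mem a = s.mem a) ∧
      (∃ dep, Tree L.n L.d g u v (fun x => s'.mem (L.tau + x)) (fun x => s'.mem (L.par + x))
        (fun x => s'.mem (L.lt + x)) dep) ∧
      (s'.reg 18 = 0 → ∀ j < L.d, ∀ x < L.n,
        s'.mem (L.tau + g j x) = g j (s'.mem (L.tau + x))) ∧
      (s'.reg 18 ≠ 0 → s'.reg 19 < L.n ∧ s'.reg 20 < L.d ∧ s'.reg 21 = g (s'.reg 20) (s'.reg 19) ∧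
        s'.mem (L.tau + s'.reg 21) ≠ g (s'.reg 20) (s'.mem (L.tau + s'.reg 19))) := by
  obtain ⟨l1, l2, l3, l4, l5, l6, l7, l8, l9, l10, l11, l12, l13, l14⟩ := L.facts
  -- Only the images need clearing between rounds: `Bfs` speaks of parents and letters of queued
  -- vertices only, and these are written on entry, apart from the unused parent of the root.
  have hclear : Tri L.w L.S (.forTo 14 1 (.store (.reg 7 + .reg 14) (.lit 0))) s
      (5 + 7 * L.n + ∑ _k ∈ Finset.range L.n, 6)
      fun s' => (∀ a < L.tau, s'.mem a = s.mem a) ∧ ∀ x < L.n, s'.mem (L.tau + x) = 0 := by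
    refine Tri.forTo (fun k s' => (∀ a < L.tau, s'.mem a = s.mem a) ∧
      ∀ x < k, s'.mem (L.tau + x) = 0) _ L.n hE.n (by decide) (by omega) ?_ ?_ ?_
    · simp
    · rintro k hk s' hf h14 ⟨h1, h2⟩
      have hE' := hE.frame hf (by decide)
      refine Tri.mono (Tri.of_vc ?_) (by decide) fun _ h => h
      simp only [Stm.vc, Ex.ok_add, Ex.ok_reg, Ex.ok_lit, Ex.val_add, Ex.val_reg, Ex.val_lit,
        hE'.tau, h14, NState.set_mem]
      refine ⟨by omega, by omega, by omega, ?_, ?_⟩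
      · intro a ha
        rw [NState.put_mem_ne _ (by omega), h1 a ha]
      · intro x hx
        rw [NState.put_mem]
        split_ifs
        · rfl
        · exact h2 x (by omega)
    · exact fun s' _ h => h
  refine Tri.mono (T := (5 + 7 * L.n + ∑ _k ∈ Finset.range L.n, 6) +
    (30 + (5 + 7 * L.n + ∑ _k ∈ Finset.range L.n, 100 * L.d))) (Tri.bind hclear ?_) ?_ fun _ h => h
  · rintro s1 ⟨m1, z1⟩ f1
    have hE1 := hE.frame f1 (by decide)
    have e15 : s1.reg 15 = u := by rw [f1 15 (by decide), h15]
    have e16 : s1.reg 16 = v := by rw [f1 16 (by decide), h16]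
    have hroot : Tri L.w L.S rootStm s1 30 fun s' => Search L g u v 0 0 s' ∧
        ∀ a < L.tau, s'.mem a = s.mem a := by
      refine Tri.mono (Tri.of_vc ?_) (by decide) fun _ h => h
      simp only [rootStm, Stm.vc, Ex.ok_add, Ex.ok_reg, Ex.ok_lit, Ex.val_add, Ex.val_reg,
        Ex.val_lit, NState.set_reg, NState.set_mem, NState.put_reg]
      simp [hE1.tau, hE1.lt, hE1.Q, hE1.d, e15, e16, scratch]
      refine ⟨by omega, by omega, by omega, by omega, by omega, l14, ⟨?_, ?_⟩, ?_⟩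
      · refine Bfs.start hu hv (by omega) ?_ ?_ ?_ ?_
        · intro x hx hxu
          simp only [NState.set_mem, NState.put_mem]
          rw [if_neg (by omega), if_neg (by omega), if_neg (by omega)]
          exact z1 x hx
        all_goals
          simp only [NState.set_mem, NState.put_mem]
          split_ifs <;> omega
      · constructor
        · intro i j hj hij
          omega
        · simp
      · intro a ha
        simp only [NState.set_mem, NState.put_mem]
        rw [if_neg (by omega), if_neg (by omega), if_neg (by omega)]
        exact m1 a ha
    refine Tri.bind hroot ?_
    rintro s2 ⟨hS, m2⟩ f2
    have hE2 := hE1.frame f2 (by decide)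
    -- A loop over exactly `n` queue positions suffices, since by `Bfs.lt_of_scan` the queue never
    -- runs empty before.
    refine Tri.forTo (fun k s' => Search L g u v k 0 s' ∧ ∀ a < L.tau, s'.mem a = s.mem a) _ L.n
      hE2.n (by decide) (by omega) ?_ ?_ ?_
    · refine ⟨hS.congr rfl ?_, m2⟩
      intro r h1 h2
      simp [show r ≠ 23 by omega]
    · rintro k hk s' hf h23 ⟨hs, hm⟩
      have hE3 := hE2.frame hf (by decide)
      refine (vertexStm_spec ha hE3 (hT.congr fun a ha => hm a (by omega)) hs hk h23).mono le_rfl ?_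
      rintro s3 ⟨h1, h2⟩
      refine ⟨h1.congr rfl ?_, ?_⟩
      · intro r h1 h2
        simp [show r ≠ 23 by omega]
      · intro a ha
        rw [NState.set_mem, h2 a ha, hm a ha]
    · rintro s' hf ⟨hs, hm⟩
      obtain ⟨h1, h2⟩ := hs.bfs.tree ha hs.scan
      refine ⟨hm, h1, h2, fun h0 => ?_⟩
      obtain ⟨c1, c2, c3, c4, c5, c6⟩ := hs.scan.conflict h0
      exact ⟨c1, c2, c3, c6⟩
  · have : L.n * 2 ≤ L.n * L.d := Nat.mul_le_mul_left _ l2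
    have e : L.n * (100 * L.d) = 100 * (L.n * L.d) := by ring
    simp only [Finset.sum_const, Finset.card_range, smul_eq_mul, e]
    omega

end Conj

namespace Conj

open WordRAM

variable {L : Layout} {g : ℕ → ℕ → ℕ} {s : NState} {u v k l : ℕ}

/-! ### Words as stacks of codes -/

/-- One step towards the root, from the vertex in register 30. -/
def climbStm : Stm :=
  .seq (.assign 32 (.ld (.reg 9 + .reg 30)))
  (.seq (.ite (.lt (.reg 12 / .reg 2) (.reg 31))
    (.seq (.store (.reg 11 + .reg 28) (.reg 31))
      (.seq (.assign 28 (.reg 28 + .lit 1)) (.assign 31 (.reg 32 + .lit 1))))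
    (.assign 31 (.reg 31 * .reg 2 + .reg 32 + .lit 1)))
  (.assign 30 (.ld (.reg 8 + .reg 30))))

/-- Push the codes of the word from the root to the vertex in register 30, followed by the word
with the code in register 31. -/
def pathStm : Stm :=
  .seq (.whileDo (.lt (.ld (.reg 9 + .reg 30)) (.reg 2)) climbStm)
  (.seq (.store (.reg 11 + .reg 28) (.reg 31)) (.assign 28 (.reg 28 + .lit 1)))

/-- The codes on the stack from position `p` on. -/
def codes (L : Layout) (s : NState) (p i : ℕ) : ℕ := s.mem (L.stk + (p + i))

/-- The word on the stack from position `p` on, preceded by the word with the code `c` at `x`. -/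
structure Path (L : Layout) (g : ℕ → ℕ → ℕ) (t : ℕ → ℕ) (p y z : ℕ) (s : NState)
    (m c x : ℕ) : Prop where
  codes_lt : ∀ i < m, codes L s p i < L.sq + L.d + 1
  code_lt : c < L.sq + L.d + 1
  left : chain L.d g (codes L s p) m (row L.d g c x) = y
  right : chain L.d g (codes L s p) m (row L.d g c (t x)) = z

/-- `chain` applies its topmost code first. A pushed code thus acts after everything that is still
to be read on the way to the root. -/
theorem Path.push {t : ℕ → ℕ} {p y z m c x : ℕ} (h : Path L g t p y z s m c x) {s' : NState}
    (hs : ∀ i < m, codes L s' p i = codes L s p i) (hm : codes L s' p m = c) {c' x' : ℕ}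
    (hc' : c' < L.sq + L.d + 1) (hx : row L.d g c' x' = x) (ht : row L.d g c' (t x') = t x) :
    Path L g t p y z s' (m + 1) c' x' := by
  refine ⟨?_, hc', ?_, ?_⟩
  · intro i hi
    rcases Nat.lt_succ_iff_lt_or_eq.1 hi with hi | rfl
    · rw [hs i hi]
      exact h.codes_lt i hi
    · rw [hm]
      exact h.code_lt
  · rw [chain_succ, hm, chain_congr hs, hx, h.left]
  · rw [chain_succ, hm, chain_congr hs, ht, h.right]

theorem Path.extend {t : ℕ → ℕ} {p y z m c x : ℕ} (h : Path L g t p y z s m c x) {s' : NState}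
    (hs : ∀ i < m, codes L s' p i = codes L s p i) {c' x' : ℕ}
    (hc' : c' < L.sq + L.d + 1) (hx : row L.d g c' x' = row L.d g c x)
    (ht : row L.d g c' (t x') = row L.d g c (t x)) :
    Path L g t p y z s' m c' x' := by
  refine ⟨?_, hc', ?_, ?_⟩
  · intro i hi
    rw [hs i hi]
    exact h.codes_lt i hi
  · rw [chain_congr hs, hx, h.left]
  · rw [chain_congr hs, ht, h.right]

/-- The loop invariant for `climbStm`: words of length at least `ℓ` have been pushed. -/
structure Climb (L : Layout) (g : ℕ → ℕ → ℕ) (t dep : ℕ → ℕ) (ℓ D p y z : ℕ) (s : NState) :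
    Prop where
  le : p ≤ s.reg 28
  vertex : s.reg 30 < L.n
  path : Path L g t p y z s (s.reg 28 - p) (s.reg 31) (s.reg 30)
  -- Here `e` bounds the length of the current coded word: codes of words of length `e` are at most
  -- d + … + d^e ≤ 2 d^e - 2, as `d ≥ 2`. The second inequality charges `ℓ` letters for each pushed
  -- code.
  length : ∃ e, s.reg 31 + 2 ≤ 2 * L.d ^ e ∧ ℓ * (s.reg 28 - p) + e + dep (s.reg 30) ≤ D

/-- A code `c` is pushed only if `c * d > sq`. Then 2 d^(e+1) ≥ (c + 2) d > sq + 2 d ≥ 2 d^ℓ, so `e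
≥ ℓ` and the charge for the pushed code is covered. -/
theorem Climb.push {t dep : ℕ → ℕ} {ℓ D p y z : ℕ} (h : Climb L g t dep ℓ D p y z s)
    (hTr : Tree L.n L.d g u v t (fun x => s.mem (L.par + x)) (fun x => s.mem (L.lt + x)) dep)
    (hℓ' : 2 * L.d ^ ℓ ≤ L.sq + 2 * L.d) (hlt : s.mem (L.lt + s.reg 30) < L.d)
    (hc : L.sq / L.d < s.reg 31) {s' : NState} (h28 : s'.reg 28 = s.reg 28 + 1)
    (h30 : s'.reg 30 = s.mem (L.par + s.reg 30))
    (h31 : s'.reg 31 = s.mem (L.lt + s.reg 30) + 1)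
    (hm : ∀ a < L.stk + s.reg 28, s'.mem a = s.mem a)
    (hm' : s'.mem (L.stk + s.reg 28) = s.reg 31) : Climb L g t dep ℓ D p y z s' := by
  obtain ⟨e, he1, he2⟩ := h.length
  have hd := L.hd
  obtain ⟨hpr, hdep, hed, him⟩ := hTr.parent _ h.vertex hlt
  have hle := h.le
  have e1 : s.reg 28 + 1 - p = s.reg 28 - p + 1 := by omega
  have hcd : L.sq < s.reg 31 * L.d := (Nat.div_lt_iff_lt_mul (by omega)).1 hc
  have hℓe : ℓ ≤ e := by
    by_contra hlt
    have h1 : 2 * L.d ^ (e + 1) ≤ 2 * L.d ^ ℓ :=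
      Nat.mul_le_mul_left _ (Nat.pow_le_pow_right (by omega) (by omega))
    have h2 := Nat.mul_le_mul_right L.d he1
    rw [Nat.mul_assoc, ← pow_succ, Nat.add_mul] at h2
    omega
  refine ⟨by omega, by rw [h30]; exact hpr, ?_, 1, by rw [h31, pow_one]; omega, ?_⟩
  · rw [h28, h30, h31, e1]
    refine h.path.push ?_ ?_ (by omega) ?_ ?_
    · intro i hi
      exact hm _ (by omega)
    · rw [codes, show p + (s.reg 28 - p) = s.reg 28 by omega, hm']
    · rw [row_letter hlt, hed]
    · rw [row_letter hlt, him]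
  · rw [h28, h30, e1, Nat.mul_add, Nat.mul_one]
    omega

/-- Since `c * d ≤ sq`, the extended code is at most `sq + d` and still has a row in the table. -/
theorem Climb.extend {t dep : ℕ → ℕ} {ℓ D p y z : ℕ} (h : Climb L g t dep ℓ D p y z s)
    (hTr : Tree L.n L.d g u v t (fun x => s.mem (L.par + x)) (fun x => s.mem (L.lt + x)) dep)
    (hlt : s.mem (L.lt + s.reg 30) < L.d)
    (hc : s.reg 31 * L.d ≤ L.sq) {s' : NState} (h28 : s'.reg 28 = s.reg 28)
    (h30 : s'.reg 30 = s.mem (L.par + s.reg 30))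
    (h31 : s'.reg 31 = s.reg 31 * L.d + s.mem (L.lt + s.reg 30) + 1)
    (hm : s'.mem = s.mem) : Climb L g t dep ℓ D p y z s' := by
  obtain ⟨e, he1, he2⟩ := h.length
  have hd := L.hd
  obtain ⟨hpr, hdep, hed, him⟩ := hTr.parent _ h.vertex hlt
  refine ⟨by rw [h28]; exact h.le, by rw [h30]; exact hpr, ?_, e + 1, ?_, ?_⟩
  · rw [h28, h30, h31]
    refine h.path.extend ?_ (by omega) ?_ ?_
    · intro i hi
      rw [codes, hm, codes]
    · rw [row_push hlt, hed]
    · rw [row_push hlt, him]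
  · have h2 := Nat.mul_le_mul_right L.d he1
    rw [Nat.mul_assoc, ← pow_succ, Nat.add_mul] at h2
    omega
  · rw [h28, h30]
    omega

theorem climbStm_spec {t dep : ℕ → ℕ} {ℓ D p y z : ℕ} (hE : Env L s)
    (hTr : Tree L.n L.d g u v t (fun x => s.mem (L.par + x)) (fun x => s.mem (L.lt + x)) dep)
    (hℓ : 0 < ℓ) (hℓ' : 2 * L.d ^ ℓ ≤ L.sq + 2 * L.d) (hD : D ≤ L.n) (hp : p ≤ L.n + 1)
    (h : Climb L g t dep ℓ D p y z s) (hlt : s.mem (L.lt + s.reg 30) < L.d) :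
    Tri L.w L.S climbStm s 40 fun s' => Climb L g t dep ℓ D p y z s' ∧
      dep (s'.reg 30) < dep (s.reg 30) ∧ ∀ a < L.stk + p, s'.mem a = s.mem a := by
  obtain ⟨l1, l2, l3, l4, l5, l6, l7, l8, l9, l10, l11, l12, l13, l14⟩ := L.facts
  obtain ⟨e, he1, he2⟩ := h.length
  have hv := h.vertex
  obtain ⟨hpr, hdep, hed, him⟩ := hTr.parent _ hv hlt
  have hm : s.reg 28 - p ≤ ℓ * (s.reg 28 - p) := Nat.le_mul_of_pos_left _ hℓ
  have hle := h.le
  refine Tri.mono (Tri.of_vc ?_) (by decide) fun _ h => h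
  simp only [climbStm, Stm.vc, Cond.ok_lt, Cond.holds_lt, Ex.ok_add, Ex.ok_div, Ex.ok_mul,
    Ex.ok_ld, Ex.ok_reg, Ex.ok_lit, Ex.val_add, Ex.val_mul, Ex.val_div, Ex.val_reg,
    Ex.val_lit, Ex.val_ld, NState.set_reg, NState.set_mem, NState.put_reg]
  simp [hE.lt, hE.sq, hE.d, hE.stk, hE.par, scratch]
  refine ⟨by omega, fun hc => ⟨by omega, by omega, by omega, by omega, by omega, ?_, ?_, ?_⟩,
    fun hc => ?_⟩
  · refine h.push hTr hℓ' hlt hc (by simp) ?_ (by simp) ?_ ?_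
    · simp only [NState.set_reg, if_true]
      exact NState.put_mem_ne _ (by omega)
    · intro a ha
      exact NState.put_mem_ne _ (by omega)
    · exact NState.put_mem_self _ _ _
  · rw [NState.put_mem_ne _ (by omega)]
    exact hdep
  · intro a ha
    exact NState.put_mem_ne _ (by omega)
  · have hc' : s.reg 31 * L.d ≤ L.sq := (Nat.le_div_iff_mul_le (by omega)).1 hc
    exact ⟨by omega, by omega, h.extend hTr hlt hc' (by simp) (by simp) (by simp) rfl, hdep⟩

theorem Tree.congr {n d : ℕ} {t pr lt dep t' pr' lt' : ℕ → ℕ} (h : Tree n d g u v t pr lt dep)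
    (ht : ∀ x < n, t' x = t x) (hp : ∀ x < n, pr' x = pr x) (hl : ∀ x < n, lt' x = lt x) :
    Tree n d g u v t' pr' lt' dep := by
  refine ⟨h.dep_lt, ?_, ?_, ?_⟩
  · intro y hy
    rw [ht y hy]
    exact h.image y hy
  · intro y hy
    rw [ht y hy, hl y hy]
    exact h.root y hy
  · intro y hy hlt
    rw [hl y hy] at hlt
    have := h.parent y hy hlt
    rw [hl y hy, hp y hy, ht y hy, ht _ this.1]
    exact this

/-- The starting word is empty or a letter, so `e ≤ 1`, while the depth is less than `n`. Thus `n`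
letters pay for all codes pushed during the climb, and `+ 1` accounts for the final push at the
root. -/
theorem pathStm_spec {t dep : ℕ → ℕ} {ℓ p e : ℕ} (hE : Env L s)
    (hTr : Tree L.n L.d g u v t (fun x => s.mem (L.par + x)) (fun x => s.mem (L.lt + x)) dep)
    (hℓ : 0 < ℓ) (hℓ' : 2 * L.d ^ ℓ ≤ L.sq + 2 * L.d) (hp : p ≤ L.n + 1) (h28 : s.reg 28 = p)
    (h30 : s.reg 30 < L.n) (h31 : s.reg 31 < L.sq + L.d + 1) (he : s.reg 31 + 2 ≤ 2 * L.d ^ e)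
    (he' : e ≤ 1) :
    Tri L.w L.S pathStm s (100 * L.n) fun s' => ∃ m, s'.reg 28 = p + m ∧ m ≤ L.n / ℓ + 1 ∧
      (∀ i < m, codes L s' p i < L.sq + L.d + 1) ∧
      chain L.d g (codes L s' p) m u = row L.d g (s.reg 31) (s.reg 30) ∧
      chain L.d g (codes L s' p) m v = row L.d g (s.reg 31) (t (s.reg 30)) ∧
      ∀ a < L.stk + p, s'.mem a = s.mem a := by
  obtain ⟨l1, l2, l3, l4, l5, l6, l7, l8, l9, l10, l11, l12, l13, l14⟩ := L.facts
  have hD := hTr.dep_lt _ h30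
  set y := row L.d g (s.reg 31) (s.reg 30) with hy
  set z := row L.d g (s.reg 31) (t (s.reg 30)) with hz
  have hend : ∀ s', Env L s' → Climb L g t dep ℓ L.n p y z s' →
      ¬ s'.mem (L.lt + s'.reg 30) < L.d → (∀ a < L.stk + p, s'.mem a = s.mem a) →
      Tri L.w L.S (.seq (.store (.reg 11 + .reg 28) (.reg 31)) (.assign 28 (.reg 28 + .lit 1))) s' 9
        fun s' => ∃ m, s'.reg 28 = p + m ∧ m ≤ L.n / ℓ + 1 ∧
        (∀ i < m, codes L s' p i < L.sq + L.d + 1) ∧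
        chain L.d g (codes L s' p) m u = y ∧ chain L.d g (codes L s' p) m v = z ∧
        ∀ a < L.stk + p, s'.mem a = s.mem a := by
    intro s' hE' h hlt hm
    obtain ⟨f, hf1, hf2⟩ := h.length
    have hle := h.le
    have hk : s'.reg 28 - p ≤ ℓ * (s'.reg 28 - p) := Nat.le_mul_of_pos_left _ hℓ
    have hk' : s'.reg 28 - p ≤ L.n / ℓ := by
      rw [Nat.le_div_iff_mul_le hℓ, Nat.mul_comm]
      omega
    have hv := h.vertex
    rw [hm _ (by omega)] at hlt
    obtain ⟨hr1, hr2⟩ := hTr.root _ hv hlt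
    refine Tri.mono (Tri.of_vc ?_) (by decide) fun _ h => h
    simp only [Stm.vc, Ex.ok_add, Ex.ok_reg, Ex.ok_lit, Ex.val_add, Ex.val_reg,
      Ex.val_lit, NState.set_reg, NState.set_mem, NState.put_reg]
    simp [hE'.stk, scratch]
    -- After the final push the current code becomes that of the empty word, so the stack alone
    -- describes the map from `u` to `y` and from `v` to `z`.
    refine ⟨by omega, by omega, ⟨l14, by omega⟩, s'.reg 28 - p + 1, by omega, by omega, ?_⟩
    have hP := h.path.push (s' := (s'.put (L.stk + s'.reg 28) (s'.reg 31)).set 28 (s'.reg 28 + 1))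
      (c' := 0) (x' := s'.reg 30) (fun i hi => ?_) ?_ (by omega) (row_zero _) (row_zero _)
    · refine ⟨fun i hi => Nat.le_of_lt_succ (hP.codes_lt i hi), ?_, ?_, ?_⟩
      · have := hP.left
        rwa [row_zero, hr1] at this
      · have := hP.right
        rwa [row_zero, hr2] at this
      · intro a ha
        rw [NState.put_mem_ne _ (by omega), hm a ha]
    · exact NState.put_mem_ne _ (by omega)
    · rw [codes, show p + (s'.reg 28 - p) = s'.reg 28 by omega]
      exact NState.put_mem_self _ _ _
  -- The depth falls in every pass; 50 steps cover the body (40) and the test (6).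
  refine Tri.mono (T := (5 + 1 + 50 * dep (s.reg 30)) + 9) (Tri.seq ?_) (by omega) fun _ h => h
  refine Tri.whileDo_frame (fun s' => Climb L g t dep ℓ L.n p y z s' ∧
    ∀ a < L.stk + p, s'.mem a = s.mem a) (fun s' => 50 * dep (s'.reg 30)) ?_ ?_ ?_ ?_
  · refine ⟨⟨by omega, h30, ?_, e, he, ?_⟩, fun _ _ => rfl⟩
    · rw [h28, Nat.sub_self]
      exact ⟨by simp, h31, rfl, rfl⟩
    · rw [h28, Nat.sub_self]
      omega
  · rintro s' hf ⟨h, hm⟩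
    have hE' := hE.frame hf (by decide)
    have := h.vertex
    simp only [Cond.ok_lt, Ex.ok_ld, Ex.ok_add, Ex.ok_reg, Ex.val_add, Ex.val_reg, hE'.lt]
    omega
  · rintro s' hf ⟨h, hm⟩ hc
    have hE' := hE.frame hf (by decide)
    simp only [Cond.holds_lt, Ex.val_ld, Ex.val_add, Ex.val_reg, hE'.lt, hE'.d] at hc
    refine ⟨40, (climbStm_spec hE' (hTr.congr (fun _ _ => rfl) ?_ ?_) hℓ hℓ' le_rfl hp h hc).mono
      le_rfl ?_⟩
    · intro x hx
      exact hm _ (by omega)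
    · intro x hx
      exact hm _ (by omega)
    · rintro s2 ⟨h1, h2, h3⟩
      refine ⟨⟨h1, fun a ha => by rw [h3 a ha, hm a ha]⟩, ?_⟩
      simp only [Cond.cost, Ex.cost]
      have : (Ex.ld (Ex.reg 9 + Ex.reg 30)).cost + (Ex.reg 2).cost = 5 := by decide
      simp only [Ex.cost] at this
      omega
  · rintro s' hf ⟨h, hm⟩ hc
    have hE' := hE.frame hf (by decide)
    simp only [Cond.holds_lt, Ex.val_ld, Ex.val_add, Ex.val_reg, hE'.lt, hE'.d] at hc
    exact hend s' hE' h hc hm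

/-- Apply the word on the stack between the positions in registers `lo` and `hi` to the point in
register 33. -/
def evalStm (lo hi : ℕ) : Stm :=
  .seq (.assign 34 (.reg hi))
  (.whileDo (.lt (.reg lo) (.reg 34))
    (.seq (.assign 34 (.reg 34 - .lit 1))
      (.assign 33 (tabAt (.ld (.reg 11 + .reg 34)) (.reg 33)))))

theorem evalStm_spec {lo hi p m x : ℕ} (ha : Acts L.n L.d g) (hE : Env L s) (hT : Tab L g s)
    (hlo : lo < 33) (hhi : hi < 33)
    (h1 : s.reg lo = p) (h2 : s.reg hi = p + m) (hpm : p + m ≤ L.N + 2) (h33 : s.reg 33 = x)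
    (hx : x < L.N) (hc : ∀ i < m, codes L s p i < L.sq + L.d + 1) :
    Tri L.w L.S (evalStm lo hi) s (40 * m + 10) fun s' => s'.mem = s.mem ∧
      s'.reg 33 = chain L.d g (codes L s p) m x := by
  obtain ⟨l1, l2, l3, l4, l5, l6, l7, l8, l9, l10, l11, l12, l13, l14⟩ := L.facts
  refine Tri.mono (T := 2 + (2 + 1 + 40 * m)) (Tri.seq ?_) (by omega) fun _ h => h
  refine Tri.assign (show 34 < scratch by norm_num) (show hi < 64 by omega) ?_
  simp only [Ex.val_reg, h2]
  have hE1 : Env L (s.set 34 (p + m)) := hE.set (by norm_num)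
  have hlo1 : (s.set 34 (p + m)).reg lo = p := by simp [show lo ≠ 34 by omega, h1]
  -- The invariant: the `k` codes not yet applied, acting on the current point, give the value
  -- sought.
  have key := Tri.whileDo_frame (w := L.w) (S := L.S) (s := s.set 34 (p + m))
    (c := .lt (.reg lo) (.reg 34)) (p := .seq (.assign 34 (.reg 34 - .lit 1))
      (.assign 33 (tabAt (.ld (.reg 11 + .reg 34)) (.reg 33))))
    (Q := fun s' => s'.mem = s.mem ∧ s'.reg 33 = chain L.d g (codes L s p) m x)
    (fun s' => s'.mem = s.mem ∧ s'.reg 33 < L.N ∧ ∃ k ≤ m, s'.reg 34 = p + k ∧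
      chain L.d g (codes L s p) k (s'.reg 33) = chain L.d g (codes L s p) m x)
    (fun s' => 40 * (s'.reg 34 - p)) ?_ ?_ ?_ ?_
  · refine key.mono ?_ fun _ h => h
    simp [Cond.cost, Ex.cost]
  · exact ⟨rfl, by simpa [h33] using hx, m, le_rfl, by simp, by simp [h33]⟩
  · intro s' _ _
    simp only [Cond.ok_lt, Ex.ok_reg]
    omega
  · rintro s' hf ⟨hm, h33', k, hk, h34, hch⟩ hc'
    have hE' := hE1.frame hf (by decide)
    have hlo' : s'.reg lo = p := by
      rw [hf lo ?_, hlo1]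
      simp only [Stm.writes, List.mem_append, List.mem_singleton]
      omega
    simp only [Cond.holds_lt, Ex.val_reg, hlo', h34] at hc'
    obtain ⟨k, rfl⟩ : ∃ k', k = k' + 1 := ⟨k - 1, by omega⟩
    refine ⟨20, Tri.mono (Tri.of_vc ?_) (by decide) fun _ h => h⟩
    have hE2 : Env L (s'.set 34 (p + k)) := hE'.set (by norm_num)
    have hcode := hc k (by omega)
    rw [codes] at hcode
    have hrow := hT _ hcode _ h33'
    simp only [Stm.vc, Ex.ok_sub, Ex.ok_reg, Ex.ok_lit, Ex.val_sub, Ex.val_reg, Ex.val_lit, h34,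
      show p + (k + 1) - 1 = p + k by omega]
    refine ⟨by norm_num, by omega, by norm_num, ok_tabAt hE2 ?_ ?_ ?_ ?_, ?_⟩
    · simp only [Ex.ok_ld, Ex.ok_add, Ex.ok_reg, Ex.val_add, Ex.val_reg, hE2.stk]
      simp
      omega
    · exact show 33 < 64 by norm_num
    · simp only [Ex.val_ld, Ex.val_add, Ex.val_reg, hE2.stk, NState.set_mem, hm]
      simpa using hcode
    · simpa [Ex.val_reg] using h33'
    · rw [val_tabAt hE2]
      simp only [Ex.val_ld, Ex.val_add, Ex.val_reg, hE2.stk, NState.set_mem, NState.set_reg, hm]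
      simp
      rw [hrow]
      refine ⟨⟨?_, by omega, ?_⟩, ?_⟩
      · rw [l3]
        exact (isWord_row (by omega) _).lt ha (by omega)
      · rw [← hch, chain_succ]
        rfl
      · simp [Cond.cost, Ex.cost]
        omega
  · rintro s' hf ⟨hm, h33', k, hk, h34, hch⟩ hc'
    have hlo' : s'.reg lo = p := by
      rw [hf lo ?_, hlo1]
      simp only [Stm.writes, List.mem_append, List.mem_singleton]
      omega
    simp only [Cond.holds_lt, Ex.val_reg, hlo', h34] at hc'
    have : k = 0 := by omega
    subst this
    exact ⟨hm, hch⟩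

end Conj

namespace Conj

open WordRAM

variable {L : Layout} {g : ℕ → ℕ → ℕ} {s : NState} {u v k l : ℕ}

/-! ### Two words that tell the root from its image -/

/-- Push two words that agree at the root, but not at its image. -/
def wordsStm : Stm :=
  .seq (.seq (.assign 28 (.lit 0)) (.seq (.assign 30 (.reg 19)) (.assign 31 (.reg 20 + .lit 1))))
  (.seq pathStm
  (.seq (.seq (.assign 29 (.reg 28)) (.seq (.assign 30 (.reg 21)) (.assign 31 (.lit 0))))
  pathStm))

/-- The stack holds two words, with `k` and `l` codes. -/
structure Words (L : Layout) (s : NState) (K k l : ℕ) : Prop where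
  sep : s.reg 29 = k
  top : s.reg 28 = k + l
  left_le : k ≤ K
  right_le : l ≤ K
  left : ∀ i < k, codes L s 0 i < L.sq + L.d + 1
  right : ∀ i < l, codes L s k i < L.sq + L.d + 1

/-- For a conflict at the edge from `x` to `y` with letter `j`, the first word is the tree path to
`x` followed by `j`, the second the tree path to `y`. Both lead from `u` to `y`, but from `v` to `g
j (t x)` and to `t y`, where `t` is the map of images. -/
theorem wordsStm_spec {dep : ℕ → ℕ} {ℓ : ℕ} (hE : Env L s)
    (hTr : Tree L.n L.d g u v (fun x => s.mem (L.tau + x)) (fun x => s.mem (L.par + x))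
      (fun x => s.mem (L.lt + x)) dep)
    (hg : Acts L.n L.d g) (hℓ : 0 < ℓ) (hℓ' : 2 * L.d ^ ℓ ≤ L.sq + 2 * L.d)
    (h19 : s.reg 19 < L.n) (h20 : s.reg 20 < L.d) (h21 : s.reg 21 = g (s.reg 20) (s.reg 19))
    (hne : s.mem (L.tau + s.reg 21) ≠ g (s.reg 20) (s.mem (L.tau + s.reg 19))) :
    Tri L.w L.S wordsStm s (200 * L.n + 20) fun s' => ∃ k l, Words L s' (L.n / ℓ + 1) k l ∧
      chain L.d g (codes L s' 0) k u = chain L.d g (codes L s' k) l u ∧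
      chain L.d g (codes L s' 0) k v ≠ chain L.d g (codes L s' k) l v ∧
      ∀ a < L.stk, s'.mem a = s.mem a := by
  obtain ⟨l1, l2, l3, l4, l5, l6, l7, l8, l9, l10, l11, l12, l13, l14⟩ := L.facts
  have hdiv : L.n / ℓ ≤ L.n := Nat.div_le_self _ _
  have hcy : s.reg 21 < L.n := h21 ▸ hg.left _ h20 _ h19
  have hinit : Tri L.w L.S (.seq (.assign 28 (.lit 0)) (.seq (.assign 30 (.reg 19))
      (.assign 31 (.reg 20 + .lit 1)))) s 10 fun s' => s'.mem = s.mem ∧ s'.reg 28 = 0 ∧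
        s'.reg 30 = s.reg 19 ∧ s'.reg 31 = s.reg 20 + 1 := by
    refine Tri.mono (Tri.of_vc ?_) (by decide) fun _ h => h
    simp only [Stm.vc, Ex.ok_add, Ex.ok_reg, Ex.ok_lit, Ex.val_add, Ex.val_reg,
      Ex.val_lit, NState.set_reg, NState.set_mem, NState.put_reg]
    simp [scratch]
    omega
  refine Tri.mono (T := 10 + (100 * L.n + (10 + 100 * L.n))) (Tri.bind hinit ?_) (by omega)
    fun _ h => h
  rintro s1 ⟨m1, e28, e30, e31⟩ f1
  have hE1 := hE.frame f1 (by decide)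
  have p1 := pathStm_spec (ℓ := ℓ) (p := 0) (e := 1) (t := fun x => s.mem (L.tau + x)) hE1
    (by simpa only [m1] using hTr) hℓ hℓ' (by omega) e28 (by omega) (by omega)
    (by rw [pow_one]; omega) le_rfl
  refine Tri.bind p1 ?_
  rintro s2 ⟨k, e28', hk, hk1, hk2, hk3, m2⟩ f2
  rw [Nat.zero_add] at e28'
  rw [e30, e31, row_letter h20] at hk2 hk3
  have hE2 := hE1.frame f2 (by decide)
  have e21 : s2.reg 21 = s.reg 21 := by rw [f2 21 (by decide), f1 21 (by decide)]
  have hmid : Tri L.w L.S (.seq (.assign 29 (.reg 28)) (.seq (.assign 30 (.reg 21))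
      (.assign 31 (.lit 0)))) s2 10 fun s' => s'.mem = s2.mem ∧ s'.reg 28 = k ∧ s'.reg 29 = k ∧
        s'.reg 30 = s.reg 21 ∧ s'.reg 31 = 0 := by
    refine Tri.mono (Tri.of_vc ?_) (by decide) fun _ h => h
    simp only [Stm.vc, Ex.ok_add, Ex.ok_reg, Ex.ok_lit, Ex.val_add, Ex.val_reg,
      Ex.val_lit, NState.set_reg, NState.set_mem, NState.put_reg]
    simp [scratch, e21, e28']
  refine Tri.bind hmid ?_
  rintro s3 ⟨m3, e28'', e29'', e30'', e31''⟩ f3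
  have hE3 := hE2.frame f3 (by decide)
  have hm : ∀ a < L.stk, s3.mem a = s.mem a := fun a ha => by
    rw [m3, m2 a (by omega), m1]
  have p2 := pathStm_spec (ℓ := ℓ) (p := k) (e := 0) (t := fun x => s.mem (L.tau + x)) hE3
    (hTr.congr (fun _ _ => rfl) (fun x hx => hm _ (by omega)) fun x hx => hm _ (by omega)) hℓ hℓ'
    (by omega) e28'' (by omega) (by omega) (by rw [pow_zero]; omega) (by omega)
  refine p2.frame.mono le_rfl ?_
  rintro s4 ⟨⟨l, e28''', hl, hl1, hl2, hl3, m4⟩, f4⟩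
  rw [e30'', e31'', row_zero] at hl2 hl3
  have hcodes : ∀ i < k, codes L s4 0 i = codes L s2 0 i := fun i hi => by
    rw [codes, codes, m4 _ (by omega), m3]
  refine ⟨k, l, ⟨by rw [f4 29 (by decide), e29''], e28''', hk, hl, ?_, hl1⟩, ?_, ?_, ?_⟩
  · intro i hi
    rw [hcodes i hi]
    exact hk1 i hi
  · rw [chain_congr hcodes, hk2, hl2, h21]
  · rw [chain_congr hcodes, hk3, hl3]
    exact hne.symm
  · intro a ha
    rw [m4 a (by omega), hm a ha]

/-! ### Splitting the set of candidates -/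

/-- Isomorphisms preserve the set `P` of points, which has `m` points on each side. -/
structure Cand (n d : ℕ) (g : ℕ → ℕ → ℕ) (P : ℕ → Prop) [DecidablePred P] (m : ℕ) : Prop where
  left : ((Finset.range n).filter P).card = m
  right : ((Finset.Ico n (2 * n)).filter P).card = m
  iso : ∀ σ, IsIso n d g σ → ∀ x < n, P x ↔ P (σ x)

theorem Cand.congr {n d m : ℕ} {P P' : ℕ → Prop} [DecidablePred P] [DecidablePred P']
    (h : Cand n d g P m) (hP : ∀ x < 2 * n, P' x ↔ P x) : Cand n d g P' m := by
  refine ⟨?_, ?_, ?_⟩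
  · rw [← h.left]
    refine congrArg _ (Finset.filter_congr fun x hx => ?_)
    have := Finset.mem_range.1 hx
    exact hP x (by omega)
  · rw [← h.right]
    refine congrArg _ (Finset.filter_congr fun x hx => ?_)
    exact hP x (Finset.mem_Ico.1 hx).2
  · intro σ hσ x hx
    rw [hP x (by omega), hP _ (hσ.map hx).2]
    exact h.iso σ hσ x hx

/-- This holds for every isomorphism, whether or not it maps `u` to `v`; hence shrinking the set of
candidates loses no isomorphism. -/
theorem Cand.iso_ne {n d m : ℕ} {P : ℕ → Prop} [DecidablePred P] (h : Cand n d g P m)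
    (ha : Acts n d g) {F G : ℕ → ℕ} (hF : IsWord d g F) (hG : IsWord d g G) {σ : ℕ → ℕ}
    (hσ : IsIso n d g σ) {x : ℕ} (hx : x < n) :
    P x ∧ F x ≠ G x ↔ P (σ x) ∧ F (σ x) ≠ G (σ x) := by
  rw [h.iso σ hσ x hx, Ne, hσ.agree_iff ha hF hG hx]

theorem Cand.ne {n d m : ℕ} {P : ℕ → Prop} [DecidablePred P] (h : Cand n d g P m)
    (ha : Acts n d g) {F G : ℕ → ℕ} (hF : IsWord d g F) (hG : IsWord d g G) {k : ℕ}
    (hl : ((Finset.range n).filter fun x => P x ∧ F x ≠ G x).card = k)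
    (hr : ((Finset.Ico n (2 * n)).filter fun x => P x ∧ F x ≠ G x).card = k) :
    Cand n d g (fun x => P x ∧ F x ≠ G x) k :=
  ⟨hl, hr, fun _ hσ _ hx => h.iso_ne ha hF hG hσ hx⟩

theorem card_filter_and_eq (A : Finset ℕ) (P : ℕ → Prop) [DecidablePred P] (F G : ℕ → ℕ) :
    (A.filter fun x => P x ∧ F x = G x).card =
      (A.filter P).card - (A.filter fun x => P x ∧ F x ≠ G x).card := by
  have h := Finset.card_filter_add_card_filter_not (s := A.filter P) (fun x => F x = G x)
  rw [Finset.filter_filter, Finset.filter_filter] at h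
  simp only [ne_eq]
  omega

theorem Cand.eq {n d m : ℕ} {P : ℕ → Prop} [DecidablePred P] (h : Cand n d g P m)
    (ha : Acts n d g) {F G : ℕ → ℕ} (hF : IsWord d g F) (hG : IsWord d g G) {k : ℕ}
    (hl : ((Finset.range n).filter fun x => P x ∧ F x ≠ G x).card = k)
    (hr : ((Finset.Ico n (2 * n)).filter fun x => P x ∧ F x ≠ G x).card = k) :
    Cand n d g (fun x => P x ∧ F x = G x) (m - k) := by
  refine ⟨?_, ?_, ?_⟩
  · rw [card_filter_and_eq, h.left, hl]
  · rw [card_filter_and_eq, h.right, hr]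
  · intro σ hσ x hx
    rw [h.iso σ hσ x hx, hσ.agree_iff ha hF hG hx]

/-! ### Marking, counting and relabelling -/

/-- Mark the point in register 14 by a 2 if the two words differ there. -/
def testStm : Stm :=
  .seq (.assign 33 (.reg 14)) (.seq (evalStm 13 29)
  (.seq (.seq (.assign 37 (.reg 33)) (.assign 33 (.reg 14))) (.seq (evalStm 29 28)
  (.ite (.eq (.reg 37) (.reg 33)) .skip
    (.seq (.store (.reg 6 + .reg 14) (.lit 2))
      (.ite (.lt (.reg 14) (.reg 1)) (.assign 35 (.reg 35 + .lit 1))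
        (.assign 36 (.reg 36 + .lit 1))))))))

/-- Mark the candidates where the two words differ, and count them on both sides. -/
def markStm : Stm :=
  .forTo 14 3 (.ite (.eq (.ld (.reg 6 + .reg 14)) (.lit 1)) testStm .skip)

/-- Memory is unchanged outside the labels. -/
def OnlyLab (L : Layout) (s s' : NState) : Prop :=
  ∀ a, (a < L.lab ∨ L.tau ≤ a) → s'.mem a = s.mem a

theorem OnlyLab.tab {s' : NState} (h : OnlyLab L s s') (hT : Tab L g s) : Tab L g s' :=
  hT.congr fun a ha => h a (Or.inl ha)

theorem OnlyLab.codes {s' : NState} (h : OnlyLab L s s') (p i : ℕ) :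
    codes L s' p i = codes L s p i := by
  obtain ⟨l1, l2, l3, l4, l5, l6, l7, l8, l9, l10, l11, l12, l13, l14⟩ := L.facts
  exact h _ (Or.inr (by omega))

theorem testStm_spec {K k l x : ℕ} (ha : Acts L.n L.d g) (hE : Env L s) (hT : Tab L g s)
    (hW : Words L s K k l) (hK : K ≤ L.n + 1) (hx : x < L.N) (h14 : s.reg 14 = x)
    (h35 : s.reg 35 ≤ L.N) (h36 : s.reg 36 ≤ L.N) :
    Tri L.w L.S testStm s (80 * K + 80) fun s' => OnlyLab L s s' ∧
      (∀ y < L.N, s'.mem (L.lab + y) = if y = x ∧ chain L.d g (codes L s 0) k x ≠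
        chain L.d g (codes L s k) l x then 2 else s.mem (L.lab + y)) ∧
      s'.reg 35 = (if x < L.n ∧ chain L.d g (codes L s 0) k x ≠ chain L.d g (codes L s k) l x
        then s.reg 35 + 1 else s.reg 35) ∧
      s'.reg 36 = (if L.n ≤ x ∧ chain L.d g (codes L s 0) k x ≠ chain L.d g (codes L s k) l x
        then s.reg 36 + 1 else s.reg 36) := by
  obtain ⟨l1, l2, l3, l4, l5, l6, l7, l8, l9, l10, l11, l12, l13, l14⟩ := L.facts
  have hk := hW.left_le
  have hl := hW.right_le
  refine Tri.mono (T := 2 + ((40 * k + 10) + (4 + ((40 * l + 10) + 30)))) (Tri.seq ?_) (by omega)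
    fun _ h => h
  refine Tri.assign (show 33 < scratch by norm_num) (show 14 < 64 by norm_num) ?_
  simp only [Ex.val_reg, h14]
  have hE1 : Env L (s.set 33 x) := hE.set (by norm_num)
  refine Tri.bind (evalStm_spec (p := 0) (m := k) (x := x) ha hE1 hT (by norm_num) (by norm_num)
    hE1.zero (by simp [hW.sep]) (by omega) (by simp) hx hW.left) ?_
  rintro s2 ⟨m2, e33⟩ f2
  have hE2 := hE1.frame f2 (by decide)
  have e14 : s2.reg 14 = x := by rw [f2 14 (by decide)]; simp [h14]
  refine Tri.bind (R := fun s' => s' = (s2.set 37 (s2.reg 33)).set 33 x)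
    (Tri.mono (Tri.of_vc ?_) (show _ ≤ 4 by decide) fun _ h => h) ?_
  · simp only [Stm.vc, Ex.ok_reg, Ex.val_reg, NState.set_reg]
    simp [e14, scratch]
  rintro s3 rfl -
  have hE3 : Env L ((s2.set 37 (s2.reg 33)).set 33 x) := (hE2.set (by norm_num)).set (by norm_num)
  refine Tri.bind (evalStm_spec (p := k) (m := l) (x := x) ha hE3 ?_ (by norm_num) (by norm_num)
    ?_ ?_ (by omega) (by simp) hx ?_) ?_
  · exact hT.congr fun a _ => by rw [NState.set_mem, NState.set_mem, m2, NState.set_mem]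
  · simp only [NState.set_reg]
    simp
    rw [f2 29 (by decide)]
    simp [hW.sep]
  · simp only [NState.set_reg]
    simp
    rw [f2 28 (by decide)]
    simp [hW.top]
  · intro i hi
    rw [codes, NState.set_mem, NState.set_mem, m2, NState.set_mem]
    exact hW.right i hi
  rintro s4 ⟨m4, e33'⟩ f4
  have hE4 := hE3.frame f4 (by decide)
  have hmem : s4.mem = s.mem := by
    rw [m4, NState.set_mem, NState.set_mem, m2, NState.set_mem]
  have e33'' : s4.reg 33 = chain L.d g (codes L s k) l x := by
    rw [e33']
    refine chain_congr (fun i _ => ?_) x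
    rw [codes, NState.set_mem, NState.set_mem, m2, NState.set_mem, codes]
  have e37 : s4.reg 37 = chain L.d g (codes L s 0) k x := by
    rw [f4 37 (by decide)]
    simp
    exact e33
  have e14' : s4.reg 14 = x := by
    rw [f4 14 (by decide)]
    simpa using e14
  have e35 : s4.reg 35 = s.reg 35 := by
    rw [f4 35 (by decide)]
    simp
    rw [f2 35 (by decide)]
    simp
  have e36 : s4.reg 36 = s.reg 36 := by
    rw [f4 36 (by decide)]
    simp
    rw [f2 36 (by decide)]
    simp
  refine Tri.mono (Tri.of_vc ?_) (by decide) fun _ h => h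
  simp only [Stm.vc, Cond.ok_eq, Cond.ok_lt, Cond.holds_eq, Cond.holds_lt, Ex.ok_add, Ex.ok_reg,
    Ex.ok_lit, Ex.val_add, Ex.val_reg, Ex.val_lit, NState.set_reg, NState.set_mem, NState.put_reg,
    e37, e33'', e14', e35, e36, hE4.lab, hE4.n]
  refine ⟨by norm_num, fun heq => ?_, fun hne => ⟨by omega, by omega, by omega, by norm_num, ?_, ?_⟩⟩
  · simp only [heq, ne_eq, not_true, and_false, if_false]
    exact ⟨fun a _ => by rw [hmem], fun y _ => by rw [hmem], trivial, trivial⟩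
  all_goals
    intro hxn
    refine ⟨by decide, ⟨by norm_num, by omega, by omega⟩, ?_, ?_, ?_, ?_⟩
    · intro a ha
      rw [NState.set_mem, NState.put_mem_ne _ (by omega), hmem]
    · intro y hy
      rw [NState.put_mem, hmem]
      simp [hne]
    · simp [hxn, hne, e35]
      try omega
    · simp [hxn, hne, e36]
      try omega

theorem card_filter_range_succ (P : ℕ → Prop) [DecidablePred P] (k : ℕ) :
    ((Finset.range (k + 1)).filter P).card =
      if P k then ((Finset.range k).filter P).card + 1 else ((Finset.range k).filter P).card := by
  rw [Finset.range_add_one, Finset.filter_insert]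
  split_ifs
  · rw [Finset.card_insert_of_notMem (by simp)]
  · rfl

theorem filter_range_left (n : ℕ) (P : ℕ → Prop) [DecidablePred P] :
    ((Finset.range (2 * n)).filter fun x => x < n ∧ P x) = (Finset.range n).filter P := by
  ext x
  simp only [Finset.mem_filter, Finset.mem_range]
  constructor
  · exact fun h => h.2
  · exact fun h => ⟨by omega, h⟩

theorem filter_range_right (n : ℕ) (P : ℕ → Prop) [DecidablePred P] :
    ((Finset.range (2 * n)).filter fun x => n ≤ x ∧ P x) = (Finset.Ico n (2 * n)).filter P := by
  ext x
  simp only [Finset.mem_filter, Finset.mem_range, Finset.mem_Ico]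
  tauto

theorem card_filter_le_range (P : ℕ → Prop) [DecidablePred P] (k : ℕ) :
    ((Finset.range k).filter P).card ≤ k :=
  (Finset.card_filter_le _ _).trans (by simp)

/-- Words are evaluated at candidates only; all other points cost a constant. This is what makes the
total over all rounds a geometric sum. -/
theorem markStm_spec {K k l m : ℕ} (ha : Acts L.n L.d g) (hE : Env L s) (hT : Tab L g s)
    (hW : Words L s K k l) (hK : K ≤ L.n + 1) (h35 : s.reg 35 = 0) (h36 : s.reg 36 = 0)
    (hm : ((Finset.range L.N).filter fun x => s.mem (L.lab + x) = 1).card = m)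
    {F G : ℕ → ℕ} (hF : F = chain L.d g (codes L s 0) k) (hG : G = chain L.d g (codes L s k) l) :
    Tri L.w L.S markStm s (30 * L.N + 10 + m * (80 * K + 80)) fun s' => OnlyLab L s s' ∧
      (∀ y < L.N, s'.mem (L.lab + y) = if s.mem (L.lab + y) = 1 ∧ F y ≠ G y then 2
        else s.mem (L.lab + y)) ∧
      s'.reg 35 = ((Finset.range L.n).filter
        fun x => s.mem (L.lab + x) = 1 ∧ F x ≠ G x).card ∧
      s'.reg 36 = ((Finset.Ico L.n (2 * L.n)).filter
        fun x => s.mem (L.lab + x) = 1 ∧ F x ≠ G x).card := by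
  obtain ⟨l1, l2, l3, l4, l5, l6, l7, l8, l9, l10, l11, l12, l13, l14⟩ := L.facts
  refine Tri.mono (Tri.forTo (fun x s' => OnlyLab L s s' ∧
      (∀ y < L.N, s'.mem (L.lab + y) = if y < x ∧ s.mem (L.lab + y) = 1 ∧ F y ≠ G y then 2
        else s.mem (L.lab + y)) ∧
      s'.reg 35 = ((Finset.range x).filter
        fun y => y < L.n ∧ s.mem (L.lab + y) = 1 ∧ F y ≠ G y).card ∧
      s'.reg 36 = ((Finset.range x).filter
        fun y => L.n ≤ y ∧ s.mem (L.lab + y) = 1 ∧ F y ≠ G y).card)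
      (fun x => 10 + if s.mem (L.lab + x) = 1 then 80 * K + 80 else 0) L.N hE.N (by decide)
      (by omega) ?_ ?_ ?_) ?_ fun _ h => h
  · exact ⟨fun _ _ => rfl, by simp, by simp [h35], by simp [h36]⟩
  · rintro x hx s' hf h14 ⟨ho, hl, h1, h2⟩
    have hE' := hE.frame hf (by decide)
    have hT' := ho.tab hT
    have hlx : s'.mem (L.lab + x) = s.mem (L.lab + x) := by
      rw [hl x hx, if_neg (by omega)]
    have hc : (Cond.eq (.ld (.reg 6 + .reg 14)) (.lit 1)).Ok (2 ^ L.w) L.S s' := by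
      simp only [Cond.ok_eq, Ex.ok_ld, Ex.ok_add, Ex.ok_reg, Ex.ok_lit, Ex.val_add, Ex.val_reg,
        hE'.lab, h14]
      omega
    have hh : (Cond.eq (.ld (.reg 6 + .reg 14)) (.lit 1)).Holds s' ↔ s.mem (L.lab + x) = 1 := by
      simp only [Cond.holds_eq, Ex.val_ld, Ex.val_add, Ex.val_reg, Ex.val_lit, hE'.lab, h14, hlx]
    rw [card_filter_range_succ, card_filter_range_succ]
    by_cases h : s.mem (L.lab + x) = 1
    · refine Tri.mono (Tri.ite (T := 80 * K + 80) (T' := 0) hc (fun _ => ?_)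
        fun hn => absurd (hh.2 h) hn) ?_ fun _ h => h
      · have hW' : Words L s' K k l := by
          refine ⟨?_, ?_, hW.left_le, hW.right_le, ?_, ?_⟩
          · rw [hf 29 (by decide), hW.sep]
          · rw [hf 28 (by decide), hW.top]
          · intro i hi
            rw [ho.codes]
            exact hW.left i hi
          · intro i hi
            rw [ho.codes]
            exact hW.right i hi
        have eF : chain L.d g (codes L s' 0) k x = F x := by
          rw [hF, chain_congr fun i _ => ho.codes 0 i]
        have eG : chain L.d g (codes L s' k) l x = G x := by
          rw [hG, chain_congr fun i _ => ho.codes k i]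
        refine (testStm_spec ha hE' hT' hW' hK hx h14 ?_ ?_).mono le_rfl ?_
        · rw [h1]
          exact (card_filter_le_range _ _).trans hx.le
        · rw [h2]
          exact (card_filter_le_range _ _).trans hx.le
        · rintro s2 ⟨o2, g1, g2, g3⟩
          rw [eF, eG] at g2 g3
          refine ⟨fun a ha => by rw [NState.set_mem, o2 a ha, ho a ha], ?_, ?_, ?_⟩
          · intro y hy
            rw [NState.set_mem, g1 y hy, hl y hy, eF, eG]
            by_cases hyx : y = x
            · subst hyx
              simp [h]
            · simp only [hyx, false_and, if_false, show y < x + 1 ↔ y < x by omega]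
          · simp only [NState.set_reg]
            simp [g2, h1, h]
          · simp only [NState.set_reg]
            simp [g3, h2, h]
      · simp only [h, if_true]
        have : (Cond.eq (.ld (.reg 6 + .reg 14)) (.lit 1)).cost = 5 := by decide
        omega
    · refine Tri.mono (Tri.ite (T := 0) (T' := 0) hc (fun hn => absurd (hh.1 hn) h)
        fun _ => Tri.skip ?_) ?_ fun _ h => h
      · refine ⟨ho, ?_, ?_, ?_⟩
        · intro y hy
          rw [NState.set_mem, hl y hy]
          by_cases hyx : y = x
          · subst hyx
            simp [h]
          · simp only [show y < x + 1 ↔ y < x by omega]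
        · simp only [NState.set_reg]
          simp [h1, h]
        · simp only [NState.set_reg]
          simp [h2, h]
      · have : (Cond.eq (.ld (.reg 6 + .reg 14)) (.lit 1)).cost = 5 := by decide
        simp only [h, if_false]
        omega
  · rintro s' hf ⟨ho, hl, h1, h2⟩
    refine ⟨ho, ?_, ?_, ?_⟩
    · intro y hy
      rw [hl y hy]
      simp [hy]
    · rw [h1, l3, filter_range_left]
    · rw [h2, l3, filter_range_right]
  · rw [Finset.sum_add_distrib, ← Finset.sum_filter, Finset.sum_const, Finset.sum_const, hm]
    simp
    omega

/-- Keep the candidates with the label in register 38. -/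
def relabelStm : Stm :=
  .forTo 14 3 (.ite (.eq (.ld (.reg 6 + .reg 14)) (.reg 38))
    (.seq (.store (.reg 6 + .reg 14) (.lit 1))
      (.ite (.lt (.reg 14) (.reg 1)) (.assign 15 (.reg 14)) (.assign 16 (.reg 14))))
    (.store (.reg 6 + .reg 14) (.lit 0)))

/-- Besides the new labels, this supplies the next pair `u`, `v`: registers 15 and 16 keep the last
surviving candidate on either side, and `hu` and `hv` guarantee that there is one. -/
theorem relabelStm_spec {β : ℕ} (hE : Env L s) (h38 : s.reg 38 = β)
    (hu : ∃ x < L.n, s.mem (L.lab + x) = β) (hv : ∃ x, L.n ≤ x ∧ x < L.N ∧ s.mem (L.lab + x) = β) :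
    Tri L.w L.S relabelStm s (40 * L.N + 10) fun s' => OnlyLab L s s' ∧
      (∀ y < L.N, s'.mem (L.lab + y) = if s.mem (L.lab + y) = β then 1 else 0) ∧
      (s'.reg 15 < L.n ∧ s.mem (L.lab + s'.reg 15) = β) ∧
      (L.n ≤ s'.reg 16 ∧ s'.reg 16 < L.N ∧ s.mem (L.lab + s'.reg 16) = β) := by
  obtain ⟨l1, l2, l3, l4, l5, l6, l7, l8, l9, l10, l11, l12, l13, l14⟩ := L.facts
  refine Tri.mono (Tri.forTo (fun x s' => OnlyLab L s s' ∧
      (∀ y < L.N, s'.mem (L.lab + y) = if y < x then (if s.mem (L.lab + y) = β then 1 else 0)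
        else s.mem (L.lab + y)) ∧
      ((∃ y < x, y < L.n ∧ s.mem (L.lab + y) = β) →
        s'.reg 15 < L.n ∧ s.mem (L.lab + s'.reg 15) = β) ∧
      ((∃ y < x, L.n ≤ y ∧ s.mem (L.lab + y) = β) →
        L.n ≤ s'.reg 16 ∧ s'.reg 16 < L.N ∧ s.mem (L.lab + s'.reg 16) = β))
      (fun x => 20) L.N hE.N (by decide) (by omega) ?_ ?_ ?_) ?_ fun _ h => h
  · exact ⟨fun _ _ => rfl, by simp, by simp, by simp⟩
  · rintro x hx s' hf h14 ⟨ho, hl, h1, h2⟩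
    have hE' := hE.frame hf (by decide)
    have hlx : s'.mem (L.lab + x) = s.mem (L.lab + x) := by
      rw [hl x hx, if_neg (by omega)]
    have e38 : s'.reg 38 = β := by rw [hf 38 (by decide), h38]
    refine Tri.mono (Tri.of_vc ?_) (by decide) fun _ h => h
    simp only [Stm.vc, Cond.ok_eq, Cond.ok_lt, Cond.holds_eq, Cond.holds_lt, Ex.ok_add, Ex.ok_ld,
      Ex.ok_reg, Ex.ok_lit, Ex.val_add, Ex.val_reg, Ex.val_lit, Ex.val_ld, NState.set_reg,
      NState.set_mem, NState.put_reg, e38, h14, hE'.lab, hE'.n, hlx]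
    have hput : ∀ c, OnlyLab L s (s'.put (L.lab + x) c) := fun c a ha => by
      rw [NState.put_mem_ne _ (by omega), ho a ha]
    refine ⟨by omega, fun hb => ⟨by omega, by omega, by omega, by norm_num, fun hxn => ?_,
      fun hxn => ?_⟩, fun hb => ⟨by omega, by omega, by omega, ?_⟩⟩
    · refine ⟨by norm_num, by norm_num, hput 1, ?_, ?_, ?_⟩
      · intro y hy
        rw [NState.put_mem, hl y hy]
        by_cases hyx : y = x
        · subst hyx
          simp [hb]
        · simp [hyx, show y < x + 1 ↔ y < x by omega]
      · intro _
        simpa using ⟨hxn, hb⟩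
      · rintro ⟨y, hy, hyn, hyb⟩
        simpa using h2 ⟨y, by omega, hyn, hyb⟩
    · refine ⟨by norm_num, by norm_num, hput 1, ?_, ?_, ?_⟩
      · intro y hy
        rw [NState.put_mem, hl y hy]
        by_cases hyx : y = x
        · subst hyx
          simp [hb]
        · simp [hyx, show y < x + 1 ↔ y < x by omega]
      · rintro ⟨y, hy, hyn, hyb⟩
        simpa using h1 ⟨y, by omega, hyn, hyb⟩
      · intro _
        simpa using ⟨not_lt.1 hxn, hx, hb⟩
    · refine ⟨hput 0, ?_, ?_, ?_⟩
      · intro y hy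
        rw [NState.put_mem, hl y hy]
        by_cases hyx : y = x
        · subst hyx
          simp [hb]
        · simp [hyx, show y < x + 1 ↔ y < x by omega]
      · rintro ⟨y, hy, hyn, hyb⟩
        have : y ≠ x := fun e => hb (e ▸ hyb)
        simpa using h1 ⟨y, by omega, hyn, hyb⟩
      · rintro ⟨y, hy, hyn, hyb⟩
        have : y ≠ x := fun e => hb (e ▸ hyb)
        simpa using h2 ⟨y, by omega, hyn, hyb⟩
  · rintro s' hf ⟨ho, hl, h1, h2⟩
    refine ⟨ho, ?_, ?_, ?_⟩
    · intro y hy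
      rw [hl y hy, if_pos hy]
    · obtain ⟨x, hx, hxb⟩ := hu
      exact h1 ⟨x, by omega, hx, hxb⟩
    · obtain ⟨x, hx, hx', hxb⟩ := hv
      exact h2 ⟨x, hx', hx, hxb⟩
  · simp
    omega

/-- Choose the label of the smaller part. -/
def chooseStm : Stm :=
  .ite (.lt (.reg 17) (.reg 35 + .reg 35))
    (.seq (.assign 38 (.lit 1)) (.assign 17 (.reg 17 - .reg 35)))
    (.seq (.assign 38 (.lit 2)) (.assign 17 (.reg 35)))

/-- Replace the set of candidates by a part of at most half its size. -/
def splitStm : Stm :=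
  .seq (.seq (.assign 35 (.lit 0)) (.assign 36 (.lit 0)))
  (.seq markStm
  (.ite (.eq (.reg 35) (.reg 36)) (.seq chooseStm relabelStm)
    (.seq (.assign 0 (.lit 0)) (.assign 17 (.lit 0)))))

/-- There are candidates, or the answer is known. -/
structure Status (L : Layout) (g : ℕ → ℕ → ℕ) (s : NState) : Prop where
  -- Register 17 counts the candidates on each side, and 0 means that register 0 holds the answer.
  -- Labels are at most 1 between rounds, so that a 2 can mark a difference.
  labels : 0 < s.reg 17 → ∀ x < L.N, s.mem (L.lab + x) ≤ 1
  left : 0 < s.reg 17 → s.reg 15 < L.n ∧ s.mem (L.lab + s.reg 15) = 1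
  right : 0 < s.reg 17 → L.n ≤ s.reg 16 ∧ s.reg 16 < L.N ∧ s.mem (L.lab + s.reg 16) = 1
  cand : 0 < s.reg 17 → Cand L.n L.d g (fun x => s.mem (L.lab + x) = 1) (s.reg 17)
  yes : s.reg 17 = 0 → (∃ σ, IsIso L.n L.d g σ) → s.reg 0 = 1
  no : s.reg 17 = 0 → (¬ ∃ σ, IsIso L.n L.d g σ) → s.reg 0 = 0

theorem Cand.card_range {n d m : ℕ} {P : ℕ → Prop} [DecidablePred P] (h : Cand n d g P m) :
    ((Finset.range (2 * n)).filter P).card = 2 * m := by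
  have h1 := Finset.card_filter_add_card_filter_not (s := (Finset.range (2 * n)).filter P)
    (fun x => x < n)
  rw [Finset.filter_filter, Finset.filter_filter] at h1
  have h2 := filter_range_left n P
  have h3 := filter_range_right n P
  simp only [not_lt] at h1
  rw [Finset.filter_congr (q := fun x => x < n ∧ P x) fun x _ => and_comm, h2,
    Finset.filter_congr (q := fun x => n ≤ x ∧ P x) fun x _ => and_comm, h3, h.left, h.right] at h1
  omega

end Conj

/-! ### One round and the sum over all rounds -/

namespace Conj

open WordRAM

variable {L : Layout} {g : ℕ → ℕ → ℕ} {s : NState} {u v k l : ℕ}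

/-- The left point `u` lies in the agreeing part and the right point `v` in the differing part. If
the sizes match on the two sides, both parts are therefore nonempty on both sides, and the smaller
one can replace the candidates. Unequal sizes rule out an isomorphism; in particular this must
happen when `m = 1`. -/
theorem splitStm_spec {K k l : ℕ} (ha : Acts L.n L.d g) (hE : Env L s) (hT : Tab L g s)
    (hW : Words L s K k l) (hK : K ≤ L.n + 1) (hS : Status L g s) (hm : 0 < s.reg 17)
    (hu : chain L.d g (codes L s 0) k (s.reg 15) = chain L.d g (codes L s k) l (s.reg 15))
    (hv : chain L.d g (codes L s 0) k (s.reg 16) ≠ chain L.d g (codes L s k) l (s.reg 16)) :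
    Tri L.w L.S splitStm s (100 * L.N + 100 + 2 * s.reg 17 * (80 * K + 80)) fun s' =>
      Tab L g s' ∧ Status L g s' ∧ 2 * s'.reg 17 ≤ s.reg 17 := by
  obtain ⟨l1, l2, l3, l4, l5, l6, l7, l8, l9, l10, l11, l12, l13, l14⟩ := L.facts
  set m := s.reg 17 with hmdef
  set F := chain L.d g (codes L s 0) k with hF
  set G := chain L.d g (codes L s k) l with hG
  have hFw : IsWord L.d g F := isWord_chain (by omega) _ _
  have hGw : IsWord L.d g G := isWord_chain (by omega) _ _
  have hC : Cand L.n L.d g (fun x => s.mem (L.lab + x) = 1) m := hS.cand hm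
  obtain ⟨hu1, hu2⟩ := hS.left hm
  obtain ⟨hv1, hv2, hv3⟩ := hS.right hm
  have hmn : m ≤ L.n := by
    rw [← hC.left]
    exact card_filter_le_range _ _
  refine Tri.mono (T := 4 + ((30 * L.N + 10 + 2 * m * (80 * K + 80)) + (40 * L.N + 50)))
    (Tri.bind (R := fun s' => s' = (s.set 35 0).set 36 0)
      (Tri.mono (Tri.of_vc ?_) (show _ ≤ 4 by decide) fun _ h => h) ?_) (by omega) fun _ h => h
  · simp only [Stm.vc, Ex.ok_lit, Ex.val_lit]
    simp [scratch]
  rintro s1 rfl -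
  have hE1 : Env L ((s.set 35 0).set 36 0) := (hE.set (by norm_num)).set (by norm_num)
  have hW1 : Words L ((s.set 35 0).set 36 0) K k l :=
    ⟨by simpa using hW.sep, by simpa using hW.top, hW.left_le, hW.right_le, hW.left, hW.right⟩
  have hmark := markStm_spec (m := 2 * m) (F := F) (G := G) ha hE1
    (hT.congr fun _ _ => rfl) hW1 hK (by simp) (by simp) (by rw [l3]; exact hC.card_range) rfl rfl
  refine Tri.bind hmark ?_
  rintro s2 ⟨o2, g1, g2, g3⟩ f2
  have hE2 := hE1.frame f2 (by decide)
  replace g1 : ∀ y < L.N, s2.mem (L.lab + y) = if s.mem (L.lab + y) = 1 ∧ F y ≠ G y then 2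
      else s.mem (L.lab + y) := g1
  replace g2 : s2.reg 35 = ((Finset.range L.n).filter
      fun x => s.mem (L.lab + x) = 1 ∧ F x ≠ G x).card := g2
  replace g3 : s2.reg 36 = ((Finset.Ico L.n (2 * L.n)).filter
      fun x => s.mem (L.lab + x) = 1 ∧ F x ≠ G x).card := g3
  have hT2 : Tab L g s2 := o2.tab (hT.congr fun _ _ => rfl)
  have e17 : s2.reg 17 = m := by
    rw [f2 17 (by decide)]
    simp [hmdef]
  have hka : s2.reg 35 ≤ L.n := by
    rw [g2]
    exact card_filter_le_range _ _
  have hle1 : s2.reg 35 ≤ m := by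
    rw [g2, ← hC.left]
    exact Finset.card_le_card (Finset.monotone_filter_right _ fun x _ h => h.1)
  refine Tri.mono (Tri.ite (T := 30 + (40 * L.N + 10)) (T' := 4) ?_ (fun hc => ?_) (fun hc => ?_))
    ?_ fun _ h => h
  · simp only [Cond.ok_eq, Ex.ok_reg]
    omega
  · simp only [Cond.holds_eq, Ex.val_reg] at hc
    have hkr : ((Finset.Ico L.n (2 * L.n)).filter
        fun x => s.mem (L.lab + x) = 1 ∧ F x ≠ G x).card = s2.reg 35 := by rw [hc, g3]
    have hpos : 0 < s2.reg 35 := by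
      rw [← hkr]
      refine Finset.card_pos.2 ⟨s.reg 16, ?_⟩
      simp only [Finset.mem_filter, Finset.mem_Ico]
      exact ⟨⟨hv1, by omega⟩, hv3, hv⟩
    have hCe := hC.eq ha hFw hGw g2.symm hkr
    have hCn := hC.ne ha hFw hGw g2.symm hkr
    have hpos' : 0 < m - s2.reg 35 := by
      rw [← hCe.left]
      refine Finset.card_pos.2 ⟨s.reg 15, ?_⟩
      simp only [Finset.mem_filter, Finset.mem_range]
      exact ⟨hu1, hu2, hu⟩
    have hch : Tri L.w L.S chooseStm s2 30 fun s' => s'.mem = s2.mem ∧ 0 < s'.reg 17 ∧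
        2 * s'.reg 17 ≤ m ∧ Cand L.n L.d g (fun x => s2.mem (L.lab + x) = s'.reg 38) (s'.reg 17) ∧
        s'.reg 38 ≠ 0 := by
      refine Tri.mono (Tri.of_vc ?_) (by decide) fun _ h => h
      simp only [chooseStm, Stm.vc, Cond.ok_lt, Cond.holds_lt, Ex.ok_add, Ex.ok_sub, Ex.ok_reg,
        Ex.ok_lit, Ex.val_add, Ex.val_sub, Ex.val_reg, Ex.val_lit, NState.set_reg, NState.set_mem,
        e17]
      simp [scratch]
      refine ⟨by omega, fun h => ⟨l14, by omega, by omega, by omega, ?_⟩,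
        fun h => ⟨by omega, by omega, by omega, ?_⟩⟩
      -- All labels were at most 1 before marking, so label 1 now means agreement and label 2
      -- difference.
      · refine hCe.congr fun x hx => ?_
        have := hS.labels hm x (by omega)
        rw [g1 x (by omega)]
        split_ifs with h'
        · exact ⟨fun h2 => by omega, fun h2 => absurd h2.2 h'.2⟩
        · constructor
          · intro h1
            exact ⟨h1, by_contra fun h2 => h' ⟨h1, h2⟩⟩
          · exact fun h1 => h1.1
      · refine hCn.congr fun x hx => ?_
        have := hS.labels hm x (by omega)
        rw [g1 x (by omega)]
        split_ifs with h'
        · simp [h']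
        · constructor
          · intro h1
            omega
          · exact fun h1 => absurd h1 h'
    refine Tri.bind hch ?_
    rintro s3 ⟨m3, p3, q3, c3, b3⟩ f3
    have hE3 := hE2.frame f3 (by decide)
    obtain ⟨x, hx⟩ := Finset.card_pos.1 (c3.left ▸ p3)
    obtain ⟨y, hy⟩ := Finset.card_pos.1 (c3.right ▸ p3)
    simp only [Finset.mem_filter, Finset.mem_range, Finset.mem_Ico] at hx hy
    refine (relabelStm_spec hE3 rfl ⟨x, hx.1, by rw [m3]; exact hx.2⟩
      ⟨y, hy.1.1, by omega, by rw [m3]; exact hy.2⟩).frame.mono le_rfl ?_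
    rintro s4 ⟨⟨o4, r1, r2, r3⟩, f4⟩
    have e17' : s4.reg 17 = s3.reg 17 := f4 17 (by decide)
    have hone : ∀ z < L.N, s4.mem (L.lab + z) = 1 ↔ s2.mem (L.lab + z) = s3.reg 38 := by
      intro z hz
      rw [r1 z hz, m3]
      split_ifs with h <;> simp [h]
    refine ⟨o4.tab (hT2.congr fun a _ => by rw [m3]), ⟨?_, ?_, ?_, ?_, ?_, ?_⟩, by omega⟩
    · intro _ z hz
      rw [r1 z hz]
      split_ifs <;> omega
    · intro _
      exact ⟨r2.1, (hone _ (by omega)).2 (by rw [← m3]; exact r2.2)⟩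
    · intro _
      exact ⟨r3.1, r3.2.1, (hone _ r3.2.1).2 (by rw [← m3]; exact r3.2.2)⟩
    · intro _
      rw [e17']
      exact c3.congr fun z hz => hone z (by omega)
    · intro h0
      omega
    · intro h0
      omega
  · simp only [Cond.holds_eq, Ex.val_reg] at hc
    have hno : ¬ ∃ σ, IsIso L.n L.d g σ := by
      rintro ⟨σ, hσ⟩
      refine hc ?_
      rw [g2, g3]
      exact hσ.card_eq _ fun x hx => hC.iso_ne ha hFw hGw hσ hx
    refine Tri.mono (Tri.of_vc ?_) (by decide) fun _ h => h
    have e : ((s2.set 0 0).set 17 0).reg 17 = 0 := by simp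
    refine ⟨by norm_num, Nat.two_pow_pos _, by norm_num, Nat.two_pow_pos _,
      hT2.congr (fun _ _ => rfl), ⟨?_, ?_, ?_, ?_, fun _ h => absurd h hno, fun _ _ => ?_⟩, ?_⟩
    · exact fun h => absurd e h.ne'
    · exact fun h => absurd e h.ne'
    · exact fun h => absurd e h.ne'
    · exact fun h => absurd e h.ne'
    · simp [Ex.val_lit]
    · simp [Ex.val_lit]
  · have : (Cond.eq (.reg 35) (.reg 36)).cost = 2 := by decide
    omega

/-- Try to map the vertex in register 15 to the vertex in register 16. -/
def roundStm : Stm :=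
  .seq bfsStm (.ite (.eq (.reg 18) (.lit 0))
    (.seq (.assign 0 (.lit 1)) (.assign 17 (.lit 0)))
    (.seq wordsStm splitStm))

theorem roundStm_spec {ℓ : ℕ} (ha : Acts L.n L.d g) (hE : Env L s) (hT : Tab L g s)
    (hS : Status L g s) (hm : 0 < s.reg 17) (hℓ : 0 < ℓ) (hℓ' : 2 * L.d ^ ℓ ≤ L.sq + 2 * L.d) :
    Tri L.w L.S roundStm s (600 * (L.n * L.d) + 2 * s.reg 17 * (80 * (L.n / ℓ) + 160)) fun s' =>
      Tab L g s' ∧ Status L g s' ∧ 2 * s'.reg 17 ≤ s.reg 17 := by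
  obtain ⟨l1, l2, l3, l4, l5, l6, l7, l8, l9, l10, l11, l12, l13, l14⟩ := L.facts
  obtain ⟨hu1, hu2⟩ := hS.left hm
  obtain ⟨hv1, hv2, hv3⟩ := hS.right hm
  have hK : L.n / ℓ + 1 ≤ L.n + 1 := Nat.succ_le_succ (Nat.div_le_self _ _)
  refine Tri.mono (T := 200 * (L.n * L.d) + (3 + (((200 * L.n + 20) + (100 * L.N + 100 +
    2 * s.reg 17 * (80 * (L.n / ℓ + 1) + 80))) + 1)))
    (Tri.bind (bfsStm_spec ha hE hT rfl rfl hu1 hv1 hv2) ?_) ?_ fun _ h => h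
  · rintro s1 ⟨m1, ⟨dep, hTr⟩, hyes, hconf⟩ f1
    have hE1 := hE.frame f1 (by decide)
    have hT1 : Tab L g s1 := hT.congr fun a ha => m1 a (by omega)
    have e15 : s1.reg 15 = s.reg 15 := f1 15 (by decide)
    have e16 : s1.reg 16 = s.reg 16 := f1 16 (by decide)
    have e17 : s1.reg 17 = s.reg 17 := f1 17 (by decide)
    refine Tri.mono (Tri.ite (T := 4) (T' := (200 * L.n + 20) + (100 * L.N + 100 +
      2 * s.reg 17 * (80 * (L.n / ℓ + 1) + 80))) ?_ (fun hc => ?_) (fun hc => ?_)) ?_ fun _ h => h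
    · simp only [Cond.ok_eq, Ex.ok_reg, Ex.ok_lit]
      exact ⟨by norm_num, Nat.two_pow_pos _⟩
    · simp only [Cond.holds_eq, Ex.val_reg, Ex.val_lit] at hc
      -- Without a conflict, the computed images form an equivariant map, hence an isomorphism.
      have hiso : ∃ σ, IsIso L.n L.d g σ :=
        ⟨fun x => s1.mem (L.tau + x), ha.isIso (by omega) hTr.image (hyes hc)⟩
      refine Tri.mono (Tri.of_vc ?_) (by decide) fun _ h => h
      have e : ((s1.set 0 1).set 17 0).reg 17 = 0 := by simp
      refine ⟨by norm_num, ?_, by norm_num, Nat.two_pow_pos _,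
        hT1.congr (fun _ _ => rfl), ⟨?_, ?_, ?_, ?_, fun _ _ => ?_, fun _ h => absurd hiso h⟩, ?_⟩
      · rw [Ex.ok_lit]
        omega
      · exact fun h => absurd e h.ne'
      · exact fun h => absurd e h.ne'
      · exact fun h => absurd e h.ne'
      · exact fun h => absurd e h.ne'
      · simp [Ex.val_lit]
      · simp [Ex.val_lit]
    · simp only [Cond.holds_eq, Ex.val_reg, Ex.val_lit] at hc
      obtain ⟨h19, h20, h21, hne⟩ := hconf hc
      refine Tri.bind (wordsStm_spec hE1 hTr ha hℓ hℓ' h19 h20 h21 hne) ?_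
      rintro s2 ⟨k, l, hW, hFu, hFv, m2⟩ f2
      have hE2 := hE1.frame f2 (by decide)
      have e15' : s2.reg 15 = s.reg 15 := by rw [f2 15 (by decide), e15]
      have e16' : s2.reg 16 = s.reg 16 := by rw [f2 16 (by decide), e16]
      have e17' : s2.reg 17 = s.reg 17 := by rw [f2 17 (by decide), e17]
      have hlab : ∀ x < L.N, s2.mem (L.lab + x) = s.mem (L.lab + x) := fun x hx => by
        rw [m2 _ (by omega), m1 _ (by omega)]
      have hS2 : Status L g s2 := by
        refine ⟨fun _ x hx => ?_, fun _ => ?_, fun _ => ?_, fun _ => ?_, fun h => ?_, fun h => ?_⟩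
        · rw [hlab x hx]
          exact hS.labels hm x hx
        · rw [e15', hlab _ (by omega)]
          exact hS.left hm
        · rw [e16', hlab _ hv2]
          exact hS.right hm
        · rw [e17']
          refine (hS.cand hm).congr fun x hx => ?_
          rw [hlab x (by omega)]
        · omega
        · omega
      have h := splitStm_spec ha hE2 (hT1.congr fun a ha => m2 a (by omega)) hW hK hS2
        (by omega) (by rw [e15']; exact hFu) (by rw [e16']; exact hFv)
      rwa [e17'] at h
    · have : (Cond.eq (.reg 18) (.lit 0)).cost = 2 := by decide
      omega
  · have h2 : L.n * 2 ≤ L.n * L.d := Nat.mul_le_mul_left _ l2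
    have e : 80 * (L.n / ℓ + 1) + 80 = 80 * (L.n / ℓ) + 160 := by ring
    rw [e]
    omega

/-- All rounds. -/
def roundsStm : Stm := .whileDo (.lt (.lit 0) (.reg 17)) roundStm

theorem roundsStm_spec {ℓ : ℕ} (ha : Acts L.n L.d g) (hE : Env L s) (hT : Tab L g s)
    (hS : Status L g s) (hm : s.reg 17 ≤ L.n) (hℓ : 0 < ℓ)
    (hℓ' : 2 * L.d ^ ℓ ≤ L.sq + 2 * L.d) :
    Tri L.w L.S roundsStm s (700 * (L.n * L.d * (Nat.log 2 L.n + 1)) +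
      4 * L.n * (80 * (L.n / ℓ) + 160)) fun s' =>
        ((∃ σ, IsIso L.n L.d g σ) → s'.reg 0 = 1) ∧
        ((¬ ∃ σ, IsIso L.n L.d g σ) → s'.reg 0 = 0) := by
  obtain ⟨l1, l2, l3, l4, l5, l6, l7, l8, l9, l10, l11, l12, l13, l14⟩ := L.facts
  set X := 80 * (L.n / ℓ) + 160 with hX
  set Y := 600 * (L.n * L.d) with hY
  have hcost : (Cond.lt (.lit 0) (.reg 17)).cost = 2 := by decide
  have hnd : L.n * 2 ≤ L.n * L.d := Nat.mul_le_mul_left _ l2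
  -- The round pays `2 * a * X` for evaluations, and `4 * b * X ≤ 2 * a * X` remains for later ones.
  -- The logarithm drops by at least one and pays for the search and the loop test, `Y + 3`
  -- together.
  have hΦ : ∀ a b, 2 * b ≤ a → 0 < a → (if b = 0 then 0 else 4 * b * X + (Nat.log 2 b + 1) * (Y + 3))
      + (Y + 2 * a * X) + 3 ≤ 4 * a * X + (Nat.log 2 a + 1) * (Y + 3) := by
    intro a b hab ha
    have h1 : 4 * b * X ≤ 2 * a * X := Nat.mul_le_mul_right _ (by omega)
    have h3 : 2 * a * X + 2 * a * X = 4 * a * X := by ring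
    split_ifs with hb
    · nlinarith [Nat.zero_le (Nat.log 2 a * (Y + 3))]
    · have h2 : Nat.log 2 b + 1 ≤ Nat.log 2 a := by
        rw [← Nat.log_mul_base (by norm_num) hb]
        exact Nat.log_mono_right (by omega)
      have h4 := Nat.mul_le_mul_right (Y + 3) h2
      have h5 : (Nat.log 2 a + 1) * (Y + 3) = Nat.log 2 a * (Y + 3) + (Y + 3) := by ring
      omega
  refine Tri.mono (Tri.whileDo_frame (fun s' => Tab L g s' ∧ Status L g s' ∧ s'.reg 17 ≤ L.n)
    (fun s' => if s'.reg 17 = 0 then 0 else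
      4 * s'.reg 17 * X + (Nat.log 2 (s'.reg 17) + 1) * (Y + 3)) ⟨hT, hS, hm⟩ ?_ ?_ ?_) ?_
      fun _ h => h
  · intro s' _ _
    simp only [Cond.ok_lt, Ex.ok_reg, Ex.ok_lit]
    exact ⟨Nat.two_pow_pos _, by norm_num⟩
  · rintro s' hf ⟨hT', hS', hm'⟩ hc
    have hE' := hE.frame hf (by decide)
    simp only [Cond.holds_lt, Ex.val_reg, Ex.val_lit] at hc
    refine ⟨Y + 2 * s'.reg 17 * X, (roundStm_spec ha hE' hT' hS' hc hℓ hℓ').mono le_rfl ?_⟩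
    rintro s2 ⟨h1, h2, h3⟩
    refine ⟨⟨h1, h2, by omega⟩, ?_⟩
    rw [hcost, if_neg hc.ne']
    have := hΦ _ _ h3 hc
    omega
  · rintro s' hf ⟨hT', hS', hm'⟩ hc
    simp only [Cond.holds_lt, Ex.val_reg, Ex.val_lit] at hc
    exact ⟨hS'.yes (by omega), hS'.no (by omega)⟩
  · rw [hcost]
    have h1 : 4 * s.reg 17 * X ≤ 4 * L.n * X := Nat.mul_le_mul_right _ (by omega)
    have h2 : (Nat.log 2 (s.reg 17) + 1) * (Y + 3) ≤ (Nat.log 2 L.n + 1) * (Y + 3) :=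
      Nat.mul_le_mul_right _ (Nat.succ_le_succ (Nat.log_mono_right hm))
    have h3 : (Nat.log 2 L.n + 1) * (Y + 6) ≤ 700 * (L.n * L.d * (Nat.log 2 L.n + 1)) := by
      have : Y + 6 ≤ 700 * (L.n * L.d) := by omega
      calc (Nat.log 2 L.n + 1) * (Y + 6) ≤ (Nat.log 2 L.n + 1) * (700 * (L.n * L.d)) :=
            Nat.mul_le_mul_left _ this
        _ = _ := by ring
    have h4 : (Nat.log 2 L.n + 1) * (Y + 6) = (Nat.log 2 L.n + 1) * (Y + 3) +
      3 * (Nat.log 2 L.n) + 3 := by ring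
    split_ifs <;> omega

end Conj

namespace Conj

open WordRAM

variable {L : Layout} {g : ℕ → ℕ → ℕ} {s : NState}

/-! ### Initialization -/

/-- The square root of `n`, rounded up. -/
def sqrtStm : Stm :=
  .seq (.assign 12 (.lit 0))
    (.whileDo (.lt (.reg 12 * .reg 12) (.reg 1)) (.assign 12 (.reg 12 + .lit 1)))

/-- Compute the places of the arrays. -/
def layoutStm : Stm :=
  .seq (.assign 3 (.reg 1 + .reg 1))
  (.seq (.assign 4 ((.reg 12 + .reg 2 + .lit 1) * .reg 3))
  (.seq (.assign 5 (.lit 2 + .reg 3 * .reg 2))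
  (.seq (.assign 6 (.reg 5 + .reg 4))
  (.seq (.assign 7 (.reg 6 + .reg 3))
  (.seq (.assign 8 (.reg 7 + .reg 1))
  (.seq (.assign 9 (.reg 8 + .reg 1))
  (.seq (.assign 10 (.reg 9 + .reg 1))
  (.seq (.assign 11 (.reg 10 + .reg 1))
  (.assign 13 (.lit 0))))))))))

/-- Compute one entry of the table of words. -/
def cellStm : Stm :=
  .ite (.lt (.reg 14) (.reg 3)) (.store (.reg 5 + .reg 14) (.reg 14))
  (.ite (.lt (.reg 14 / .reg 3) (.reg 2 + .lit 1))
    (.ite (.lt (.reg 14 % .reg 3) (.reg 1))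
      (.store (.reg 5 + .reg 14)
        (.ld (.lit 2 + ((.reg 14 / .reg 3 - .lit 1) * .reg 1 + .reg 14 % .reg 3))))
      (.store (.reg 5 + .reg 14)
        (.ld (.lit 2 + (.reg 1 * .reg 2 + ((.reg 14 / .reg 3 - .lit 1) * .reg 1 +
          (.reg 14 % .reg 3 - .reg 1)))) + .reg 1)))
    (.store (.reg 5 + .reg 14) (tabAt ((.reg 14 / .reg 3 - .lit 1) / .reg 2)
      (tabAt ((.reg 14 / .reg 3 - .lit 1) % .reg 2 + .lit 1) (.reg 14 % .reg 3)))))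

/-- The algorithm for at least two points and at least two permutations. -/
def coreStm : Stm :=
  .seq sqrtStm (.seq layoutStm (.seq (.forTo 14 4 cellStm)
  (.seq (.forTo 14 3 (.store (.reg 6 + .reg 14) (.lit 1)))
  (.seq (.seq (.assign 15 (.lit 0)) (.seq (.assign 16 (.reg 1)) (.assign 17 (.reg 1))))
  roundsStm))))

/-- The memory holds the two tuples. -/
def Input (L : Layout) (g : ℕ → ℕ → ℕ) (s : NState) : Prop :=
  ∀ j < L.d, ∀ x < L.n, s.mem (2 + (j * L.n + x)) = g j x ∧
    s.mem (2 + (L.n * L.d + (j * L.n + x))) + L.n = g j (L.n + x)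

theorem Layout.sq_le (L : Layout) : L.sq ≤ L.n := by
  have hn := L.hn
  by_contra h
  have := L.hsq' (L.sq - 1) (by omega)
  have h2 : (L.sq - 1) * 1 ≤ (L.sq - 1) * (L.sq - 1) := Nat.mul_le_mul_left _ (by omega)
  omega

/-- Needed so that the product in the linear search for the square root does not overflow. -/
theorem Layout.sq_mul_le (L : Layout) : L.sq * L.sq < L.T := by
  obtain ⟨l1, l2, l3, -⟩ := L.facts
  have h1 : L.sq * L.sq ≤ L.sq * L.N := Nat.mul_le_mul_left _ (by have := L.sq_le; omega)
  have h2 : (L.sq + 1) * L.N ≤ L.T := by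
    rw [L.hT]
    exact Nat.mul_le_mul_right _ (by omega)
  rw [Nat.add_mul] at h2
  omega

theorem sqrtStm_spec (h1 : s.reg 1 = L.n) :
    Tri L.w L.S sqrtStm s (20 * L.n + 20) fun s' => s'.mem = s.mem ∧ s'.reg 12 = L.sq := by
  obtain ⟨l1, l2, l3, l4, l5, l6, l7, l8, l9, l10, l11, l12, l13, l14⟩ := L.facts
  have hle := L.sq_le
  have hsq := L.sq_mul_le
  refine Tri.mono (T := 2 + (4 + 1 + 10 * L.sq)) (Tri.seq (Tri.assign (by norm_num)
    (Nat.two_pow_pos _) ?_)) (by omega) fun _ h => h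
  have key := Tri.whileDo_frame (w := L.w) (S := L.S) (s := s.set 12 0)
    (c := .lt (.reg 12 * .reg 12) (.reg 1)) (p := .assign 12 (.reg 12 + .lit 1))
    (Q := fun s' => s'.mem = s.mem ∧ s'.reg 12 = L.sq)
    (fun s' => s'.mem = s.mem ∧ s'.reg 12 ≤ L.sq) (fun s' => 10 * (L.sq - s'.reg 12)) ?_ ?_ ?_ ?_
  · exact key.mono (by simp [Cond.cost]; decide) fun _ h => h
  · simp
  · rintro s' hf ⟨hm, hle'⟩
    have : s'.reg 12 * s'.reg 12 ≤ L.sq * L.sq := Nat.mul_le_mul hle' hle'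
    simp only [Cond.ok_lt, Ex.ok_mul, Ex.ok_reg, Ex.val_reg]
    omega
  · rintro s' hf ⟨hm, hle'⟩ hc
    simp only [Cond.holds_lt, Ex.val_mul, Ex.val_reg, hf 1 (by decide)] at hc
    simp [h1] at hc
    have hlt : s'.reg 12 < L.sq := by
      rcases Nat.lt_or_eq_of_le hle' with h | h
      · exact h
      · have := L.hsq
        rw [h] at hc
        omega
    have hc4 : (Cond.lt (.reg 12 * .reg 12) (.reg 1)).cost = 4 := by decide
    refine ⟨4, Tri.mono (Tri.of_vc ?_) (by decide) fun _ h => h⟩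
    simp only [Stm.vc, Ex.ok_add, Ex.ok_reg, Ex.ok_lit, Ex.val_add, Ex.val_reg, Ex.val_lit,
      NState.set_reg, NState.set_mem, hc4, if_true]
    refine ⟨by norm_num, by omega, ⟨hm, hlt⟩, by omega⟩
  · rintro s' hf ⟨hm, hle'⟩ hc
    simp only [Cond.holds_lt, Ex.val_mul, Ex.val_reg, hf 1 (by decide)] at hc
    simp [h1] at hc
    refine ⟨hm, le_antisymm hle' ?_⟩
    by_contra h
    have := L.hsq' _ (not_le.1 h)
    omega

theorem layoutStm_spec (h1 : s.reg 1 = L.n) (h2 : s.reg 2 = L.d) (h12 : s.reg 12 = L.sq) :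
    Tri L.w L.S layoutStm s 60 fun s' => s'.mem = s.mem ∧ Env L s' := by
  obtain ⟨l1, l2, l3, l4, l5, l6, l7, l8, l9, l10, l11, l12, l13, l14⟩ := L.facts
  have e3 : L.n + L.n = L.N := by omega
  have e4 := L.hT.symm
  have e5 := L.htb.symm
  refine Tri.mono (Tri.of_vc ?_) (by decide) fun _ h => h
  simp only [layoutStm, Stm.vc, Ex.ok_add, Ex.ok_mul, Ex.ok_reg, Ex.ok_lit, Ex.val_add, Ex.val_mul,
    Ex.val_reg, Ex.val_lit, NState.set_reg, NState.set_mem]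
  simp [h1, h2, h12, scratch, e3, e4, e5, l6.symm, l7.symm, l8.symm, l9.symm, l10.symm, l11.symm]
  refine ⟨?_, ⟨⟨?_, l14, ?_⟩, ?_⟩, ⟨?_, ?_, ?_⟩, ?_, ?_, ?_, ?_, ?_, ?_, ?_⟩
  all_goals first | omega | skip
  constructor <;> simp [h1, h2, h12]

/-- Rows are filled in the order of their codes. Beyond the letters, row `j + 1` is composed of the
rows `j / d` and `j % d + 1`, both of which come earlier. -/
theorem cellStm_spec {p : ℕ} (ha : Acts L.n L.d g) (hE : Env L s) (hI : Input L g s)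
    (h14 : s.reg 14 = p) (hp : p < L.T)
    (hT : ∀ q < p, s.mem (L.tb + q) = row L.d g (q / L.N) (q % L.N)) :
    Tri L.w L.S cellStm s 100 fun s' => s' = s.put (L.tb + p) (row L.d g (p / L.N) (p % L.N)) := by
  obtain ⟨l1, l2, l3, l4, l5, l6, l7, l8, l9, l10, l11, l12, l13, l14⟩ := L.facts
  set c := p / L.N with hc
  set x := p % L.N with hx
  have hcx : c * L.N + x = p := Nat.div_add_mod' _ _
  have hxN : x < L.N := Nat.mod_lt _ (by omega)
  have hcM : c < L.sq + L.d + 1 := by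
    rw [hc, Nat.div_lt_iff_lt_mul (by omega), ← L.hT]
    exact hp
  have hcell : ∀ b y, b < c → y < L.N → s.mem (L.tb + (b * L.N + y)) = row L.d g b y := by
    intro b y hb hy
    have h1 : (b + 1) * L.N ≤ c * L.N := Nat.mul_le_mul_right _ hb
    rw [Nat.add_mul] at h1
    rw [hT _ (by omega), Nat.add_comm, Nat.add_mul_div_right _ _ (by omega), Nat.div_eq_of_lt hy,
      Nat.add_mul_mod_self_right, Nat.mod_eq_of_lt hy, Nat.zero_add]
  have htb := L.htb
  have eNd : L.N * L.d = L.n * L.d + L.n * L.d := by rw [l3]; ring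
  refine Tri.mono (Tri.of_vc ?_) (by decide) fun _ h => h
  simp only [cellStm, Stm.vc, Cond.ok_lt, Cond.holds_lt, Ex.ok_add, Ex.ok_sub, Ex.ok_mul, Ex.ok_div,
    Ex.ok_mod, Ex.ok_ld, Ex.ok_reg, Ex.ok_lit, Ex.val_add, Ex.val_sub, Ex.val_mul, Ex.val_div,
    Ex.val_mod, Ex.val_ld, Ex.val_reg, Ex.val_lit, h14, hE.N, hE.tb, hE.d, hE.n, ← hc, ← hx,
    val_tabAt hE, and_true]
  refine ⟨by norm_num, fun h => ⟨by omega, by norm_num, by omega, ?_⟩, fun h =>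
    ⟨by omega, fun hcd => ⟨by norm_num, fun hxn => ?_, fun hxn => ?_⟩, fun hcd => ?_⟩⟩
  · rw [hc, hx, Nat.div_eq_of_lt h, Nat.mod_eq_of_lt h, row_zero]
  -- Outside the first `N` cells the code is positive, so the truncated subtraction of 1 is exact.
  all_goals
    obtain ⟨j, hj⟩ : ∃ j, c = j + 1 := ⟨c - 1, by
      have : 0 < c := Nat.div_pos (not_lt.1 h) (by omega)
      omega⟩
    simp only [hj, Nat.add_sub_cancel]
  · have hjd : j < L.d := by omega
    have hjn : (j + 1) * L.n ≤ L.d * L.n := Nat.mul_le_mul_right _ hjd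
    rw [Nat.add_mul, Nat.mul_comm L.d] at hjn
    refine ⟨by omega, by omega, by omega, ?_⟩
    rw [(hI j hjd x hxn).1, row_letter hjd]
  · have hjd : j < L.d := by omega
    have hjn : (j + 1) * L.n ≤ L.d * L.n := Nat.mul_le_mul_right _ hjd
    rw [Nat.add_mul, Nat.mul_comm L.d] at hjn
    have hval := (hI j hjd (x - L.n) (by omega)).2
    rw [show L.n + (x - L.n) = x by omega] at hval
    have hgx := (ha.right j hjd x (by omega) (by omega)).2
    refine ⟨by omega, by omega, by omega, ?_⟩
    rw [hval, row_letter hjd]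
  · have hmod : j % L.d < L.d := Nat.mod_lt _ (by omega)
    have hdiv : j / L.d ≤ j := Nat.div_le_self _ _
    have hgx : g (j % L.d) x < L.N := by
      have := (IsWord.cons hmod IsWord.id).lt ha (x := x) (by omega)
      omega
    have e1 := hcell (j % L.d + 1) x (by omega) hxN
    rw [row_letter hmod] at e1
    have e2 := hcell (j / L.d) _ (by omega) hgx
    refine ⟨by omega, ok_tabAt hE ?_ ?_ ?_ ?_, by omega, ?_⟩
    · simp only [Ex.ok_sub, Ex.ok_div, Ex.ok_reg, Ex.ok_lit, Ex.val_sub, Ex.val_div, Ex.val_reg,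
        Ex.val_lit, h14, hE.N, ← hc, and_true]
      omega
    · refine ok_tabAt hE ?_ ?_ ?_ ?_
      · simp only [Ex.ok_add, Ex.ok_sub, Ex.ok_div, Ex.ok_mod, Ex.ok_reg, Ex.ok_lit, Ex.val_sub,
          Ex.val_div, Ex.val_mod, Ex.val_reg, Ex.val_lit, h14, hE.N, hE.d, ← hc, hj,
          Nat.add_sub_cancel, and_true]
        omega
      · simp only [Ex.ok_mod, Ex.ok_reg, and_true]
        omega
      · simp only [Ex.val_add, Ex.val_sub, Ex.val_div, Ex.val_mod, Ex.val_reg, Ex.val_lit, h14,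
          hE.N, hE.d, ← hc, hj, Nat.add_sub_cancel]
        omega
      · simp only [Ex.val_mod, Ex.val_reg, h14, hE.N, ← hx]
        exact hxN
    · simp only [Ex.val_sub, Ex.val_div, Ex.val_reg, Ex.val_lit, h14, hE.N, hE.d, ← hc, hj,
        Nat.add_sub_cancel]
      omega
    · rw [val_tabAt hE]
      simp only [Ex.val_add, Ex.val_sub, Ex.val_div, Ex.val_mod, Ex.val_reg, Ex.val_lit, h14,
        hE.N, hE.d, ← hc, ← hx, hj, Nat.add_sub_cancel, e1]
      exact hgx
    · rw [e1, e2, row_succ]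

theorem coreStm_spec {ℓ : ℕ} (ha : Acts L.n L.d g) (h1 : s.reg 1 = L.n) (h2 : s.reg 2 = L.d)
    (hI : Input L g s) (hℓ : 0 < ℓ) (hℓ' : 2 * L.d ^ ℓ ≤ L.sq + 2 * L.d) :
    Tri L.w L.S coreStm s (200 * L.T + 700 * (L.n * L.d * (Nat.log 2 L.n + 1)) +
      4 * L.n * (80 * (L.n / ℓ) + 160)) fun s' =>
        ((∃ σ, IsIso L.n L.d g σ) → s'.reg 0 = 1) ∧
        ((¬ ∃ σ, IsIso L.n L.d g σ) → s'.reg 0 = 0) := by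
  obtain ⟨l1, l2, l3, l4, l5, l6, l7, l8, l9, l10, l11, l12, l13, l14⟩ := L.facts
  have htb := L.htb
  have eNd : L.N * L.d = L.n * L.d + L.n * L.d := by rw [l3]; ring
  have hNT : 5 * L.N ≤ 2 * L.T := by
    have : 3 * L.N ≤ (L.sq + L.d + 1) * L.N := Nat.mul_le_mul_right _ (by omega)
    rw [← L.hT] at this
    omega
  refine Tri.mono (T := (20 * L.n + 20) + (60 + ((5 + 7 * L.T + ∑ _k ∈ Finset.range L.T, 100) +
    ((5 + 7 * L.N + ∑ _k ∈ Finset.range L.N, 6) + (6 + (700 * (L.n * L.d * (Nat.log 2 L.n + 1)) +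
      4 * L.n * (80 * (L.n / ℓ) + 160))))))) (Tri.bind (sqrtStm_spec h1) ?_) ?_ fun _ h => h
  · rintro s1 ⟨m1, e12⟩ f1
    refine Tri.bind (layoutStm_spec (by rw [f1 1 (by decide), h1]) (by rw [f1 2 (by decide), h2])
      e12) ?_
    rintro s2 ⟨m2, hE2⟩ -
    have hm2 : s2.mem = s.mem := by rw [m2, m1]
    refine Tri.bind (R := Tab L g) (Tri.forTo (fun p s' => (∀ a < L.tb, s'.mem a = s.mem a) ∧
      ∀ q < p, s'.mem (L.tb + q) = row L.d g (q / L.N) (q % L.N)) _ L.T hE2.T (by decide) (by omega)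
      ⟨fun a _ => by rw [NState.set_mem, hm2], by simp⟩ ?_ ?_) ?_
    · rintro p hp s' hf h14 ⟨hlow, hT⟩
      have hE' := hE2.frame hf (by decide)
      have hI' : Input L g s' := by
        intro j hj x hx
        have hjn : (j + 1) * L.n ≤ L.d * L.n := Nat.mul_le_mul_right _ hj
        rw [Nat.add_mul, Nat.mul_comm L.d] at hjn
        rw [hlow _ (by omega), hlow _ (by omega)]
        exact hI j hj x hx
      refine (cellStm_spec ha hE' hI' h14 hp hT).mono le_rfl ?_
      rintro _ rfl
      refine ⟨fun a ha => ?_, fun q hq => ?_⟩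
      · rw [NState.set_mem, NState.put_mem_ne _ (by omega), hlow a ha]
      · rw [NState.set_mem, NState.put_mem]
        split_ifs with h
        · rw [show q = p by omega]
        · exact hT q (by omega)
    · rintro s' hf ⟨-, hT⟩ c hc x hx
      rw [hT _ (L.idx_lt hc hx), Nat.add_comm (c * L.N), Nat.add_mul_div_right _ _ (by omega),
        Nat.div_eq_of_lt hx, Nat.add_mul_mod_self_right, Nat.mod_eq_of_lt hx, Nat.zero_add]
    · rintro s3 hT3 f3
      have hE3 := hE2.frame f3 (by decide)
      refine Tri.bind (R := fun s' => Tab L g s' ∧ ∀ x < L.N, s'.mem (L.lab + x) = 1)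
        (Tri.forTo (fun p s' => (∀ a < L.lab, s'.mem a = s3.mem a) ∧
        ∀ x < p, s'.mem (L.lab + x) = 1) _ L.N hE3.N (by decide) (by omega)
        ⟨fun a _ => rfl, by simp⟩ ?_ ?_) ?_
      · rintro p hp s' hf h14 ⟨hlow, hl⟩
        have hE' := hE3.frame hf (by decide)
        refine Tri.mono (Tri.of_vc ?_) (by decide) fun _ h => h
        simp only [Stm.vc, Ex.ok_add, Ex.ok_reg, Ex.ok_lit, Ex.val_add, Ex.val_reg, Ex.val_lit, h14,
          hE'.lab]
        refine ⟨by omega, by omega, by omega, fun a ha => ?_, fun q hq => ?_⟩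
        · rw [NState.set_mem, NState.put_mem_ne _ (by omega), hlow a ha]
        · rw [NState.set_mem, NState.put_mem]
          split_ifs with h
          · rfl
          · exact hl q (by omega)
      · rintro s' - ⟨hlow, hl⟩
        exact ⟨hT3.congr hlow, hl⟩
      · rintro s4 ⟨hT4, hl4⟩ f4
        have hE4 := hE3.frame f4 (by decide)
        refine Tri.bind (R := fun s' => s' = ((s4.set 15 0).set 16 L.n).set 17 L.n)
          (Tri.mono (Tri.of_vc ?_) (show _ ≤ 6 by decide) fun _ h => h) ?_
        · simp only [Stm.vc, Ex.ok_lit, Ex.val_lit, Ex.ok_reg, Ex.val_reg, NState.set_reg]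
          simp [hE4.n, scratch]
        rintro s5 rfl -
        have hE5 : Env L (((s4.set 15 0).set 16 L.n).set 17 L.n) :=
          ((hE4.set (by norm_num)).set (by norm_num)).set (by norm_num)
        have e15 : (((s4.set 15 0).set 16 L.n).set 17 L.n).reg 15 = 0 := by simp
        have e16 : (((s4.set 15 0).set 16 L.n).set 17 L.n).reg 16 = L.n := by simp
        have e17 : (((s4.set 15 0).set 16 L.n).set 17 L.n).reg 17 = L.n := by simp
        -- At the start every point is a candidate, and the first attempt is `0 ↦ n`.
        refine roundsStm_spec ha hE5 (hT4.congr fun _ _ => rfl) ⟨?_, ?_, ?_, ?_, ?_, ?_⟩ e17.le hℓ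
          hℓ'
        · exact fun _ x hx => (hl4 x hx).le
        · rw [e15]
          exact fun _ => ⟨by omega, hl4 0 (by omega)⟩
        · rw [e16]
          exact fun _ => ⟨le_rfl, by omega, hl4 L.n (by omega)⟩
        · rw [e17]
          refine fun _ => ⟨?_, ?_, ?_⟩
          · rw [Finset.filter_true_of_mem, Finset.card_range]
            intro x hx
            have := Finset.mem_range.1 hx
            exact hl4 x (by omega)
          · rw [Finset.filter_true_of_mem, Nat.card_Ico]
            · omega
            · intro x hx
              have := Finset.mem_Ico.1 hx
              exact hl4 x (by omega)
          · intro σ hσ x hx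
            exact iff_of_true (hl4 x (by omega)) (hl4 _ (by rw [l3]; exact (hσ.map hx).2))
        · rw [e17]
          omega
        · rw [e17]
          omega
  · simp only [Finset.sum_const, Finset.card_range, smul_eq_mul]
    omega

/-- The algorithm. -/
def mainStm : Stm :=
  .seq (.seq (.assign 1 (.ld (.lit 0))) (.assign 2 (.ld (.lit 1))))
    (.ite (.lt (.lit 1) (.reg 1)) (.ite (.lt (.lit 1) (.reg 2)) coreStm (.assign 0 (.lit 1)))
      (.assign 0 (.lit 1)))

end Conj

namespace Conj

open WordRAM

variable {n d : ℕ} {a b : Fin d → Equiv.Perm (Fin n)}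

/-! ### The two actions -/

/-- The images of the points `x < n` under the first tuple, and of the points `n + x` under the
second. -/
def pairAct (a b : Fin d → Equiv.Perm (Fin n)) (j x : ℕ) : ℕ :=
  if hj : j < d then
    if hx : x < n then a ⟨j, hj⟩ ⟨x, hx⟩
    else if hx : x - n < n then n + b ⟨j, hj⟩ ⟨x - n, hx⟩ else 0
  else 0

theorem pairAct_left (j : Fin d) (x : Fin n) : pairAct a b j x = a j x := by
  simp [pairAct]

theorem pairAct_right (j : Fin d) (x : Fin n) : pairAct a b j (n + x) = n + b j x := by
  simp [pairAct]

/-- A nonempty set that is closed under the generators is everything. -/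
theorem _root_.GeneratesTransitive.forall_of_closed (h : GeneratesTransitive a) {Z : Fin n → Prop}
    {u : Fin n} (hu : Z u) (hZ : ∀ x, Z x → ∀ j, Z (a j x)) (x : Fin n) : Z x := by
  obtain ⟨⟨f, hf⟩, rfl⟩ := h.exists_smul_eq u x
  change Z (f u)
  -- In a finite group inverses are positive powers, so closure under the generators alone is
  -- enough.
  have hf' : f ∈ Submonoid.closure (Set.range a) := by
    rw [← Subgroup.closure_toSubmonoid_of_finite]
    exact hf
  clear hf
  induction hf' using Submonoid.closure_induction generalizing u with
  | mem f hf =>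
    obtain ⟨j, rfl⟩ := hf
    exact hZ u hu j
  | one => exact hu
  | mul f f' _ _ h1 h2 => exact h1 (h2 hu)

theorem acts_pairAct (ha : GeneratesTransitive a) (hb : GeneratesTransitive b) :
    Acts n d (pairAct a b) where
  left j hj x hx := by
    rw [show pairAct a b j x = _ from pairAct_left ⟨j, hj⟩ ⟨x, hx⟩]
    exact Fin.isLt _
  right j hj x hx hx' := by
    obtain ⟨y, rfl⟩ := Nat.exists_eq_add_of_le hx
    rw [show pairAct a b j (n + y) = _ from pairAct_right ⟨j, hj⟩ ⟨y, by omega⟩]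
    have := (b ⟨j, hj⟩ ⟨y, by omega⟩).isLt
    omega
  reach_left Z u hu hZu hZ x hx := by
    refine ha.forall_of_closed (Z := fun y => Z y) (u := ⟨u, hu⟩) hZu (fun y hy j => ?_) ⟨x, hx⟩
    have := hZ y y.isLt hy j j.isLt
    rwa [pairAct_left] at this
  reach_right Z u hu hu' hZu hZ x hx hx' := by
    obtain ⟨y, rfl⟩ := Nat.exists_eq_add_of_le hx
    obtain ⟨v, rfl⟩ := Nat.exists_eq_add_of_le hu
    refine hb.forall_of_closed (Z := fun y => Z (n + y)) (u := ⟨v, by omega⟩) hZu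
      (fun y hy j => ?_) ⟨y, by omega⟩
    have := hZ (n + y) (by omega) (by omega) hy j j.isLt
    rwa [pairAct_right] at this

/-- The conjugating permutation is the inverse of the isomorphism, once the right points are shifted
down by `n`. -/
theorem exists_isIso_pairAct :
    (∃ σ, IsIso n d (pairAct a b) σ) ↔ SimultaneouslyConjugate a b := by
  constructor
  · rintro ⟨σ, hσ, hg⟩
    have hlt : ∀ x : Fin n, n ≤ σ x ∧ σ x < 2 * n := fun x => hσ.mapsTo x.isLt
    let f : Fin n → Fin n := fun x => ⟨σ x - n, by have := hlt x; omega⟩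
    have hf : ∀ x : Fin n, σ x = n + f x := fun x => by
      have := hlt x
      simp only [f]
      omega
    have hinj : Function.Injective f := fun x y hxy =>
      Fin.ext (hσ.injOn x.isLt y.isLt (by rw [hf, hf, hxy]))
    let e := Equiv.ofBijective f (Finite.injective_iff_bijective.1 hinj)
    refine ⟨e⁻¹, fun j => ?_⟩
    rw [inv_inv, eq_mul_inv_iff_mul_eq]
    ext x
    have := hg j j.isLt x x.isLt
    rw [pairAct_left, hf, hf, pairAct_right] at this
    change (b j (f x) : ℕ) = f (a j x)
    omega
  · rintro ⟨τ, hτ⟩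
    have key : ∀ j x, τ⁻¹ (a j x) = b j (τ⁻¹ x) := fun j x => by rw [hτ]; simp
    let σ : ℕ → ℕ := fun x => if hx : x < n then n + τ⁻¹ ⟨x, hx⟩ else 0
    have hσ : ∀ x : Fin n, σ x = n + τ⁻¹ x := fun x => by simp [σ]
    refine ⟨σ, ⟨fun x hx => ?_, fun x hx y hy hxy => ?_, fun y hy => ?_⟩, fun j hj x hx => ?_⟩
    · rw [hσ ⟨x, hx⟩]
      simp only [Set.mem_Ico]
      omega
    · rw [hσ ⟨x, hx⟩, hσ ⟨y, hy⟩] at hxy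
      have := τ⁻¹.injective (Fin.ext (Nat.add_left_cancel hxy))
      exact congrArg Fin.val this
    · simp only [Set.mem_Ico] at hy
      refine ⟨τ ⟨y - n, by omega⟩, Fin.isLt _, ?_⟩
      rw [hσ]
      simp
      omega
    · rw [show pairAct a b j x = _ from pairAct_left ⟨j, hj⟩ ⟨x, hx⟩, hσ, hσ ⟨x, hx⟩,
        show pairAct a b j _ = _ from pairAct_right ⟨j, hj⟩ _, key]

/-- Two tuples of at most one permutation are conjugate. -/
theorem simultaneouslyConjugate_of_le_one (hn : n ≤ 1 ∨ d ≤ 1) (ha : GeneratesTransitive a)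
    (hb : GeneratesTransitive b) : SimultaneouslyConjugate a b := by
  rcases Nat.lt_or_ge 1 n with h | h
  swap
  · have : Subsingleton (Fin n) := Fin.subsingleton_iff_le_one.2 h
    exact ⟨1, fun j => Subsingleton.elim _ _⟩
  obtain rfl | rfl : d = 0 ∨ d = 1 := by omega
  · exact ⟨1, fun j => j.elim0⟩
  -- A single permutation that generates a transitive group is a cycle through all points, and two
  -- such cycles have the same cycle type.
  have cycle : ∀ c : Fin 1 → Equiv.Perm (Fin n), GeneratesTransitive c →
      (c 0).IsCycle ∧ (c 0).support = Finset.univ := by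
    intro c hc
    have hs : ∀ x y, (c 0).SameCycle x y := by
      intro x
      refine hc.forall_of_closed (Equiv.Perm.SameCycle.refl _ x) fun y hy j => ?_
      rw [Subsingleton.elim j 0]
      exact Equiv.Perm.sameCycle_apply_right.2 hy
    have hne : ∀ x, c 0 x ≠ x := by
      intro x hx
      have : Nontrivial (Fin n) := Fin.nontrivial_iff_two_le.2 h
      obtain ⟨y, hy⟩ := exists_ne x
      exact hy ((hs x y).eq_of_left hx).symm
    exact ⟨⟨⟨0, by omega⟩, hne _, fun y _ => hs _ y⟩, by ext x; simp [hne x]⟩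
  obtain ⟨a1, a2⟩ := cycle a ha
  obtain ⟨b1, b2⟩ := cycle b hb
  obtain ⟨c, hc⟩ := isConj_iff.1 (a1.isConj b1 (by rw [a2, b2]))
  refine ⟨c⁻¹, fun j => ?_⟩
  rw [Subsingleton.elim j 0, inv_inv, hc]

/-! ### The input -/

theorem getD_tupleWords (a : Fin d → Equiv.Perm (Fin n)) (l : List ℕ) (j : Fin d) (x : Fin n) :
    (tupleWords a ++ l).getD (j * n + x) 0 = a j x := by
  have h : (j + 1) * n ≤ d * n := Nat.mul_le_mul_right _ j.isLt
  rw [Nat.add_mul] at h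
  have hlt : (j * n + x : ℕ) < d * n := by omega
  rw [List.getD_append _ _ _ _ (by simpa [tupleWords] using hlt), List.getD_eq_getElem _ _
    (by simpa [tupleWords] using hlt)]
  simp only [tupleWords, List.getElem_ofFn]
  congr 3
  · ext
    simp [Fin.divNat, Nat.add_comm, Nat.add_mul_div_right _ _ x.pos, Nat.div_eq_of_lt x.isLt]
  · ext
    simp [Fin.modNat, Nat.add_comm, Nat.mod_eq_of_lt x.isLt]

theorem scpInput_mem {w : ℕ} (hn : n < 2 ^ w) (hd : d < 2 ^ w) :
    (scpInput w a b).toNat.mem 0 = n ∧ (scpInput w a b).toNat.mem 1 = d ∧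
    ∀ j < d, ∀ x < n, (scpInput w a b).toNat.mem (2 + (j * n + x)) = pairAct a b j x ∧
      (scpInput w a b).toNat.mem (2 + (n * d + (j * n + x))) + n = pairAct a b j (n + x) := by
  refine ⟨?_, ?_, fun j hj x hx => ⟨?_, ?_⟩⟩
  · simp [State.toNat, scpInput, Nat.mod_eq_of_lt hn]
  · simp [State.toNat, scpInput, Nat.mod_eq_of_lt hd]
  · have := getD_tupleWords a (tupleWords b) ⟨j, hj⟩ ⟨x, hx⟩
    simp only at this
    have hlt := (a ⟨j, hj⟩ ⟨x, hx⟩).isLt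
    simp only [State.toNat, scpInput]
    rw [Nat.add_comm, List.getD_cons_succ, List.getD_cons_succ, this, BitVec.toNat_ofNat,
      Nat.mod_eq_of_lt (by omega)]
    exact (pairAct_left ⟨j, hj⟩ ⟨x, hx⟩).symm
  · have := getD_tupleWords b [] ⟨j, hj⟩ ⟨x, hx⟩
    simp only [List.append_nil] at this
    have hlt := (b ⟨j, hj⟩ ⟨x, hx⟩).isLt
    simp only [State.toNat, scpInput]
    have hlen : (tupleWords a).length = n * d := by simp [tupleWords, Nat.mul_comm]
    rw [Nat.add_comm 2, List.getD_cons_succ, List.getD_cons_succ,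
      List.getD_append_right _ _ _ _ (by omega), hlen, Nat.add_sub_cancel_left, this,
      BitVec.toNat_ofNat, Nat.mod_eq_of_lt (by omega), Nat.add_comm]
    exact (pairAct_right ⟨j, hj⟩ ⟨x, hx⟩).symm

/-- In the trivial cases the program reads only `n` and `d`, so two memory cells suffice. -/
theorem mainStm_spec_of_le {w : ℕ} {s : NState} (hw : 2 < 2 ^ w) (h0 : s.mem 0 ≤ 1 ∨ s.mem 1 ≤ 1) :
    Tri w 2 mainStm s 20 fun s' => s'.reg 0 = 1 := by
  have hw0 : w ≠ 0 := by
    rintro rfl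
    norm_num at hw
  refine Tri.mono (T := (3 + 3) + (2 + (max (2 + (max 0 2 + 1)) 2 + 1))) (Tri.seq (Tri.seq
    (Tri.assign (by norm_num) ?_ (Tri.assign (by norm_num) ?_ (Tri.ite ?_ (fun h => Tri.ite ?_
      (fun h' => ?_) fun h' => Tri.assign (by norm_num) ?_ ?_) fun h => Tri.assign (by norm_num)
        ?_ ?_))))) (by norm_num) fun _ h => h
  all_goals simp only [Ex.Ok, Cond.Ok, Ex.val, Cond.Holds, NState.set_reg, NState.set_mem] at *
  all_goals simp [scratch, hw0] at *
  omega

theorem mainStm_spec {w S T : ℕ} {s : NState} {Q : NState → Prop} (hS : 2 < S) (hw : S ≤ 2 ^ w)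
    (hn : 1 < s.mem 0) (hd : 1 < s.mem 1)
    (h : Tri w S coreStm ((s.set 1 (s.mem 0)).set 2 (s.mem 1)) T Q) :
    Tri w S mainStm s (T + 20) Q := by
  have hw0 : w ≠ 0 := by
    rintro rfl
    norm_num at hw
    omega
  refine Tri.mono (T := (3 + 3) + (2 + (max (2 + (max T 0 + 1)) 0 + 1))) (Tri.seq (Tri.seq
    (Tri.assign (by norm_num) ?_ (Tri.assign (by norm_num) ?_ (Tri.ite ?_ (fun _ => Tri.ite ?_
      (fun _ => h) fun h' => (h' ?_).elim) fun h' => (h' ?_).elim))))) (by omega) fun _ h => h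
  all_goals simp only [Ex.Ok, Cond.Ok, Ex.val, Cond.Holds, NState.set_reg, NState.set_mem]
  all_goals simp [scratch, hw0]
  all_goals omega

/-! ### The bounds -/

theorem rpow_three_halves {x : ℝ} (hx : 0 < x) : x ^ (3 / 2 : ℝ) = x * √x := by
  rw [Real.sqrt_eq_rpow, show (3 / 2 : ℝ) = 1 + 1 / 2 by norm_num, Real.rpow_add hx, Real.rpow_one]

theorem le_two_mul_sqrt {n sq : ℕ} (hn : 1 ≤ n) (h : ∀ k < sq, k * k < n) :
    (sq : ℝ) ≤ 2 * √n := by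
  have h1 : 1 ≤ √(n : ℝ) := Real.one_le_sqrt.2 (by exact_mod_cast hn)
  rcases Nat.eq_zero_or_pos sq with rfl | hs
  · simp
  obtain ⟨k, rfl⟩ : ∃ k, sq = k + 1 := ⟨sq - 1, by omega⟩
  have h2 : (k : ℝ) ≤ √n := by
    apply Real.le_sqrt_of_sq_le
    have := h k (by omega)
    rw [pow_two]
    exact_mod_cast this.le
  push_cast
  linarith

/-- The length of the words in the table. -/
theorem exists_wordLength {n d sq : ℕ} (hn : 2 ≤ n) (hd : 2 ≤ d) (hsq : n ≤ sq * sq) :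
    ∃ ℓ : ℕ, 0 < ℓ ∧ 2 * d ^ ℓ ≤ sq + 2 * d ∧ Real.log n ≤ 6 * ℓ * Real.log d := by
  have hs0 : sq ≠ 0 := by
    rintro rfl
    omega
  have hld : 0 < Real.log d := Real.log_pos (by exact_mod_cast hd)
  have hlog : Real.log n ≤ 2 * Real.log sq := by
    rw [← Nat.cast_two, ← Real.log_pow]
    refine Real.log_le_log (by positivity) ?_
    rw [pow_two]
    exact_mod_cast hsq
  have hk : Real.log sq ≤ (Nat.log d sq + 1 : ℕ) * Real.log d := by
    rw [← Real.log_pow]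
    refine Real.log_le_log (by positivity) ?_
    exact_mod_cast (Nat.lt_pow_succ_log_self (by omega) sq).le
  -- One letter fewer than the logarithm leaves d^(ℓ+1) ≤ sq, and so 2 d^ℓ ≤ sq because `d ≥ 2`. If
  -- this would give 0, length 1 is allowed by the summand `2 * d`. The factor 6 is 2 from `n ≤ sq *
  -- sq` times 3 from `log + 1 ≤ 3 * ℓ`.
  refine ⟨max 1 (Nat.log d sq - 1), by omega, ?_, ?_⟩
  · rcases Nat.lt_or_ge (Nat.log d sq) 2 with h | h
    · rw [max_eq_left (by omega), pow_one]
      omega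
    · rw [max_eq_right (by omega)]
      have h1 : d ^ (Nat.log d sq) ≤ sq := Nat.pow_log_le_self d hs0
      obtain ⟨k, hk⟩ : ∃ k, Nat.log d sq = k + 1 := ⟨Nat.log d sq - 1, by omega⟩
      rw [hk, pow_succ] at h1
      rw [hk, Nat.add_sub_cancel]
      have h2 : d ^ k * 2 ≤ d ^ k * d := Nat.mul_le_mul_left _ hd
      omega
  · have h3 : ((Nat.log d sq + 1 : ℕ) : ℝ) ≤ 3 * (max 1 (Nat.log d sq - 1) : ℕ) := by
      exact_mod_cast (by omega : Nat.log d sq + 1 ≤ 3 * max 1 (Nat.log d sq - 1))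
    have := mul_le_mul_of_nonneg_right h3 hld.le
    linarith

/-- The first term of the bound absorbs the word evaluations, of order n · n/ℓ, and the table part n
· sq, since sq · log n = O(n) and log d ≥ log 2. The second term absorbs dn and the searches. -/
theorem time_le {n d sq ℓ : ℕ} (hn : 2 ≤ n) (hd : 2 ≤ d) (hs : (sq : ℝ) ≤ 2 * √n) (hℓ : 0 < ℓ)
    (hlog : Real.log n ≤ 6 * ℓ * Real.log d) :
    ((200 * ((sq + d + 1) * (2 * n)) + 700 * (n * d * (Nat.log 2 n + 1)) +
      4 * n * (80 * (n / ℓ) + 160) + 20 : ℕ) : ℝ) ≤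
      10000 * ((n : ℝ) ^ 2 * Real.log d / Real.log n + d * n * Real.log n) := by
  have hn' : (2 : ℝ) ≤ n := by exact_mod_cast hn
  have hd' : (2 : ℝ) ≤ d := by exact_mod_cast hd
  have l2 : (0.69 : ℝ) ≤ Real.log 2 := by linarith [Real.log_two_gt_d9]
  have hln : Real.log 2 ≤ Real.log n := Real.log_le_log (by norm_num) hn'
  have hld : Real.log 2 ≤ Real.log d := Real.log_le_log (by norm_num) hd'
  have hln0 : 0 < Real.log n := by linarith
  set X := (n : ℝ) ^ 2 * Real.log d / Real.log n with hX
  set Y := (d : ℝ) * n * Real.log n with hY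
  have hnd : (n : ℝ) ≤ d * n := by nlinarith
  have hY1 : (d : ℝ) * n ≤ 2 * Y := by
    have : (d * n : ℝ) * 0.69 ≤ d * n * Real.log n :=
      mul_le_mul_of_nonneg_left (by linarith) (by positivity)
    linarith
  have hY2 : (n : ℝ) * d * (Nat.log 2 n + 1) ≤ 4 * Y := by
    have h1 : (Nat.log 2 n : ℝ) * Real.log 2 ≤ Real.log n := by
      rw [← Real.log_pow]
      refine Real.log_le_log (by positivity) ?_
      exact_mod_cast Nat.pow_log_le_self 2 (by omega : n ≠ 0)
    have h2 : (Nat.log 2 n : ℝ) ≤ 2 * Real.log n := by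
      have h0 : (0 : ℝ) ≤ Nat.log 2 n := Nat.cast_nonneg _
      nlinarith
    have h3 : (Nat.log 2 n + 1 : ℝ) ≤ 4 * Real.log n := by linarith
    calc (n : ℝ) * d * (Nat.log 2 n + 1) ≤ n * d * (4 * Real.log n) :=
          mul_le_mul_of_nonneg_left h3 (by positivity)
      _ = 4 * Y := by rw [hY]; ring
  have hX1 : (n : ℝ) * sq ≤ 8 * X := by
    have hsqrt : 0 < √(n : ℝ) := Real.sqrt_pos.2 (by linarith)
    have hlog2 : Real.log n ≤ 2 * √(n : ℝ) := by
      have h1 := Real.log_le_sub_one_of_pos hsqrt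
      rw [Real.log_sqrt (by linarith)] at h1
      linarith
    have h2 : (sq : ℝ) * Real.log n ≤ 4 * n := by
      calc (sq : ℝ) * Real.log n ≤ (2 * √n) * (2 * √n) :=
            mul_le_mul hs hlog2 hln0.le (by positivity)
        _ = 4 * (√n * √n) := by ring
        _ = 4 * n := by rw [Real.mul_self_sqrt (by linarith)]
    rw [hX, ← mul_div_assoc, le_div_iff₀ hln0]
    have h3 : (n : ℝ) * (4 * n) ≤ 8 * (n ^ 2 * Real.log d) := by
      have : (n : ℝ) ^ 2 * 0.69 ≤ n ^ 2 * Real.log d :=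
        mul_le_mul_of_nonneg_left (by linarith) (by positivity)
      nlinarith
    calc (n : ℝ) * sq * Real.log n = n * (sq * Real.log n) := by ring
      _ ≤ n * (4 * n) := mul_le_mul_of_nonneg_left h2 (by positivity)
      _ ≤ _ := h3
  have hX2 : (n : ℝ) * (n / ℓ : ℕ) ≤ 6 * X := by
    have hℓ' : (0 : ℝ) < ℓ := by exact_mod_cast hℓ
    have h1 : ((n / ℓ : ℕ) : ℝ) ≤ n / ℓ := Nat.cast_div_le
    have h2 : (n : ℝ) / ℓ ≤ 6 * (n * Real.log d / Real.log n) := by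
      rw [← mul_div_assoc, div_le_div_iff₀ hℓ' hln0]
      calc (n : ℝ) * Real.log n ≤ n * (6 * ℓ * Real.log d) :=
            mul_le_mul_of_nonneg_left hlog (by positivity)
        _ = _ := by ring
    calc (n : ℝ) * (n / ℓ : ℕ) ≤ n * (6 * (n * Real.log d / Real.log n)) :=
          mul_le_mul_of_nonneg_left (h1.trans h2) (by positivity)
      _ = 6 * X := by rw [hX]; ring
  push_cast
  have e : (200 * ((sq + d + 1) * (2 * n)) + 700 * (n * d * (Nat.log 2 n + 1)) +
      4 * n * (80 * ((n / ℓ : ℕ) : ℝ) + 160) + 20 : ℝ) = 400 * (n * sq) + 400 * (d * n) + 1040 * n +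
      700 * (n * d * (Nat.log 2 n + 1)) + 320 * (n * (n / ℓ : ℕ)) + 20 := by ring
  rw [e]
  nlinarith

/-- The algorithm is correct and stays within the bounds. -/
theorem exists_exec {n d : ℕ} (hn : 1 ≤ n) {a b : Fin d → Equiv.Perm (Fin n)}
    (ha : GeneratesTransitive a) (hb : GeneratesTransitive b) {w : ℕ}
    (hw : (10000 : ℝ) * ((n : ℝ) ^ (3 / 2 : ℝ) + d * n) ≤ 2 ^ w) :
    ∃ (S t : ℕ) (s : State w), Exec S mainStm.compile (scpInput w a b) t s ∧
      (SimultaneouslyConjugate a b → s.reg 0 = 1) ∧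
      (¬ SimultaneouslyConjugate a b → s.reg 0 = 0) ∧
      (2 ≤ n → (t : ℝ) ≤
        10000 * ((n : ℝ) ^ 2 * Real.log d / Real.log n + d * n * Real.log n)) ∧
      (S : ℝ) ≤ 10000 * ((n : ℝ) ^ (3 / 2 : ℝ) + d * n) := by
  have hn1 : (1 : ℝ) ≤ n := by exact_mod_cast hn
  have hd0 : (0 : ℝ) ≤ d := Nat.cast_nonneg d
  have hsq1 : 1 ≤ √(n : ℝ) := Real.one_le_sqrt.2 hn1
  have hdn : (d : ℝ) ≤ d * n := by nlinarith
  have hnn : (n : ℝ) ≤ n * √n := by nlinarith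
  rw [rpow_three_halves (by linarith)] at hw ⊢
  have hwn : n < 2 ^ w := by
    have : (n : ℝ) < 2 ^ w := by nlinarith
    exact_mod_cast this
  have hwd : d < 2 ^ w := by
    have : (d : ℝ) < 2 ^ w := by nlinarith
    exact_mod_cast this
  have hw2 : 2 < 2 ^ w := by
    have : (2 : ℝ) < 2 ^ w := by nlinarith
    exact_mod_cast this
  obtain ⟨m0, m1, mg⟩ := scpInput_mem (a := a) (b := b) hwn hwd
  have reg_one : ∀ s : State w, s.toNat.reg 0 = 1 → s.reg 0 = 1 := fun s h => by
    apply BitVec.eq_of_toNat_eq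
    simp only [State.toNat, scratch, Nat.ofNat_pos, if_true] at h
    rw [h]
    exact (Nat.mod_eq_of_lt (by omega : 1 < 2 ^ w)).symm
  have reg_zero : ∀ s : State w, s.toNat.reg 0 = 0 → s.reg 0 = 0 := fun s h => by
    apply BitVec.eq_of_toNat_eq
    simp only [State.toNat, scratch, Nat.ofNat_pos, if_true] at h
    rw [h]
    simp
  by_cases h : n ≤ 1 ∨ d ≤ 1
  · obtain ⟨t, s, x, ht, h1⟩ := mainStm_spec_of_le hw2 (by rwa [m0, m1]) _ rfl
    refine ⟨2, t, s, x, fun _ => reg_one s h1,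
      fun h' => (h' (simultaneouslyConjugate_of_le_one h ha hb)).elim, fun hn2 => ?_,
      by push_cast; nlinarith⟩
    have hn2' : (2 : ℝ) ≤ n := by exact_mod_cast hn2
    have l2 : (0.69 : ℝ) ≤ Real.log 2 := by linarith [Real.log_two_gt_d9]
    have hln : Real.log 2 ≤ Real.log n := Real.log_le_log (by norm_num) hn2'
    have hd1 : d = 1 := by
      rcases Nat.eq_zero_or_pos d with rfl | h'
      · have : (0 : ℕ) = 1 := congrArg Fin.val
          (ha.forall_of_closed (Z := fun y => (⟨0, by omega⟩ : Fin n) = y) rfl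
            (fun _ _ j => j.elim0) ⟨1, by omega⟩)
        omega
      · omega
    have ht' : (t : ℝ) ≤ 20 := by exact_mod_cast ht
    subst hd1
    simp only [Nat.cast_one, Real.log_one, mul_zero, zero_div, zero_add, one_mul]
    nlinarith
  push Not at h
  obtain ⟨hn2, hd2⟩ := h
  have hex : ∃ k, n ≤ k * k := ⟨n, Nat.le_mul_self n⟩
  classical
  obtain ⟨sq, hsq, hsq'⟩ : ∃ sq, n ≤ sq * sq ∧ ∀ k < sq, k * k < n :=
    ⟨Nat.find hex, Nat.find_spec hex, fun k hk => not_le.1 (Nat.find_min hex hk)⟩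
  have hs := le_two_mul_sqrt hn hsq'
  obtain ⟨ℓ, hℓ, hℓ', hlog⟩ := exists_wordLength hn2 hd2 hsq
  -- The sum of the lengths of all arrays: input 2 + 2dn, table 2n(sq + d + 1), labels 2n, four
  -- arrays of n cells, stack 2n + 2.
  obtain ⟨S, hS⟩ : ∃ S, S = 4 + 4 * (d * n) + 2 * (n * sq) + 10 * n := ⟨_, rfl⟩
  have hSR : (S : ℝ) ≤ 10000 * (n * √n + d * n) := by
    rw [hS]
    push_cast
    nlinarith
  have hSw : S ≤ 2 ^ w := by
    have := hSR.trans hw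
    exact_mod_cast this
  let L : Layout :=
    { w := w, n := n, d := d, sq := sq, N := 2 * n, T := (sq + d + 1) * (2 * n),
      tb := 2 + 2 * n * d, lab := 2 + 2 * n * d + (sq + d + 1) * (2 * n),
      tau := _, par := _, lt := _, Q := _, stk := _, S := S,
      hn := hn2, hd := hd2, hN := rfl, hT := rfl, htb := rfl, hlab := rfl, htau := rfl,
      hpar := rfl, hlt := rfl, hQ := rfl, hstk := rfl, hS := by rw [hS]; ring,
      hSw := hSw, hsq := hsq, hsq' := hsq' }
  have core := coreStm_spec (L := L) (ℓ := ℓ) (s := (((scpInput w a b).toNat.set 1 n).set 2 d))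
    (acts_pairAct ha hb) (by simp [L]) (by simp [L]) (fun j hj x hx => mg j hj x hx) hℓ hℓ'
  obtain ⟨t, s, x, ht, h1, h0⟩ := mainStm_spec (w := w) (S := S) (by omega) hSw
    (by rw [m0]; exact hn2) (by rw [m1]; exact hd2) (by rw [m0, m1]; exact core) _ rfl
  rw [exists_isIso_pairAct] at h1 h0
  refine ⟨S, t, s, x, fun h => reg_one s (h1 h), fun h => reg_zero s (h0 h), fun _ => ?_, hSR⟩
  refine le_trans ?_ (time_le hn2 hd2 hs hℓ hlog)
  exact_mod_cast ht

end Conj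

theorem theorem1 :
    ∃ (P : WordRAM.Program) (C : ℝ), 0 < C ∧
      ∀ (n d : ℕ), 1 ≤ n →
      ∀ a b : Fin d → Equiv.Perm (Fin n), GeneratesTransitive a → GeneratesTransitive b →
      -- the words are long enough to address the memory
      ∀ w : ℕ, C * ((n : ℝ) ^ (3 / 2 : ℝ) + d * n) ≤ 2 ^ w →
      ∃ (S t : ℕ) (s : WordRAM.State w),
        WordRAM.Exec S P (scpInput w a b) t s ∧
        (SimultaneouslyConjugate a b → s.reg 0 = 1) ∧
        (¬ SimultaneouslyConjugate a b → s.reg 0 = 0) ∧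
        (2 ≤ n →
          (t : ℝ) ≤ C * ((n : ℝ) ^ 2 * Real.log d / Real.log n + d * n * Real.log n)) ∧
        (S : ℝ) ≤ C * ((n : ℝ) ^ (3 / 2 : ℝ) + d * n) :=
  ⟨Conj.mainStm.compile, 10000, by norm_num, fun _ _ hn _ _ ha hb _ hw =>
    Conj.exists_exec hn ha hb hw⟩
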